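/- Let $d\in\mathbb N$, $\kappa,T>0$ and $p\ge 1$. There is a constant $C=C(\kappa,d,T,p)>0$ with the following property. Let $b:\mathbb R_+\times\mathbb R^d\to\mathbb R^d$ be Borel measurable with $$\langle x-y,\,b(s,x)-b(s,y)\rangle\le\kappa|x-y|^2,\qquad |b(s,x)|\le\kappa(1+|x|)\qquad\text{for all } s\ge 0,\ x,y\in\mathbb R^d .$$ Put $H_b(t,x,w):=\lim_{\delta\downarrow0}\operatorname{ess\,sup}_{|y-x|\le\delta}\langle b(t,y),w\rangle$ and $A^b_{t,x}:=\{v\in\mathbb R^d:\langle v,w\rangle\le H_b(t,x,w)\ \text{for all } w\in\mathbb R^d\}$. A Filippov solution of $\dot X_t=b(t,X_t)$ starting from $x_0$ is a curve $(X_t)_{t\ge0}$ in $\mathbb R^d$, absolutely continuous on every $[0,R]$, with $X_0=x_0$ and $\dot X_t\in A^b_{t,X_t}$ for Lebesgue-almost every $t\ge0$. For every $x_0\in\mathbb R^d$ there is exactly one Filippov solution starting from $x_0$. Let $T_1,T_2,\dots$ be i.i.d. exponential random variables of parameter $1$ on a probability space $(\Omega,\mathcal F,\mathbb P)$, let $S_n=T_1+\dots+T_n$,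 $\mathcal N_t=\max\{n\ge 0:S_n\le t\}$, and $\mathcal N^\varepsilon_t=\mathcal N_{t/\varepsilon}$. Let $\mathcal F_0\subset\mathcal F$ be a $\sigma$-field independent of $(T_k)_{k\ge1}$, let $\xi\in\bigcap_{1<q<\infty}L^q(\Omega,\mathcal F_0,\mathbb P;\mathbb R^d)$, and let $(X_t)_{t\ge0}$ be the unique Filippov solution with $X_0=\xi$, i.e. for almost every $\omega$ the path $X_\cdot(\omega)$ is the Filippov solution starting from $\xi(\omega)$. Then for every $\varepsilon\in(0,1)$ the equation $$X^\varepsilon_t=\xi+\varepsilon\int_0^t b(s,X^\varepsilon_{s-})\,\mathrm d\mathcal N^\varepsilon_s=\xi+\varepsilon\sum_{0<s\le t}b(s,X^\varepsilon_{s-})\,(\mathcal N^\varepsilon_s-\mathcal N^\varepsilon_{s-}),\qquad t\ge0,\ \text{a.s.},$$ has a solution, and every solution $X^\varepsilon$ satisfies $$\mathbb E\Big(\sup_{t\in[0,T]}|X^\varepsilon_t-X_t|^{2p}\Big)\le C\,(1+\mathbb E|\xi|^{2p})\,\varepsilon^p .$$ -/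

import Mathlib

open MeasureTheory ProbabilityTheory Set Filter Topology
open scoped ENNReal

noncomputable section

/-- The one-sided Lipschitz and linear growth condition with constant `κ`, at every time `s ≥ 0`
and all points of `ℝ^d`. Continuity of `b` is not required. -/
structure OneSidedLipschitzGrowth {d : ℕ} (κ : ℝ)
    (b : ℝ → EuclideanSpace ℝ (Fin d) → EuclideanSpace ℝ (Fin d)) : Prop where
  oneSided : ∀ s : ℝ, 0 ≤ s → ∀ x y : EuclideanSpace ℝ (Fin d),
    inner ℝ (x - y) (b s x - b s y) ≤ κ * ‖x - y‖ ^ 2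
  growth : ∀ s : ℝ, 0 ≤ s → ∀ x : EuclideanSpace ℝ (Fin d), ‖b s x‖ ≤ κ * (1 + ‖x‖)

/-- The essential supremum of `y ↦ ⟨b(t,y), w⟩` over the closed ball of radius `δ` about `x`,
with respect to Lebesgue measure, as an extended real number. -/
def ballEssSup {d : ℕ} (b : ℝ → EuclideanSpace ℝ (Fin d) → EuclideanSpace ℝ (Fin d))
    (t : ℝ) (x w : EuclideanSpace ℝ (Fin d)) (δ : ℝ) : EReal :=
  essSup (fun y => ((inner ℝ (b t y) w : ℝ) : EReal)) (volume.restrict (Metric.closedBall x δ))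

/-- The supporting function `H_b(t,x,w) = lim_{δ ↓ 0} ess sup_{|y-x| ≤ δ} ⟨b(t,y), w⟩`. The
essential supremum is monotone in `δ`, so that the limit is the infimum over `δ > 0`
(see `tendsto_ballEssSup`). -/
def filippovSupport {d : ℕ} (b : ℝ → EuclideanSpace ℝ (Fin d) → EuclideanSpace ℝ (Fin d))
    (t : ℝ) (x w : EuclideanSpace ℝ (Fin d)) : EReal :=
  ⨅ δ ∈ Ioi (0 : ℝ), ballEssSup b t x w δ

theorem tendsto_ballEssSup {d : ℕ}
    (b : ℝ → EuclideanSpace ℝ (Fin d) → EuclideanSpace ℝ (Fin d))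
    (t : ℝ) (x w : EuclideanSpace ℝ (Fin d)) :
    Tendsto (ballEssSup b t x w) (𝓝[>] 0) (𝓝 (filippovSupport b t x w)) := by
  have hm : Monotone (ballEssSup b t x w) := fun δ δ' h =>
    essSup_mono_measure' (Measure.restrict_mono (Metric.closedBall_subset_closedBall h) le_rfl)
  have h := hm.tendsto_nhdsGT 0
  rwa [sInf_image] at h

/-- The essential convex hull `A^b_{t,x}` of `b(t,·)` at `x`. -/
def filippovSet {d : ℕ} (b : ℝ → EuclideanSpace ℝ (Fin d) → EuclideanSpace ℝ (Fin d))
    (t : ℝ) (x : EuclideanSpace ℝ (Fin d)) : Set (EuclideanSpace ℝ (Fin d)) :=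
  {v | ∀ w : EuclideanSpace ℝ (Fin d), ((inner ℝ v w : ℝ) : EReal) ≤ filippovSupport b t x w}

/-- `X` (only its values at times `t ≥ 0` matter) is a Filippov solution of `X' = b(t, X)` starting
from `x₀`: an absolutely continuous curve with `X'_t ∈ A^b_{t,X_t}` for almost every `t ≥ 0`. -/
structure IsFilippovSolution {d : ℕ}
    (b : ℝ → EuclideanSpace ℝ (Fin d) → EuclideanSpace ℝ (Fin d))
    (x₀ : EuclideanSpace ℝ (Fin d)) (X : ℝ → EuclideanSpace ℝ (Fin d)) : Prop where
  initial : X 0 = x₀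
  absolutelyContinuous : ∀ R : ℝ, 0 ≤ R → AbsolutelyContinuousOnInterval X 0 R
  inclusion : ∀ᵐ t ∂(volume.restrict (Ioi (0 : ℝ))),
    ∃ v ∈ filippovSet b t (X t), HasDerivAt X v t

/-- The arrival times `S_n = T_1 + ⋯ + T_n`, `S_0 = 0`; the waiting time `T_{k+1}` is `τ k`. -/
def arrivalTime {Ω : Type*} (τ : ℕ → Ω → ℝ) (n : ℕ) (ω : Ω) : ℝ :=
  ∑ k ∈ Finset.range n, τ k ω

/-- The counting process `N_t = max {n : S_n ≤ t}`. For i.i.d. exponential waiting times the set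
is almost surely bounded for every `t ≥ 0`. -/
def poissonProcess {Ω : Type*} (τ : ℕ → Ω → ℝ) (t : ℝ) (ω : Ω) : ℕ :=
  sSup {n : ℕ | arrivalTime τ n ω ≤ t}

/-- The time-changed process `N^ε_t = N_{t/ε}`, of intensity `1/ε`, with real values. -/
def scaledPoisson {Ω : Type*} (τ : ℕ → Ω → ℝ) (ε t : ℝ) (ω : Ω) : ℝ :=
  (poissonProcess τ (t / ε) ω : ℝ)

/-- The pathwise integral `∫_0^t f(s) dN_s = ∑_{0 < s ≤ t} f(s) (N_s - N_{s-})` against a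
path `N` that is a step function with finitely many jumps in `(0, t]`. -/
def stepIntegral {d : ℕ} (N : ℝ → ℝ) (f : ℝ → EuclideanSpace ℝ (Fin d)) (t : ℝ) :
    EuclideanSpace ℝ (Fin d) :=
  ∑ᶠ s ∈ Ioc (0 : ℝ) t, (N s - Function.leftLim N s) • f s

/-- The process `Y` solves `Y_t = ξ + ε ∫_0^t b(s, Y_{s-}) dN^ε_s` for all `t ≥ 0`, almost
surely. -/
def SolvesPoissonSDE {d : ℕ} {Ω : Type*} [MeasurableSpace Ω] (P : Measure Ω)
    (b : ℝ → EuclideanSpace ℝ (Fin d) → EuclideanSpace ℝ (Fin d)) (τ : ℕ → Ω → ℝ) (ε : ℝ)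
    (ξ : Ω → EuclideanSpace ℝ (Fin d)) (Y : ℝ → Ω → EuclideanSpace ℝ (Fin d)) : Prop :=
  ∀ᵐ ω ∂P, ∀ t : ℝ, 0 ≤ t →
    Y t ω = ξ ω + ε • stepIntegral (fun s => scaledPoisson τ ε s ω)
      (fun s => b s (Function.leftLim (fun r => Y r ω) s)) t

end

/-! ### Absolutely continuous functions -/

section AbsolutelyContinuous

variable {F : Type*} [NormedAddCommGroup F]

/-! Filippov solutions. The one-sided Lipschitz bound survives passage to the Filippov set: a vector
`v` of the set at `x` satisfies it against `b t y` for every `y`, and then against every vector of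
the set at `y`. Gronwall's inequality gives uniqueness and Lipschitz dependence on the starting
point. Conversely (Minty's trick, `mem_filippovSet`), a vector that satisfies the bound against `b t
y` for almost every `y` lies in the set. Existence follows without any continuity of `b`: Euler
polygons, built with time averages of `b` over each mesh interval, form a Cauchy sequence by the
one-sided bound; their limit satisfies an integrated one-sided inequality against each fixed `y`;
differentiating it and exchanging null sets by Fubini gives the inclusion.

Rate. A solution of the Poisson equation is the Euler scheme `z ↦ z + ε • b(θ, z)` run along the
jump times `θ` (`randomEuler`). Over one exponential waiting time the drift of `X` is compensated in
mean by the jump of the scheme. The two first-order terms combine into `⟨X - z, v - b(θ, z)⟩` at the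
same time `θ`, with `v` in the Filippov set at `X`, and the one-sided bound applies to this
directly. Regularity of `b` is therefore never needed, and the `2(m+1)`-th power of the distance
gains only an error of order `ε ^ (m + 2)` per step (`exists_lintegral_norm_pow_le`).

There are about `1 / ε` steps, so the total should be of order `ε ^ (m + 1)`. This is made exact by
a discounted Lyapunov function, the distance power plus `ε ^ (m + 1)` times a growth weight. The
discount of the weight over one step pays for the error just described, for the growth of the weight
itself, and for a further term controlling the motion of `X` between two jumps
(`exists_lintegral_lyapunov_le`). The Lyapunov process is thus a nonnegative supermartingale with
initial value `N = ε ^ (m + 1) * (1 + 2‖ξ‖) ^ (2(m+1))`.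

Its supremum obeys a weak-type maximal inequality, which controls moments of order `θ < 1`. With `θ
= p / (m + 1)` and `m > p`, the `θ`-th moment of the supremum is at most a constant times `E N ^ θ`,
that is, `ε ^ p * E (1 + 2‖ξ‖) ^ (2p)`. -/

theorem AbsolutelyContinuousOnInterval.norm {f : ℝ → F} {a b : ℝ}
    (hf : AbsolutelyContinuousOnInterval f a b) :
    AbsolutelyContinuousOnInterval (fun t => ‖f t‖) a b := by
  rw [absolutelyContinuousOnInterval_iff] at hf ⊢
  intro ε hε
  obtain ⟨δ, hδ, h⟩ := hf ε hε
  refine ⟨δ, hδ, fun E hE hlt => lt_of_le_of_lt (Finset.sum_le_sum fun i _ => ?_) (h E hE hlt)⟩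
  exact (dist_eq_norm (f _) (f _)).symm ▸ dist_norm_norm_le _ _

theorem absolutelyContinuousOnInterval_const {X : Type*} [PseudoMetricSpace X] (c : X) (a b : ℝ) :
    AbsolutelyContinuousOnInterval (fun _ => c) a b := by
  rw [absolutelyContinuousOnInterval_iff]
  intro ε hε
  exact ⟨1, one_pos, fun E _ _ => by simpa using hε⟩

theorem AbsolutelyContinuousOnInterval.pow {f : ℝ → ℝ} {a b : ℝ}
    (hf : AbsolutelyContinuousOnInterval f a b) (n : ℕ) :
    AbsolutelyContinuousOnInterval (fun t => f t ^ n) a b := by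
  induction n with
  | zero => simpa using absolutelyContinuousOnInterval_const (1 : ℝ) a b
  | succ n ih => simpa only [pow_succ] using! ih.fun_mul hf

theorem absolutelyContinuousOnInterval_exp_mul (c a b : ℝ) :
    AbsolutelyContinuousOnInterval (fun t => Real.exp (c * t)) a b := by
  apply ContDiffOn.absolutelyContinuousOnInterval
  fun_prop

theorem absolutelyContinuousOnInterval_id (a b : ℝ) :
    AbsolutelyContinuousOnInterval (fun t : ℝ => t) a b := by
  apply ContDiffOn.absolutelyContinuousOnInterval
  fun_prop

/-- The fundamental theorem of calculus as an inequality. -/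
theorem AbsolutelyContinuousOnInterval.sub_le_integral {f h : ℝ → ℝ} {a b : ℝ} (hab : a ≤ b)
    (hf : AbsolutelyContinuousOnInterval f a b) (hh : IntervalIntegrable h volume a b)
    (hder : ∀ᵐ t, t ∈ Ioo a b → ∃ f', HasDerivAt f f' t ∧ f' ≤ h t) :
    f b - f a ≤ ∫ t in a..b, h t := by
  rw [← hf.integral_deriv_eq_sub]
  refine intervalIntegral.integral_mono_ae_restrict hab hf.intervalIntegrable_deriv hh ?_
  rw [Filter.EventuallyLE, ae_restrict_iff' measurableSet_Icc]
  have h1 : ∀ᵐ x : ℝ, x ≠ a := by simp [ae_iff, measure_singleton]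
  have h2 : ∀ᵐ x : ℝ, x ≠ b := by simp [ae_iff, measure_singleton]
  filter_upwards [hder, h1, h2] with t ht hta htb hmem
  obtain ⟨f', hf', hle⟩ := ht ⟨lt_of_le_of_ne hmem.1 (Ne.symm hta), lt_of_le_of_ne hmem.2 htb⟩
  rwa [hf'.deriv]

theorem AbsolutelyContinuousOnInterval.le_of_deriv_nonpos {f : ℝ → ℝ} {a b : ℝ} (hab : a ≤ b)
    (hf : AbsolutelyContinuousOnInterval f a b)
    (hder : ∀ᵐ t, t ∈ Ioo a b → ∃ f', HasDerivAt f f' t ∧ f' ≤ 0) :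
    f b ≤ f a := by
  have := hf.sub_le_integral hab (h := fun _ => 0) (by simp) hder
  simpa using this

/-- Gronwall's inequality for absolutely continuous functions. -/
theorem AbsolutelyContinuousOnInterval.gronwall {f : ℝ → ℝ} {R c k : ℝ} (hR : 0 ≤ R) (hc : 0 ≤ c)
    (hk : 0 ≤ k) (hf : AbsolutelyContinuousOnInterval f 0 R)
    (hder : ∀ᵐ t, t ∈ Ioo 0 R → ∃ f', HasDerivAt f f' t ∧ f' ≤ c * f t + k) :
    f R ≤ Real.exp (c * R) * (f 0 + k * R) := by
  -- Integrating factor. As `exp (-c t) ≤ 1` and `k ≥ 0`, the forcing contributes at most `k` to the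
  -- derivative, so subtracting `k * t` makes the function nonincreasing.
  have hac : AbsolutelyContinuousOnInterval
      (fun t => Real.exp ((-c) * t) * f t - k * t) 0 R :=
    ((absolutelyContinuousOnInterval_exp_mul (-c) 0 R).fun_mul hf).fun_sub
      ((absolutelyContinuousOnInterval_id 0 R).const_mul k)
  have key := hac.le_of_deriv_nonpos hR (by
    filter_upwards [hder] with t ht hmem
    obtain ⟨f', hf', hle⟩ := ht hmem
    refine ⟨_, ((((hasDerivAt_id t).const_mul (-c)).exp.mul hf').sub
      ((hasDerivAt_id t).const_mul k)), ?_⟩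
    have h1 : Real.exp (-c * t) ≤ 1 := Real.exp_le_one_iff.2 (by nlinarith [hmem.1])
    have h2 : 0 < Real.exp (-c * t) := Real.exp_pos _
    simp only [id]
    nlinarith [mul_le_mul_of_nonneg_left hle h2.le, mul_nonneg hk (sub_nonneg.2 h1)])
  simp only [mul_zero, Real.exp_zero, one_mul, sub_zero] at key
  have h3 : Real.exp (c * R) * Real.exp (-c * R) = 1 := by rw [← Real.exp_add]; simp
  have h4 : Real.exp (-c * R) * f R ≤ f 0 + k * R := by linarith
  calc f R = Real.exp (c * R) * (Real.exp (-c * R) * f R) := by rw [← mul_assoc, h3, one_mul]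
    _ ≤ _ := by gcongr

theorem ae_restrict_Ioi_iff {q : ℝ → Prop} :
    (∀ᵐ t ∂(volume.restrict (Ioi (0 : ℝ))), q t) ↔ ∀ᵐ t : ℝ, 0 < t → q t := by
  rw [ae_restrict_iff' measurableSet_Ioi]; rfl

end AbsolutelyContinuous

section InnerProduct

variable {F : Type*} [NormedAddCommGroup F] [InnerProductSpace ℝ F]

theorem hasDerivAt_norm_sub_sq {f g : ℝ → F} {f' g' : F} {t : ℝ} (hf : HasDerivAt f f' t)
    (hg : HasDerivAt g g' t) :
    HasDerivAt (fun s => ‖f s - g s‖ ^ 2) (2 * inner ℝ (f t - g t) (f' - g')) t :=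
  (hf.sub hg).norm_sq

/-- An absolutely continuous curve whose velocity is bounded by `K` is `K`-Lipschitz. -/
theorem AbsolutelyContinuousOnInterval.norm_sub_le {f : ℝ → F} {a b K : ℝ} (hab : a ≤ b)
    (hf : AbsolutelyContinuousOnInterval f a b)
    (hder : ∀ᵐ t, t ∈ Ioo a b → ∃ f', HasDerivAt f f' t ∧ ‖f'‖ ≤ K) :
    ‖f b - f a‖ ≤ K * (b - a) := by
  set w := f b - f a with hw
  -- Pairing with the increment `w` itself reduces the claim to the scalar inequality `‖w‖ ^ 2 ≤ ‖w‖
  -- * K * (b - a)`.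
  have hac : AbsolutelyContinuousOnInterval (fun t => inner ℝ w (f t)) a b := by
    rw [absolutelyContinuousOnInterval_iff] at hf ⊢
    intro ε hε
    obtain ⟨δ, hδ, h⟩ := hf (ε / (‖w‖ + 1)) (by positivity)
    refine ⟨δ, hδ, fun E hE hlt => ?_⟩
    have h1 := h E hE hlt
    have hpos : 0 < ‖w‖ + 1 := by positivity
    rw [lt_div_iff₀ hpos, Finset.sum_mul] at h1
    refine lt_of_le_of_lt (Finset.sum_le_sum fun i _ => ?_) h1
    rw [Real.dist_eq, ← inner_sub_right, dist_eq_norm]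
    calc |inner ℝ w (f (E.2 i).1 - f (E.2 i).2)| ≤ ‖w‖ * ‖f (E.2 i).1 - f (E.2 i).2‖ :=
          abs_real_inner_le_norm _ _
      _ ≤ _ := by nlinarith [norm_nonneg (f (E.2 i).1 - f (E.2 i).2)]
  have h := hac.sub_le_integral hab (h := fun _ => ‖w‖ * K) (by simp) (by
    filter_upwards [hder] with t ht hmem
    obtain ⟨f', hf', hle⟩ := ht hmem
    refine ⟨inner ℝ w f', by simpa using (hasDerivAt_const t w).inner ℝ hf', ?_⟩
    exact (real_inner_le_norm _ _).trans (by gcongr))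
  rw [← inner_sub_right, ← hw, real_inner_self_eq_norm_sq, intervalIntegral.integral_const,
    smul_eq_mul] at h
  -- `K` is not assumed nonnegative. When `w = 0` its sign is read off at one point of the interval
  -- where the velocity bound holds.
  rcases (norm_nonneg w).eq_or_lt with h0 | h0
  · rcases hab.eq_or_lt with rfl | hlt
    · rw [← h0]; simp
    · have hne : (volume (Ioo a b)) ≠ 0 := by simp [hlt]
      obtain ⟨t, ht, hmem⟩ : ∃ t, (t ∈ Ioo a b → ∃ f', HasDerivAt f f' t ∧ ‖f'‖ ≤ K) ∧
          t ∈ Ioo a b := by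
        by_contra! hcon
        refine hne (measure_mono_null (fun t ht => ?_) (ae_iff.1 hder))
        intro hh
        exact hcon t hh ht
      obtain ⟨f', -, hle⟩ := ht hmem
      rw [← h0]
      exact mul_nonneg ((norm_nonneg _).trans hle) (sub_nonneg.2 hab)
  · nlinarith

end InnerProduct

/-! ### The Filippov set of a one-sided Lipschitz field -/

section FilippovSet

variable {d : ℕ} {κ : ℝ} {b : ℝ → EuclideanSpace ℝ (Fin d) → EuclideanSpace ℝ (Fin d)}
  {t : ℝ} {x y v u : EuclideanSpace ℝ (Fin d)}

/-- A continuous upper bound for `⟨b(t,·), w⟩` bounds `⟨v, w⟩` for `v` in the Filippov set. -/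
theorem inner_le_of_mem_filippovSet (hv : v ∈ filippovSet b t x) {w : EuclideanSpace ℝ (Fin d)}
    {β : EuclideanSpace ℝ (Fin d) → ℝ} (hβ : Continuous β)
    (hle : ∀ z, inner ℝ (b t z) w ≤ β z) : inner ℝ v w ≤ β x := by
  refine le_of_forall_pos_le_add fun η hη => ?_
  have hev : ∀ᶠ z in 𝓝 x, β z < β x + η :=
    hβ.continuousAt.eventually_lt continuousAt_const (by linarith)
  obtain ⟨δ, hδ, hsub⟩ := Metric.nhds_basis_closedBall.eventually_iff.1 hev
  have h1 : ballEssSup b t x w δ ≤ ((β x + η : ℝ) : EReal) := by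
    refine essSup_le_of_ae_le _ ?_
    filter_upwards [ae_restrict_mem Metric.isClosed_closedBall.measurableSet] with z hz
    exact EReal.coe_le_coe_iff.2 ((hle z).trans (hsub hz).le)
  have h2 : ((inner ℝ v w : ℝ) : EReal) ≤ ((β x + η : ℝ) : EReal) :=
    ((hv w).trans (iInf₂_le δ hδ)).trans h1
  exact EReal.coe_le_coe_iff.1 h2

/-- Write `⟨b(z), x - y⟩ = ⟨b(z), z - y⟩ + ⟨b(z), x - z⟩`. The first term is bounded through the
hypothesis on `u`, the second by linear growth; the resulting bound is continuous in `z`, and its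
growth term vanishes at `z = x`. The vector `u` is left free so that the lemma can be used twice:
with `u = b t y`, then with `u` in the Filippov set at `y`, whose hypothesis is the first use with
the roles of the points exchanged. -/
theorem OneSidedLipschitzGrowth.inner_sub_le_of_forall (hb : OneSidedLipschitzGrowth κ b)
    (ht : 0 ≤ t) (hv : v ∈ filippovSet b t x)
    (hu : ∀ z, inner ℝ (z - y) (b t z - u) ≤ κ * ‖z - y‖ ^ 2) :
    inner ℝ (x - y) (v - u) ≤ κ * ‖x - y‖ ^ 2 := by
  have key := inner_le_of_mem_filippovSet hv (w := x - y)
    (β := fun z => inner ℝ u (z - y) + κ * ‖z - y‖ ^ 2 + κ * (1 + ‖z‖) * ‖x - z‖)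
    (by fun_prop) (fun z => by
      have h1 : inner ℝ (b t z) (x - y) = inner ℝ (z - y) (b t z - u) + inner ℝ u (z - y)
          + inner ℝ (b t z) (x - z) := by
        have h3 : inner ℝ (z - y) (b t z - u) = inner ℝ (b t z) (z - y) - inner ℝ u (z - y) := by
          rw [inner_sub_right, real_inner_comm (b t z), real_inner_comm u]
        rw [h3]
        simp only [inner_sub_right]; ring
      have h2 : inner ℝ (b t z) (x - z) ≤ κ * (1 + ‖z‖) * ‖x - z‖ :=
        (real_inner_le_norm _ _).trans (by gcongr; exact hb.growth t ht z)
      linarith [hu z])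
  simp only [sub_self, norm_zero, mul_zero, add_zero] at key
  rw [inner_sub_right, real_inner_comm v, real_inner_comm u]
  linarith

/-- The Filippov set is contained in the maximal monotone extension of the field. -/
theorem OneSidedLipschitzGrowth.inner_sub_le_of_mem (hb : OneSidedLipschitzGrowth κ b)
    (ht : 0 ≤ t) (hv : v ∈ filippovSet b t x) (y : EuclideanSpace ℝ (Fin d)) :
    inner ℝ (x - y) (v - b t y) ≤ κ * ‖x - y‖ ^ 2 :=
  hb.inner_sub_le_of_forall ht hv fun z => hb.oneSided t ht z y

theorem OneSidedLipschitzGrowth.inner_sub_le_of_mem_of_mem (hb : OneSidedLipschitzGrowth κ b)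
    (ht : 0 ≤ t) (hv : v ∈ filippovSet b t x) (hu : u ∈ filippovSet b t y) :
    inner ℝ (x - y) (v - u) ≤ κ * ‖x - y‖ ^ 2 :=
  hb.inner_sub_le_of_forall ht hv fun z => by
    have := hb.inner_sub_le_of_mem ht hu z
    rwa [norm_sub_rev, ← inner_neg_neg, neg_sub, neg_sub] at this

theorem OneSidedLipschitzGrowth.norm_le_of_mem (hb : OneSidedLipschitzGrowth κ b)
    (ht : 0 ≤ t) (hv : v ∈ filippovSet b t x) : ‖v‖ ≤ κ * (1 + ‖x‖) := by
  have key := inner_le_of_mem_filippovSet hv (w := v)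
    (β := fun z => κ * (1 + ‖z‖) * ‖v‖) (by fun_prop)
    (fun z => (real_inner_le_norm _ _).trans (by gcongr; exact hb.growth t ht z))
  rw [real_inner_self_eq_norm_sq] at key
  rcases (norm_nonneg v).eq_or_lt with h0 | h0
  · rw [← h0]; exact (norm_nonneg _).trans (hb.growth t ht x)
  · nlinarith

/-- A vector satisfying the one-sided Lipschitz bound against almost all values of the field
belongs to the Filippov set. -/
theorem OneSidedLipschitzGrowth.mem_filippovSet (hb : OneSidedLipschitzGrowth κ b) (hκ : 0 < κ)
    (ht : 0 ≤ t) (hv : ∀ᵐ y, inner ℝ (x - y) (v - b t y) ≤ κ * ‖x - y‖ ^ 2) :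
    v ∈ filippovSet b t x := by
  intro w
  refine le_iInf₂ fun δ hδ => ?_
  have hδ : 0 < δ := hδ
  refine EReal.ge_of_forall_gt_iff_ge.1 fun c hc => ?_
  have hc : inner ℝ v w > c := by simpa using hc
  -- Minty's trick: test the inequality at points `y` near `x - s • w` and divide by `s`. `K` bounds
  -- `‖v - b t y‖`. The radius `s * ρ` of the ball of test points makes the directional error `ρ * K
  -- = η / 2`, and `s` is so small that this ball stays within distance `δ` of `x` and the quadratic
  -- term is at most `η / 2`.
  set η := inner ℝ v w - c with hη_def
  have hη : 0 < η := by linarith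
  set K := ‖v‖ + κ * (1 + ‖x‖ + δ) with hK_def
  have hK : 0 < K := by positivity
  set ρ := η / (2 * K) with hρ_def
  have hρ : 0 < ρ := by positivity
  have hwρ : 0 < ‖w‖ + ρ := by positivity
  set s := min (δ / (‖w‖ + ρ)) (η / (2 * κ * (‖w‖ + ρ) ^ 2)) with hs_def
  have hs : 0 < s := lt_min (by positivity) (by positivity)
  have hs1 : s * (‖w‖ + ρ) ≤ δ := (le_div_iff₀ hwρ).1 (min_le_left _ _)
  have hs2 : s * (2 * κ * (‖w‖ + ρ) ^ 2) ≤ η := (le_div_iff₀ (by positivity)).1 (min_le_right _ _)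
  have hsub : Metric.ball (x - s • w) (s * ρ) ⊆ Metric.closedBall x δ := by
    intro y hy
    rw [Metric.mem_closedBall, dist_eq_norm]
    rw [Metric.mem_ball, dist_eq_norm] at hy
    have : y - x = (y - (x - s • w)) - s • w := by abel
    rw [this]
    refine (norm_sub_le _ _).trans ?_
    rw [norm_smul, Real.norm_of_nonneg hs.le]
    nlinarith
  have hpos : volume (Metric.ball (x - s • w) (s * ρ)) ≠ 0 :=
    (Metric.measure_ball_pos volume _ (by positivity)).ne'
  have hae : ∀ᵐ y, y ∈ Metric.closedBall x δ →
      ((inner ℝ (b t y) w : ℝ) : EReal) ≤ ballEssSup b t x w δ :=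
    (ae_restrict_iff' Metric.isClosed_closedBall.measurableSet).1 ae_le_essSup
  -- Both the hypothesis and the bound by the essential supremum hold only almost everywhere, so the
  -- test point is taken from a ball of positive measure instead of being `x - s • w`.
  obtain ⟨y, hyb, hy1, hy2⟩ : ∃ y, y ∈ Metric.ball (x - s • w) (s * ρ) ∧
      inner ℝ (x - y) (v - b t y) ≤ κ * ‖x - y‖ ^ 2 ∧
      ((inner ℝ (b t y) w : ℝ) : EReal) ≤ ballEssSup b t x w δ := by
    by_contra! hcon
    refine hpos (measure_mono_null (fun y hy => ?_) (ae_iff.1 (hv.and hae)))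
    intro hh
    exact absurd (hh.2 (hsub hy)) (not_le.2 (hcon y hy hh.1))
  refine le_trans (EReal.coe_le_coe_iff.2 ?_) hy2
  set e := x - y - s • w with he_def
  have he : ‖e‖ < s * ρ := by
    rw [Metric.mem_ball, dist_eq_norm, ← norm_neg] at hyb
    have h0 : e = -(y - (x - s • w)) := by rw [he_def]; abel
    rwa [h0]
  have hxy : x - y = s • w + e := by rw [he_def]; abel
  have hnxy : ‖x - y‖ ≤ s * (‖w‖ + ρ) := by
    rw [hxy]
    refine (norm_add_le _ _).trans ?_
    rw [norm_smul, Real.norm_of_nonneg hs.le]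
    linarith
  have hyn : ‖y‖ ≤ ‖x‖ + δ := by
    have : y = x - (x - y) := by abel
    rw [this]
    exact (norm_sub_le _ _).trans (by linarith)
  have hvb : ‖v - b t y‖ ≤ K := by
    refine (norm_sub_le _ _).trans ?_
    have h1 := hb.growth t ht y
    have h2 : κ * (1 + ‖y‖) ≤ κ * (1 + ‖x‖ + δ) := by
      apply mul_le_mul_of_nonneg_left _ hκ.le; linarith
    linarith
  have h1 : s * inner ℝ w (v - b t y) + inner ℝ e (v - b t y) ≤ κ * (s * (‖w‖ + ρ)) ^ 2 := by
    rw [hxy, inner_add_left, real_inner_smul_left, ← hxy] at hy1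
    exact hy1.trans (by gcongr)
  have h2 : -(s * ρ * K) ≤ inner ℝ e (v - b t y) := by
    have := abs_real_inner_le_norm e (v - b t y)
    have h3 : ‖e‖ * ‖v - b t y‖ ≤ s * ρ * K := by gcongr
    linarith [neg_abs_le (inner ℝ e (v - b t y))]
  have h3 : inner ℝ w (v - b t y) ≤ κ * s * (‖w‖ + ρ) ^ 2 + ρ * K := by
    have : s * inner ℝ w (v - b t y) ≤ s * (κ * s * (‖w‖ + ρ) ^ 2 + ρ * K) := by nlinarith
    exact le_of_mul_le_mul_left this hs
  have h4 : ρ * K = η / 2 := by rw [hρ_def]; field_simp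
  have h5 : inner ℝ w (v - b t y) = inner ℝ v w - inner ℝ (b t y) w := by
    rw [inner_sub_right, real_inner_comm v, real_inner_comm (b t y)]
  nlinarith

end FilippovSet

/-! ### Stability and growth of Filippov solutions -/

section Stability

variable {d : ℕ} {κ : ℝ} {b : ℝ → EuclideanSpace ℝ (Fin d) → EuclideanSpace ℝ (Fin d)}
  {x₀ y₀ : EuclideanSpace ℝ (Fin d)} {X Y : ℝ → EuclideanSpace ℝ (Fin d)}

theorem IsFilippovSolution.ae_hasDerivAt (hX : IsFilippovSolution b x₀ X) :
    ∀ᵐ t : ℝ, 0 < t → ∃ v ∈ filippovSet b t (X t), HasDerivAt X v t :=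
  ae_restrict_Ioi_iff.1 hX.inclusion

theorem IsFilippovSolution.absolutelyContinuousOnInterval (hX : IsFilippovSolution b x₀ X)
    {s t : ℝ} (hs : 0 ≤ s) (hst : s ≤ t) : AbsolutelyContinuousOnInterval X s t :=
  (hX.absolutelyContinuous t (hs.trans hst)).mono (by
    rw [uIcc_of_le hst, uIcc_of_le (hs.trans hst)]; exact Icc_subset_Icc_left hs)

/-- The velocities lie in the two Filippov sets, so the derivative of `‖X - Y‖ ^ 2` is at most `2 *
κ * ‖X - Y‖ ^ 2` almost everywhere. Besides uniqueness this provides the continuity in the starting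
point that makes the flow measurable. -/
theorem IsFilippovSolution.norm_sub_sq_le (hb : OneSidedLipschitzGrowth κ b) (hκ : 0 < κ)
    (hX : IsFilippovSolution b x₀ X) (hY : IsFilippovSolution b y₀ Y) {t : ℝ} (ht : 0 ≤ t) :
    ‖X t - Y t‖ ^ 2 ≤ Real.exp (2 * κ * t) * ‖x₀ - y₀‖ ^ 2 := by
  have hac := ((hX.absolutelyContinuous t ht).fun_sub (hY.absolutelyContinuous t ht)).norm.pow 2
  have := hac.gronwall ht (c := 2 * κ) (k := 0) (by positivity) le_rfl (by
    filter_upwards [hX.ae_hasDerivAt, hY.ae_hasDerivAt] with s hs1 hs2 hs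
    obtain ⟨v, hv, hXv⟩ := hs1 hs.1
    obtain ⟨u, hu, hYu⟩ := hs2 hs.1
    refine ⟨_, hasDerivAt_norm_sub_sq hXv hYu, ?_⟩
    have := hb.inner_sub_le_of_mem_of_mem hs.1.le hv hu
    linarith)
  simpa [hX.initial, hY.initial] using this

theorem IsFilippovSolution.norm_sub_le (hb : OneSidedLipschitzGrowth κ b) (hκ : 0 < κ)
    (hX : IsFilippovSolution b x₀ X) (hY : IsFilippovSolution b y₀ Y) {t : ℝ} (ht : 0 ≤ t) :
    ‖X t - Y t‖ ≤ Real.exp (κ * t) * ‖x₀ - y₀‖ := by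
  refine (sq_le_sq₀ (norm_nonneg _) (by positivity)).1 ?_
  rw [mul_pow, ← Real.exp_nat_mul, show ((2 : ℕ) : ℝ) * (κ * t) = 2 * κ * t by push_cast; ring]
  exact hX.norm_sub_sq_le hb hκ hY ht

theorem IsFilippovSolution.eqOn (hb : OneSidedLipschitzGrowth κ b) (hκ : 0 < κ)
    (hX : IsFilippovSolution b x₀ X) (hY : IsFilippovSolution b x₀ Y) : EqOn X Y (Ici 0) := by
  intro t ht
  have := hX.norm_sub_le hb hκ hY ht
  rw [sub_self, norm_zero, mul_zero] at this
  exact sub_eq_zero.1 (norm_le_zero_iff.1 this)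

theorem IsFilippovSolution.norm_le (hb : OneSidedLipschitzGrowth κ b) (hκ : 0 < κ)
    (hX : IsFilippovSolution b x₀ X) {t : ℝ} (ht : 0 ≤ t) :
    1 + ‖X t‖ ≤ 2 * Real.exp (2 * κ * t) * (1 + ‖x₀‖) := by
  -- The zero curve is subtracted only to reuse `hasDerivAt_norm_sub_sq`; Gronwall is applied to
  -- `‖X‖ ^ 2 + 1`.
  have hac := ((hX.absolutelyContinuous t ht).fun_sub
    (absolutelyContinuousOnInterval_const (0 : EuclideanSpace ℝ (Fin d)) 0 t)).norm.pow 2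
  have h := (hac.fun_add (absolutelyContinuousOnInterval_const (1 : ℝ) 0 t)).gronwall ht
    (c := 4 * κ) (k := 0) (by positivity) le_rfl (by
    filter_upwards [hX.ae_hasDerivAt] with s hs1 hs
    obtain ⟨v, hv, hXv⟩ := hs1 hs.1
    refine ⟨_, (hasDerivAt_norm_sub_sq hXv (hasDerivAt_const s 0)).add_const 1, ?_⟩
    have h1 := hb.norm_le_of_mem hs.1.le hv
    have h2 := real_inner_le_norm (X s) v
    simp only [sub_zero]
    have h3 : ‖X s‖ * ‖v‖ ≤ ‖X s‖ * (κ * (1 + ‖X s‖)) := by gcongr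
    nlinarith [mul_nonneg hκ.le (sq_nonneg (‖X s‖ - 1)), sq_nonneg (‖X s‖)])
  simp only [sub_zero, zero_mul, add_zero, hX.initial] at h
  have hE : Real.exp (4 * κ * t) = Real.exp (2 * κ * t) ^ 2 := by
    rw [← Real.exp_nat_mul]; congr 1; push_cast; ring
  rw [hE] at h
  have h1 : 1 ≤ Real.exp (2 * κ * t) := Real.one_le_exp (by positivity)
  set e := Real.exp (2 * κ * t)
  have h2 : ‖X t‖ ≤ e * (1 + ‖x₀‖) := by
    refine (sq_le_sq₀ (norm_nonneg _) (by positivity)).1 ?_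
    rw [mul_pow]
    refine le_trans (by linarith : _ ≤ ‖X t‖ ^ 2 + 1) (h.trans ?_)
    gcongr
    nlinarith [norm_nonneg x₀]
  nlinarith [norm_nonneg x₀, mul_nonneg (sub_nonneg.2 h1) (norm_nonneg x₀)]

theorem IsFilippovSolution.norm_sub_le_mul (hb : OneSidedLipschitzGrowth κ b) (hκ : 0 < κ)
    (hX : IsFilippovSolution b x₀ X) {s t T : ℝ} (hs : 0 ≤ s) (hst : s ≤ t) (htT : t ≤ T) :
    ‖X t - X s‖ ≤ κ * (2 * Real.exp (2 * κ * T) * (1 + ‖x₀‖)) * (t - s) := by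
  refine (hX.absolutelyContinuousOnInterval hs hst).norm_sub_le hst ?_
  filter_upwards [hX.ae_hasDerivAt] with r hr hmem
  have hr0 : 0 < r := hs.trans_lt hmem.1
  obtain ⟨v, hv, hXv⟩ := hr hr0
  refine ⟨v, hXv, (hb.norm_le_of_mem hr0.le hv).trans ?_⟩
  gcongr
  refine (hX.norm_le hb hκ hr0.le).trans ?_
  gcongr
  linarith [hmem.2]

theorem IsFilippovSolution.continuousOn (hX : IsFilippovSolution b x₀ X) :
    ContinuousOn X (Ici 0) := by
  intro t ht
  have h1 : (0 : ℝ) ≤ t + 1 := add_nonneg ht zero_le_one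
  have h := (hX.absolutelyContinuous (t + 1) h1).continuousOn
  rw [uIcc_of_le h1] at h
  refine (h t ⟨ht, by linarith⟩).mono_of_mem_nhdsWithin ?_
  rw [← Ici_inter_Iic]
  exact inter_mem_nhdsWithin _ (Iic_mem_nhds (by linarith))

end Stability

/-! ### Euler polygons -/

section Euler

variable {d : ℕ} {κ : ℝ} {b : ℝ → EuclideanSpace ℝ (Fin d) → EuclideanSpace ℝ (Fin d)}
  {x₀ : EuclideanSpace ℝ (Fin d)} {h : ℝ}

/-- The nodes of the Euler polygon with mesh `h`. -/
noncomputable def eulerNode (b : ℝ → EuclideanSpace ℝ (Fin d) → EuclideanSpace ℝ (Fin d))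
    (x₀ : EuclideanSpace ℝ (Fin d)) (h : ℝ) : ℕ → EuclideanSpace ℝ (Fin d)
  | 0 => x₀
  | k + 1 => eulerNode b x₀ h k + ∫ s in (k * h)..((k + 1 : ℕ) * h), b s (eulerNode b x₀ h k)

/-- The piecewise constant interpolation of the nodes. -/
noncomputable def eulerStep (b : ℝ → EuclideanSpace ℝ (Fin d) → EuclideanSpace ℝ (Fin d))
    (x₀ : EuclideanSpace ℝ (Fin d)) (h s : ℝ) : EuclideanSpace ℝ (Fin d) :=
  eulerNode b x₀ h ⌊s / h⌋₊

/-- The Euler polygon. -/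
noncomputable def eulerCurve (b : ℝ → EuclideanSpace ℝ (Fin d) → EuclideanSpace ℝ (Fin d))
    (x₀ : EuclideanSpace ℝ (Fin d)) (h t : ℝ) : EuclideanSpace ℝ (Fin d) :=
  x₀ + ∫ s in (0 : ℝ)..t, b s (eulerStep b x₀ h s)

theorem intervalIntegral_norm_le_of_nonneg {f : ℝ → EuclideanSpace ℝ (Fin d)} {s t K : ℝ}
    (hst : s ≤ t) (hf : ∀ r ∈ Icc s t, ‖f r‖ ≤ K) : ‖∫ r in s..t, f r‖ ≤ K * (t - s) := by
  rw [← abs_of_nonneg (sub_nonneg.2 hst)]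
  refine intervalIntegral.norm_integral_le_of_norm_le_const fun r hr => hf r ?_
  rw [uIoc_of_le hst] at hr
  exact Ioc_subset_Icc_self hr

theorem norm_eulerNode_le (hb : OneSidedLipschitzGrowth κ b) (hκ : 0 < κ) (hh : 0 < h) (k : ℕ) :
    1 + ‖eulerNode b x₀ h k‖ ≤ Real.exp (κ * (k * h)) * (1 + ‖x₀‖) := by
  induction k with
  | zero => simp [eulerNode]
  | succ k ih =>
    have hkh : (k * h : ℝ) ≤ ((k + 1 : ℕ) : ℝ) * h := by push_cast; nlinarith
    have h0 : (0 : ℝ) ≤ k * h := by positivity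
    have h1 : ‖∫ s in (k * h)..((k + 1 : ℕ) * h), b s (eulerNode b x₀ h k)‖ ≤
        κ * (1 + ‖eulerNode b x₀ h k‖) * (((k + 1 : ℕ) : ℝ) * h - k * h) :=
      intervalIntegral_norm_le_of_nonneg hkh fun r hr => hb.growth r (h0.trans hr.1) _
    have h2 : 1 + ‖eulerNode b x₀ h (k + 1)‖ ≤ (κ * h + 1) * (1 + ‖eulerNode b x₀ h k‖) := by
      rw [eulerNode]
      refine (add_le_add_right (norm_add_le _ _) 1).trans ?_
      push_cast at h1 ⊢
      nlinarith
    refine h2.trans ?_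
    have h3 : κ * (((k + 1 : ℕ) : ℝ) * h) = κ * h + κ * (k * h) := by push_cast; ring
    rw [h3, Real.exp_add, mul_assoc]
    exact mul_le_mul (Real.add_one_le_exp _) ih (by positivity) (by positivity)

theorem norm_apply_eulerStep_le (hb : OneSidedLipschitzGrowth κ b) (hκ : 0 < κ) (hh : 0 < h)
    {s R : ℝ} (hs : s ∈ Icc 0 R) :
    ‖b s (eulerStep b x₀ h s)‖ ≤ κ * (Real.exp (κ * R) * (1 + ‖x₀‖)) := by
  refine (hb.growth s hs.1 _).trans ?_
  gcongr
  refine (norm_eulerNode_le hb hκ hh _).trans ?_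
  gcongr
  have := Nat.floor_le (div_nonneg hs.1 hh.le)
  exact ((le_div_iff₀ hh).1 this).trans hs.2

theorem measurable_apply_eulerStep (hbm : Measurable (Function.uncurry b)) :
    Measurable fun s => b s (eulerStep b x₀ h s) := by
  have h1 : Measurable (eulerStep b x₀ h) :=
    (measurable_from_nat (f := eulerNode b x₀ h)).comp
      (Nat.measurable_floor.comp (measurable_id.div_const h))
  exact hbm.comp (measurable_id.prodMk h1)

theorem intervalIntegrable_of_norm_le {F : Type*} [NormedAddCommGroup F] {f : ℝ → F} {s t K : ℝ}
    (hst : s ≤ t) (hfm : StronglyMeasurable f) (hf : ∀ r ∈ Icc s t, ‖f r‖ ≤ K) :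
    IntervalIntegrable f volume s t := by
  rw [intervalIntegrable_iff_integrableOn_Ioc_of_le hst]
  refine Measure.integrableOn_of_bounded (M := K) (by simp) hfm.aestronglyMeasurable ?_
  filter_upwards [ae_restrict_mem measurableSet_Ioc] with r hr
  exact hf r (Ioc_subset_Icc_self hr)

theorem intervalIntegrable_apply_eulerStep (hb : OneSidedLipschitzGrowth κ b) (hκ : 0 < κ)
    (hbm : Measurable (Function.uncurry b)) (hh : 0 < h) {s t : ℝ} (hs : 0 ≤ s) (hst : s ≤ t) :
    IntervalIntegrable (fun s => b s (eulerStep b x₀ h s)) volume s t :=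
  intervalIntegrable_of_norm_le hst (measurable_apply_eulerStep hbm).stronglyMeasurable fun _ hr =>
    norm_apply_eulerStep_le hb hκ hh (R := t) ⟨hs.trans hr.1, hr.2⟩

theorem eulerCurve_sub (hb : OneSidedLipschitzGrowth κ b) (hκ : 0 < κ)
    (hbm : Measurable (Function.uncurry b)) (hh : 0 < h) {s t : ℝ} (hs : 0 ≤ s) (hst : s ≤ t) :
    eulerCurve b x₀ h t - eulerCurve b x₀ h s = ∫ r in s..t, b r (eulerStep b x₀ h r) := by
  rw [eulerCurve, eulerCurve, add_sub_add_left_eq_sub]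
  exact intervalIntegral.integral_interval_sub_left
    (intervalIntegrable_apply_eulerStep hb hκ hbm hh le_rfl (hs.trans hst))
    (intervalIntegrable_apply_eulerStep hb hκ hbm hh le_rfl hs)

theorem norm_eulerCurve_sub_le (hb : OneSidedLipschitzGrowth κ b) (hκ : 0 < κ)
    (hbm : Measurable (Function.uncurry b)) (hh : 0 < h) {s t R : ℝ} (hs : 0 ≤ s) (hst : s ≤ t)
    (htR : t ≤ R) : ‖eulerCurve b x₀ h t - eulerCurve b x₀ h s‖ ≤
      κ * (Real.exp (κ * R) * (1 + ‖x₀‖)) * (t - s) := by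
  rw [eulerCurve_sub hb hκ hbm hh hs hst]
  exact intervalIntegral_norm_le_of_nonneg hst fun r hr =>
    norm_apply_eulerStep_le hb hκ hh ⟨hs.trans hr.1, hr.2.trans htR⟩

theorem eulerCurve_node (hb : OneSidedLipschitzGrowth κ b) (hκ : 0 < κ)
    (hbm : Measurable (Function.uncurry b)) (hh : 0 < h) (k : ℕ) :
    eulerCurve b x₀ h (k * h) = eulerNode b x₀ h k := by
  induction k with
  | zero => simp [eulerCurve, eulerNode]
  | succ k ih =>
    have hkh : (k * h : ℝ) ≤ ((k + 1 : ℕ) : ℝ) * h := by push_cast; nlinarith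
    have h1 := eulerCurve_sub (x₀ := x₀) hb hκ hbm hh (by positivity : (0 : ℝ) ≤ k * h) hkh
    rw [sub_eq_iff_eq_add', ih] at h1
    rw [h1, eulerNode]
    congr 1
    -- The floor equals `k` on the interval closed on the left and open on the right, hence the
    -- change from `Ioc` to `Ico`.
    rw [intervalIntegral.integral_of_le hkh, intervalIntegral.integral_of_le hkh,
      ← integral_Ico_eq_integral_Ioc, ← integral_Ico_eq_integral_Ioc]
    refine setIntegral_congr_fun measurableSet_Ico fun s hs => ?_
    have : ⌊s / h⌋₊ = k := by
      rw [Nat.floor_eq_iff (div_nonneg (le_trans (by positivity) hs.1) hh.le), le_div_iff₀ hh,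
        div_lt_iff₀ hh]
      exact ⟨hs.1, by simpa using hs.2⟩
    simp only [eulerStep, this]

theorem norm_eulerCurve_sub_eulerStep_le (hb : OneSidedLipschitzGrowth κ b) (hκ : 0 < κ)
    (hbm : Measurable (Function.uncurry b)) (hh : 0 < h) {t R : ℝ} (ht : t ∈ Icc 0 R) :
    ‖eulerCurve b x₀ h t - eulerStep b x₀ h t‖ ≤
      κ * (Real.exp (κ * R) * (1 + ‖x₀‖)) * h := by
  rw [eulerStep, ← eulerCurve_node hb hκ hbm hh]
  have h1 : (⌊t / h⌋₊ : ℝ) * h ≤ t :=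
    (le_div_iff₀ hh).1 (Nat.floor_le (div_nonneg ht.1 hh.le))
  have h2 : t < ((⌊t / h⌋₊ : ℝ) + 1) * h := (div_lt_iff₀ hh).1 (Nat.lt_floor_add_one _)
  refine (norm_eulerCurve_sub_le hb hκ hbm hh (by positivity) h1 ht.2).trans ?_
  gcongr
  linarith

theorem absolutelyContinuousOnInterval_of_norm_sub_le {F : Type*} [NormedAddCommGroup F]
    {f : ℝ → F} {a c K : ℝ} (hac : a ≤ c)
    (hf : ∀ s t, a ≤ s → s ≤ t → t ≤ c → ‖f t - f s‖ ≤ K * (t - s)) :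
    AbsolutelyContinuousOnInterval f a c := by
  refine LipschitzOnWith.absolutelyContinuousOnInterval (K := K.toNNReal) ?_
  rw [uIcc_of_le hac]
  refine LipschitzOnWith.of_dist_le_mul fun s hs t ht => ?_
  rcases le_total s t with hst | hst
  · rw [dist_comm, dist_eq_norm, dist_comm, Real.dist_eq, abs_of_nonneg (sub_nonneg.2 hst)]
    exact (hf s t hs.1 hst ht.2).trans
      (mul_le_mul_of_nonneg_right (Real.le_coe_toNNReal K) (sub_nonneg.2 hst))
  · rw [dist_eq_norm, Real.dist_eq, abs_of_nonneg (sub_nonneg.2 hst)]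
    exact (hf t s ht.1 hst hs.2).trans
      (mul_le_mul_of_nonneg_right (Real.le_coe_toNNReal K) (sub_nonneg.2 hst))

theorem eulerCurve_absolutelyContinuousOnInterval (hb : OneSidedLipschitzGrowth κ b) (hκ : 0 < κ)
    (hbm : Measurable (Function.uncurry b)) (hh : 0 < h) {s R : ℝ} (hs : 0 ≤ s) (hR : s ≤ R) :
    AbsolutelyContinuousOnInterval (eulerCurve b x₀ h) s R :=
  absolutelyContinuousOnInterval_of_norm_sub_le hR fun _ _ hs' hst ht =>
    norm_eulerCurve_sub_le hb hκ hbm hh (hs.trans hs') hst ht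

theorem ae_hasDerivAt_eulerCurve (hb : OneSidedLipschitzGrowth κ b) (hκ : 0 < κ)
    (hbm : Measurable (Function.uncurry b)) (hh : 0 < h) (R : ℝ) :
    ∀ᵐ t : ℝ, t ∈ Ioo 0 R →
      HasDerivAt (eulerCurve b x₀ h) (b t (eulerStep b x₀ h t)) t := by
  rcases lt_or_ge R 0 with hR | hR
  · exact ae_of_all _ fun t ht => absurd (ht.1.trans ht.2) hR.not_gt
  filter_upwards [(intervalIntegrable_apply_eulerStep (x₀ := x₀) hb hκ hbm hh le_rfl
    hR).ae_hasDerivAt_integral] with t ht hmem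
  rw [uIcc_of_le hR] at ht
  exact (ht (Ioo_subset_Icc_self hmem) 0 ⟨le_rfl, hR⟩).const_add x₀

/-- Two Euler polygons with meshes `h` and `h'` are close to each other. -/
theorem norm_eulerCurve_sub_eulerCurve_sq_le (hb : OneSidedLipschitzGrowth κ b) (hκ : 0 < κ)
    (hbm : Measurable (Function.uncurry b)) {h' : ℝ} (hh : 0 < h) (hh' : 0 < h') {t R K η : ℝ}
    (ht : t ∈ Icc 0 R) (hK : K = κ * (Real.exp (κ * R) * (1 + ‖x₀‖))) (hη : η = K * (h + h')) :
    ‖eulerCurve b x₀ h t - eulerCurve b x₀ h' t‖ ^ 2 ≤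
      Real.exp (4 * κ * R) * ((4 * κ * η ^ 2 + 4 * K * η) * R) := by
  have hK0 : 0 < K := by rw [hK]; positivity
  have hη0 : 0 < η := by rw [hη]; positivity
  have hac := ((eulerCurve_absolutelyContinuousOnInterval (x₀ := x₀) hb hκ hbm hh le_rfl
    ht.1).fun_sub (eulerCurve_absolutelyContinuousOnInterval (x₀ := x₀) hb hκ hbm hh' le_rfl
    ht.1)).norm.pow 2
  have hG := hac.gronwall ht.1 (c := 4 * κ) (k := 4 * κ * η ^ 2 + 4 * K * η) (by positivity)
    (by positivity) (by
    filter_upwards [ae_hasDerivAt_eulerCurve (x₀ := x₀) hb hκ hbm hh t,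
      ae_hasDerivAt_eulerCurve (x₀ := x₀) hb hκ hbm hh' t] with s hs1 hs2 hs
    refine ⟨_, hasDerivAt_norm_sub_sq (hs1 hs) (hs2 hs), ?_⟩
    have hsR : s ∈ Icc 0 R := ⟨hs.1.le, hs.2.le.trans ht.2⟩
    have e1 := norm_eulerCurve_sub_eulerStep_le (x₀ := x₀) hb hκ hbm hh hsR
    have e2 := norm_eulerCurve_sub_eulerStep_le (x₀ := x₀) hb hκ hbm hh' hsR
    have n1 := norm_apply_eulerStep_le (x₀ := x₀) hb hκ hh hsR
    have n2 := norm_apply_eulerStep_le (x₀ := x₀) hb hκ hh' hsR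
    have o := hb.oneSided s hs.1.le (eulerStep b x₀ h s) (eulerStep b x₀ h' s)
    rw [← hK] at e1 e2 n1 n2
    set X := eulerCurve b x₀ h s
    set X' := eulerCurve b x₀ h' s
    set ζ := eulerStep b x₀ h s
    set ζ' := eulerStep b x₀ h' s
    have he : ‖(X - ζ) - (X' - ζ')‖ ≤ η := by
      rw [hη]; exact (norm_sub_le _ _).trans (by linarith)
    -- The velocities are the values of `b` at the frozen points `ζ`, `ζ'`, so the one-sided bound
    -- is applied there. The lag of size `η` is paired with a velocity difference of size at most `2
    -- * K`.
    have hXX : X - X' = (ζ - ζ') + ((X - ζ) - (X' - ζ')) := by abel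
    have hζζ : ζ - ζ' = (X - X') - ((X - ζ) - (X' - ζ')) := by abel
    have h1 : ‖ζ - ζ'‖ ≤ ‖X - X'‖ + η := by
      rw [hζζ]; exact (norm_sub_le _ _).trans (by linarith)
    have h2 : ‖ζ - ζ'‖ ^ 2 ≤ 2 * ‖X - X'‖ ^ 2 + 2 * η ^ 2 := by
      have := pow_le_pow_left₀ (norm_nonneg _) h1 2
      nlinarith [sq_nonneg (‖X - X'‖ - η)]
    have h3 : inner ℝ ((X - ζ) - (X' - ζ')) (b s ζ - b s ζ') ≤ η * (2 * K) := by
      refine (real_inner_le_norm _ _).trans ?_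
      have : ‖b s ζ - b s ζ'‖ ≤ 2 * K := (norm_sub_le _ _).trans (by linarith)
      gcongr
    rw [hXX, inner_add_left, ← hXX]
    nlinarith)
  have h0 : ‖eulerCurve b x₀ h 0 - eulerCurve b x₀ h' 0‖ ^ 2 = 0 := by simp [eulerCurve]
  rw [h0, zero_add] at hG
  refine hG.trans ?_
  have := ht.2
  have := ht.1
  gcongr

end Euler

/-! ### Existence of Filippov solutions -/

section Existence

variable {d : ℕ} {κ : ℝ} {b : ℝ → EuclideanSpace ℝ (Fin d) → EuclideanSpace ℝ (Fin d)}
  {x₀ : EuclideanSpace ℝ (Fin d)}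

/-- The Euler polygons with mesh `1 / (n + 1)` converge locally uniformly. -/
theorem exists_limit_eulerCurve (hb : OneSidedLipschitzGrowth κ b) (hκ : 0 < κ)
    (hbm : Measurable (Function.uncurry b)) (x₀ : EuclideanSpace ℝ (Fin d)) :
    ∃ X : ℝ → EuclideanSpace ℝ (Fin d), ∀ R : ℝ, 0 ≤ R → ∃ B : ℕ → ℝ, Tendsto B atTop (𝓝 0) ∧
      ∀ n : ℕ, ∀ t ∈ Icc 0 R, ‖eulerCurve b x₀ (1 / ((n : ℝ) + 1)) t - X t‖ ≤ B n := by
  have hpos : ∀ n : ℕ, (0 : ℝ) < 1 / ((n : ℝ) + 1) := fun n => Nat.one_div_pos_of_nat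
  have hanti : ∀ {N n : ℕ}, N ≤ n → 1 / ((n : ℝ) + 1) ≤ 1 / ((N : ℝ) + 1) := fun h =>
    Nat.one_div_le_one_div h
  let K : ℝ → ℝ := fun R => κ * (Real.exp (κ * R) * (1 + ‖x₀‖))
  let C : ℝ → ℝ → ℝ := fun R η => Real.exp (4 * κ * R) * ((4 * κ * η ^ 2 + 4 * K R * η) * R)
  let B : ℝ → ℕ → ℝ := fun R N => √(C R (K R * (1 / ((N : ℝ) + 1) + 1 / ((N : ℝ) + 1))))
  have hK : ∀ R, 0 < K R := fun R => by positivity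
  have hB : ∀ R, Tendsto (B R) atTop (𝓝 0) := by
    intro R
    have h1 := tendsto_one_div_add_atTop_nhds_zero_nat (𝕜 := ℝ)
    have hcont : Continuous fun z : ℝ => √(C R (K R * (z + z))) := by fun_prop
    have h2 : Tendsto (B R) atTop (𝓝 (√(C R (K R * (0 + 0))))) := (hcont.tendsto 0).comp h1
    have h3 : √(C R (K R * (0 + 0))) = 0 := by simp [C]
    rwa [h3] at h2
  have hdist : ∀ R, 0 ≤ R → ∀ t ∈ Icc 0 R, ∀ N n m : ℕ, N ≤ n → N ≤ m →
      ‖eulerCurve b x₀ (1 / ((n : ℝ) + 1)) t - eulerCurve b x₀ (1 / ((m : ℝ) + 1)) t‖ ≤ B R N := by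
    intro R hR t ht N n m hn hm
    refine Real.le_sqrt_of_sq_le ?_
    refine (norm_eulerCurve_sub_eulerCurve_sq_le hb hκ hbm (hpos n) (hpos m) ht rfl rfl).trans ?_
    have h1 := hanti hn
    have h2 := hanti hm
    have h3 := hpos n
    have h4 := hpos m
    have h5 := hK R
    simp only [C]
    gcongr
  have hlim : ∀ t : ℝ, 0 ≤ t → ∃ x, Tendsto (fun n : ℕ => eulerCurve b x₀ (1 / ((n : ℝ) + 1)) t)
      atTop (𝓝 x) := by
    intro t ht
    refine cauchySeq_tendsto_of_complete (cauchySeq_of_le_tendsto_0 (B t) (fun n m N hn hm => ?_)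
      (hB t))
    rw [dist_eq_norm]
    exact hdist t ht t ⟨ht, le_rfl⟩ N n m hn hm
  choose! X hX using hlim
  refine ⟨X, fun R hR => ⟨B R, hB R, fun n t ht => ?_⟩⟩
  refine le_of_tendsto ((tendsto_const_nhds.sub (hX t ht.1)).norm) ?_
  filter_upwards [eventually_ge_atTop n] with m hm
  exact hdist R hR t ht n n m le_rfl hm

theorem limit_eulerCurve_zero {X : ℝ → EuclideanSpace ℝ (Fin d)} {R : ℝ} (hR : 0 ≤ R) {B : ℕ → ℝ}
    (hB : Tendsto B atTop (𝓝 0))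
    (hX : ∀ n : ℕ, ∀ t ∈ Icc 0 R, ‖eulerCurve b x₀ (1 / ((n : ℝ) + 1)) t - X t‖ ≤ B n) :
    X 0 = x₀ := by
  have h : ∀ n, ‖x₀ - X 0‖ ≤ B n := fun n => by simpa [eulerCurve] using hX n 0 ⟨le_rfl, hR⟩
  have := ge_of_tendsto' hB h
  exact (sub_eq_zero.1 (norm_le_zero_iff.1 this)).symm

theorem norm_limit_eulerCurve_sub_le (hb : OneSidedLipschitzGrowth κ b) (hκ : 0 < κ)
    (hbm : Measurable (Function.uncurry b)) {X : ℝ → EuclideanSpace ℝ (Fin d)} {R : ℝ} {B : ℕ → ℝ}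
    (hB : Tendsto B atTop (𝓝 0))
    (hX : ∀ n : ℕ, ∀ t ∈ Icc 0 R, ‖eulerCurve b x₀ (1 / ((n : ℝ) + 1)) t - X t‖ ≤ B n)
    (s t : ℝ) (hs : 0 ≤ s) (hst : s ≤ t) (ht : t ≤ R) :
    ‖X t - X s‖ ≤ κ * (Real.exp (κ * R) * (1 + ‖x₀‖)) * (t - s) := by
  have h : ∀ n, ‖X t - X s‖ ≤ κ * (Real.exp (κ * R) * (1 + ‖x₀‖)) * (t - s) + (B n + B n) := by
    intro n
    have h1 := hX n t ⟨hs.trans hst, ht⟩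
    have h2 := hX n s ⟨hs, hst.trans ht⟩
    have h3 := norm_eulerCurve_sub_le (x₀ := x₀) hb hκ hbm (Nat.one_div_pos_of_nat (n := n))
      hs hst ht
    set E := eulerCurve b x₀ (1 / ((n : ℝ) + 1))
    have : X t - X s = (E t - E s) - (E t - X t) + (E s - X s) := by abel
    rw [this]
    refine (norm_add_le _ _).trans ?_
    have := norm_sub_le (E t - E s) (E t - X t)
    linarith
  refine ge_of_tendsto' (f := fun n => κ * (Real.exp (κ * R) * (1 + ‖x₀‖)) * (t - s) +
    (B n + B n)) (x := atTop) ?_ h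
  simpa using (tendsto_const_nhds (x := κ * (Real.exp (κ * R) * (1 + ‖x₀‖)) * (t - s))).add
    (hB.add hB)

/-- The integrated one-sided inequality against a fixed point `y` for the limit of the Euler
polygons. -/
theorem limit_eulerCurve_norm_sub_sq_le (hb : OneSidedLipschitzGrowth κ b) (hκ : 0 < κ)
    (hbm : Measurable (Function.uncurry b)) {X : ℝ → EuclideanSpace ℝ (Fin d)} {R : ℝ}
    {B : ℕ → ℝ} (hB : Tendsto B atTop (𝓝 0)) (hXc : Continuous X)
    (hX : ∀ n : ℕ, ∀ t ∈ Icc 0 R, ‖eulerCurve b x₀ (1 / ((n : ℝ) + 1)) t - X t‖ ≤ B n)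
    (y : EuclideanSpace ℝ (Fin d)) {s t : ℝ} (hs : 0 ≤ s) (hst : s ≤ t) (ht : t ≤ R)
    (hG : IntervalIntegrable (fun r => 2 * inner ℝ (X r - y) (b r y) + 2 * κ * ‖X r - y‖ ^ 2)
      volume s t) :
    ‖X t - y‖ ^ 2 - ‖X s - y‖ ^ 2 ≤
      ∫ r in s..t, (2 * inner ℝ (X r - y) (b r y) + 2 * κ * ‖X r - y‖ ^ 2) := by
  set G : ℝ → ℝ := fun r => 2 * inner ℝ (X r - y) (b r y) + 2 * κ * ‖X r - y‖ ^ 2 with hGdef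
  obtain ⟨M, hM⟩ := (isCompact_Icc (a := s) (b := t)).exists_bound_of_continuousOn
    (f := fun r => X r - y) (by fun_prop)
  set K := κ * (Real.exp (κ * R) * (1 + ‖x₀‖)) with hK
  have hK0 : 0 < K := by positivity
  let h : ℕ → ℝ := fun n => 1 / ((n : ℝ) + 1)
  -- `μ n` bounds the distance from the frozen Euler point to the limit. `c n` collects three
  -- errors: replacing the polygon by its frozen point, moving the pairing with `b r y` from the
  -- frozen point to `X r`, and doing the same in the quadratic term.
  let μ : ℕ → ℝ := fun n => K * h n + B n
  let c : ℕ → ℝ := fun n =>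
    2 * (K * h n * K) + 2 * (μ n * (κ * (1 + ‖y‖))) + 2 * κ * (2 * μ n * M + μ n ^ 2)
  have hh : Tendsto h atTop (𝓝 0) := tendsto_one_div_add_atTop_nhds_zero_nat
  have hμ : Tendsto μ atTop (𝓝 0) := by simpa using (hh.const_mul K).add hB
  have hc : Tendsto c atTop (𝓝 0) := by
    have h1 : Continuous fun q : ℝ × ℝ =>
      2 * (K * q.1 * K) + 2 * (q.2 * (κ * (1 + ‖y‖))) + 2 * κ * (2 * q.2 * M + q.2 ^ 2) := by
      fun_prop
    simpa using! (h1.tendsto (0, 0)).comp (hh.prodMk_nhds hμ)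
  have key : ∀ n, ‖eulerCurve b x₀ (h n) t - y‖ ^ 2 - ‖eulerCurve b x₀ (h n) s - y‖ ^ 2 ≤
      (∫ r in s..t, G r) + c n * (t - s) := by
    intro n
    have hpos : 0 < h n := Nat.one_div_pos_of_nat
    have hac := ((eulerCurve_absolutelyContinuousOnInterval (x₀ := x₀) hb hκ hbm hpos hs
      hst).fun_sub (absolutelyContinuousOnInterval_const y s t)).norm.pow 2
    have h1 := hac.sub_le_integral hst (h := fun r => G r + c n) (hG.add (by simp)) (by
      filter_upwards [ae_hasDerivAt_eulerCurve (x₀ := x₀) hb hκ hbm hpos R] with r hr1 hr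
      have hr0 : 0 < r := hs.trans_lt hr.1
      have hrR : r ∈ Icc 0 R := ⟨hr0.le, hr.2.le.trans ht⟩
      refine ⟨_, hasDerivAt_norm_sub_sq (hr1 ⟨hr0, hr.2.trans_le ht⟩) (hasDerivAt_const r y), ?_⟩
      have e1 := norm_eulerCurve_sub_eulerStep_le (x₀ := x₀) hb hκ hbm hpos hrR
      have e2 := hX n r hrR
      have n1 := norm_apply_eulerStep_le (x₀ := x₀) hb hκ hpos hrR
      have o := hb.oneSided r hr0.le (eulerStep b x₀ (h n) r) y
      have g := hb.growth r hr0.le y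
      have m := hM r ⟨hr.1.le, hr.2.le⟩
      rw [← hK] at e1 n1
      simp only [G]
      change ‖eulerCurve b x₀ (h n) r - X r‖ ≤ B n at e2
      set E := eulerCurve b x₀ (h n) r
      set ζ := eulerStep b x₀ (h n) r
      have hμ1 : ‖ζ - X r‖ ≤ μ n := by
        have : ζ - X r = (E - X r) - (E - ζ) := by abel
        rw [this]
        exact (norm_sub_le _ _).trans (by simp only [μ]; linarith)
      have hμ0 : 0 ≤ μ n := (norm_nonneg _).trans hμ1
      have i1 : inner ℝ (E - ζ) (b r ζ) ≤ K * h n * K :=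
        (real_inner_le_norm _ _).trans (by gcongr)
      have i2 : inner ℝ (ζ - X r) (b r y) ≤ μ n * (κ * (1 + ‖y‖)) :=
        (real_inner_le_norm _ _).trans (by gcongr)
      have i3 : ‖ζ - y‖ ^ 2 ≤ ‖X r - y‖ ^ 2 + (2 * μ n * M + μ n ^ 2) := by
        have : ‖ζ - y‖ ≤ ‖X r - y‖ + μ n := by
          have : ζ - y = (X r - y) + (ζ - X r) := by abel
          rw [this]
          exact (norm_add_le _ _).trans (by linarith)
        have := pow_le_pow_left₀ (norm_nonneg _) this 2
        nlinarith [mul_le_mul_of_nonneg_left m hμ0]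
      have i4 : inner ℝ (E - y) (b r ζ - 0) = inner ℝ (E - ζ) (b r ζ) +
          inner ℝ (ζ - y) (b r ζ - b r y) + inner ℝ (ζ - X r) (b r y) + inner ℝ (X r - y) (b r y) := by
        simp only [inner_sub_left, inner_sub_right, inner_zero_right]; ring
      rw [i4]
      have i5 := mul_le_mul_of_nonneg_left i3 hκ.le
      simp only [c]
      nlinarith)
    rw [intervalIntegral.integral_add hG (by simp), intervalIntegral.integral_const,
      smul_eq_mul] at h1
    linarith
  have hconv : ∀ r ∈ Icc 0 R, Tendsto (fun n => ‖eulerCurve b x₀ (h n) r - y‖ ^ 2) atTop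
      (𝓝 (‖X r - y‖ ^ 2)) := by
    intro r hr
    refine ((Tendsto.sub_const ?_ y).norm).pow 2
    rw [tendsto_iff_norm_sub_tendsto_zero]
    exact squeeze_zero (fun _ => norm_nonneg _) (fun n => hX n r hr) hB
  refine le_of_tendsto_of_tendsto' ((hconv t ⟨hs.trans hst, ht⟩).sub
    (hconv s ⟨hs, hst.trans ht⟩)) ?_ key
  simpa using tendsto_const_nhds.add (hc.mul_const (t - s))

/-- The velocities of the Euler polygons need not converge. Instead, the integrated inequality
against a fixed `y` passes to the uniform limit, is differentiated at Lebesgue points, and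
identifies the velocity through `mem_filippovSet`. The last clause freezes the curve at negative
times, which makes it continuous on the whole line. -/
theorem OneSidedLipschitzGrowth.exists_isFilippovSolution (hb : OneSidedLipschitzGrowth κ b)
    (hκ : 0 < κ) (hbm : Measurable (Function.uncurry b)) (x₀ : EuclideanSpace ℝ (Fin d)) :
    ∃ X : ℝ → EuclideanSpace ℝ (Fin d), IsFilippovSolution b x₀ X ∧ ∀ t, X (max t 0) = X t := by
  obtain ⟨L, hL⟩ := exists_limit_eulerCurve hb hκ hbm x₀
  set X : ℝ → EuclideanSpace ℝ (Fin d) := fun t => L (max t 0) with hXdef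
  have hX : ∀ R : ℝ, 0 ≤ R → ∃ B : ℕ → ℝ, Tendsto B atTop (𝓝 0) ∧
      ∀ n : ℕ, ∀ t ∈ Icc 0 R, ‖eulerCurve b x₀ (1 / ((n : ℝ) + 1)) t - X t‖ ≤ B n := by
    intro R hR
    obtain ⟨B, hB, h⟩ := hL R hR
    refine ⟨B, hB, fun n t ht => ?_⟩
    simpa [hXdef, max_eq_left ht.1] using h n t ht
  have hlip : ∀ R : ℝ, 0 ≤ R → ∀ s t, 0 ≤ s → s ≤ t → t ≤ R →
      ‖X t - X s‖ ≤ κ * (Real.exp (κ * R) * (1 + ‖x₀‖)) * (t - s) := by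
    intro R hR
    obtain ⟨B, hB, h⟩ := hX R hR
    exact norm_limit_eulerCurve_sub_le hb hκ hbm hB h
  have hac : ∀ R : ℝ, 0 ≤ R → AbsolutelyContinuousOnInterval X 0 R := fun R hR =>
    absolutelyContinuousOnInterval_of_norm_sub_le hR (hlip R hR)
  have hXc : Continuous X := by
    have h1 : ContinuousOn X (Ici 0) := by
      intro t ht
      have h1 : (0 : ℝ) ≤ t + 1 := add_nonneg ht zero_le_one
      have h := (hac (t + 1) h1).continuousOn
      rw [uIcc_of_le h1] at h
      refine (h t ⟨ht, by linarith⟩).mono_of_mem_nhdsWithin ?_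
      rw [← Ici_inter_Iic]
      exact inter_mem_nhdsWithin _ (Iic_mem_nhds (by linarith))
    have h2 : X = X ∘ fun t => max t 0 := by
      funext t
      simp [hXdef]
    rw [h2]
    exact h1.comp_continuous (by fun_prop) fun t => le_max_right t 0
  refine ⟨X, ⟨?_, hac, ?_⟩, fun t => by simp [hXdef]⟩
  · obtain ⟨B, hB, h⟩ := hX 0 le_rfl
    exact limit_eulerCurve_zero le_rfl hB h
  -- `X` is differentiable almost everywhere
  have hdiff : ∀ᵐ t : ℝ, 0 < t → DifferentiableAt ℝ X t := by
    have h1 : ∀ n : ℕ, ∀ᵐ t : ℝ, t ∈ uIcc (0 : ℝ) n → DifferentiableAt ℝ X t := fun n =>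
      (hac n n.cast_nonneg).boundedVariationOn.ae_differentiableAt_of_mem_uIcc
    filter_upwards [ae_all_iff.2 h1] with t ht ht0
    obtain ⟨n, hn⟩ := exists_nat_ge t
    exact ht n (by rw [uIcc_of_le (Nat.cast_nonneg n)]; exact ⟨ht0.le, hn⟩)
  -- the inequality against a fixed point
  have hfix : ∀ y, ∀ᵐ t : ℝ, 0 < t →
      inner ℝ (X t - y) (deriv X t - b t y) ≤ κ * ‖X t - y‖ ^ 2 := by
    intro y
    set G : ℝ → ℝ := fun r => 2 * inner ℝ (X r - y) (b r y) + 2 * κ * ‖X r - y‖ ^ 2 with hGdef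
    have hbym : Measurable fun r => b r y := hbm.comp (measurable_id.prodMk measurable_const)
    have hG : ∀ s t : ℝ, 0 ≤ s → s ≤ t → IntervalIntegrable G volume s t := by
      intro s t hs hst
      have hXy : Continuous fun r => X r - y := by fun_prop
      obtain ⟨M, hM⟩ := (isCompact_Icc (a := s) (b := t)).exists_bound_of_continuousOn
        hXy.continuousOn
      have h1 : IntervalIntegrable (fun r => 2 * inner ℝ (X r - y) (b r y)) volume s t := by
        refine IntervalIntegrable.const_mul ?_ 2
        rw [intervalIntegrable_iff_integrableOn_Ioc_of_le hst]
        refine Measure.integrableOn_of_bounded (M := M * (κ * (1 + ‖y‖))) (by simp)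
          (hXy.measurable.inner hbym).aestronglyMeasurable ?_
        filter_upwards [ae_restrict_mem measurableSet_Ioc] with r hr
        have m := hM r (Ioc_subset_Icc_self hr)
        have g := hb.growth r (hs.trans hr.1.le) y
        have m0 := (norm_nonneg _).trans m
        exact (norm_inner_le_norm _ _).trans (by gcongr)
      exact h1.add (Continuous.intervalIntegrable (by fun_prop) _ _)
    have hLDT : ∀ᵐ t : ℝ, 0 < t → HasDerivAt (fun x => ∫ r in (0 : ℝ)..x, G r) (G t) t := by
      have h1 : ∀ n : ℕ, ∀ᵐ t : ℝ, t ∈ uIcc (0 : ℝ) n → ∀ c ∈ uIcc (0 : ℝ) n,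
          HasDerivAt (fun x => ∫ r in c..x, G r) (G t) t := fun n =>
        (hG 0 n le_rfl n.cast_nonneg).ae_hasDerivAt_integral
      filter_upwards [ae_all_iff.2 h1] with t ht ht0
      obtain ⟨n, hn⟩ := exists_nat_ge t
      exact ht n (by rw [uIcc_of_le (Nat.cast_nonneg n)]; exact ⟨ht0.le, hn⟩) 0 left_mem_uIcc
    filter_upwards [hdiff, hLDT] with t ht1 ht2 ht0
    have hder := ((hasDerivAt_norm_sub_sq (ht1 ht0).hasDerivAt (hasDerivAt_const t y))).sub
      (ht2 ht0)
    -- The integrated inequality on every subinterval says exactly that this difference is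
    -- nonincreasing; its derivative at `t` is the pointwise inequality.
    have hanti : AntitoneOn ((fun r => ‖X r - y‖ ^ 2) - fun x => ∫ r in (0 : ℝ)..x, G r)
        (Ici 0) := by
      intro p hp q hq hpq
      have hp : 0 ≤ p := hp
      have hq : 0 ≤ q := hq
      obtain ⟨B, hB, h⟩ := hX q hq
      have h1 := limit_eulerCurve_norm_sub_sq_le hb hκ hbm hB hXc h y hp hpq le_rfl (hG p q hp hpq)
      have h2 := intervalIntegral.integral_interval_sub_left (hG 0 q le_rfl hq) (hG 0 p le_rfl hp)
      change _ ≤ ∫ r in p..q, G r at h1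
      simp only [Pi.sub_apply]
      linarith
    have hle : 2 * inner ℝ (X t - y) (deriv X t - 0) - G t ≤ 0 := by
      rw [← (hder.hasDerivWithinAt (s := Ici 0)).derivWithin
        ((uniqueDiffOn_Ici 0).uniqueDiffWithinAt ht0.le)]
      exact hanti.derivWithin_nonpos
    simp only [hGdef, sub_zero] at hle
    rw [inner_sub_right]
    linarith
  have hmeas : MeasurableSet {q : ℝ × EuclideanSpace ℝ (Fin d) | 0 < q.1 →
      inner ℝ (X q.1 - q.2) (deriv X q.1 - b q.1 q.2) ≤ κ * ‖X q.1 - q.2‖ ^ 2} := by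
    have m1 : Measurable fun q : ℝ × EuclideanSpace ℝ (Fin d) => X q.1 - q.2 := by fun_prop
    have m2 : Measurable fun q : ℝ × EuclideanSpace ℝ (Fin d) => deriv X q.1 - b q.1 q.2 :=
      ((measurable_deriv X).comp measurable_fst).sub hbm
    exact (measurableSet_lt measurable_const measurable_fst).imp
      (measurableSet_le (m1.inner m2) ((m1.norm.pow_const 2).const_mul κ))
  -- The exceptional set of times depends on `y`. After the exchange there is one null set of times,
  -- outside which the inequality holds for almost every `y`, and this is all that `mem_filippovSet`
  -- asks for.
  have hswap := (Measure.ae_ae_comm (μ := (volume : Measure ℝ))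
    (ν := (volume : Measure (EuclideanSpace ℝ (Fin d))))
    (p := fun t y => 0 < t → inner ℝ (X t - y) (deriv X t - b t y) ≤ κ * ‖X t - y‖ ^ 2)
    hmeas).2 (ae_of_all _ hfix)
  rw [ae_restrict_Ioi_iff]
  filter_upwards [hswap, hdiff] with t ht1 ht2 ht0
  refine ⟨deriv X t, hb.mem_filippovSet hκ ht0.le ?_, (ht2 ht0).hasDerivAt⟩
  filter_upwards [ht1] with y hy using hy ht0

end Existence

/-! ### The Filippov flow -/

section Flow

variable {d : ℕ} {κ : ℝ} {b : ℝ → EuclideanSpace ℝ (Fin d) → EuclideanSpace ℝ (Fin d)}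

/-- The Filippov flow can be chosen jointly measurable. -/
theorem OneSidedLipschitzGrowth.exists_measurable_flow (hb : OneSidedLipschitzGrowth κ b)
    (hκ : 0 < κ) (hbm : Measurable (Function.uncurry b)) :
    ∃ Φ : ℝ → EuclideanSpace ℝ (Fin d) → EuclideanSpace ℝ (Fin d),
      Measurable (Function.uncurry Φ) ∧ ∀ x, IsFilippovSolution b x (fun t => Φ t x) := by
  choose S hS hS0 using hb.exists_isFilippovSolution hκ hbm
  refine ⟨fun t x => S x t, ?_, hS⟩
  refine measurable_uncurry_of_continuous_of_measurable (fun x => ?_) (fun t => ?_)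
  · have h : S x = S x ∘ fun t => max t 0 := funext fun t => (hS0 x t).symm
    rw [h]
    exact (hS x).continuousOn.comp_continuous (by fun_prop) fun t => le_max_right t 0
  · refine Continuous.measurable ?_
    have h : LipschitzWith (Real.exp (κ * max t 0)).toNNReal fun x => S x t := by
      refine LipschitzWith.of_dist_le_mul fun x y => ?_
      rw [dist_eq_norm, dist_eq_norm, ← hS0 x, ← hS0 y,
        Real.coe_toNNReal _ (Real.exp_pos _).le]
      exact (hS x).norm_sub_le hb hκ (hS y) (le_max_right t 0)
    exact h.continuous

end Flow

/-! ### Expansion of even powers of the norm -/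

section Power

theorem pow_mul_le_pow_succ_add {A g : ℝ} (hA : 0 ≤ A) (hg : 0 ≤ g) (m : ℕ) :
    A ^ m * g ≤ A ^ (m + 1) + g ^ (m + 1) := by
  rcases le_total g A with h | h
  · have : A ^ m * g ≤ A ^ (m + 1) := by rw [pow_succ]; gcongr
    linarith [pow_nonneg hg (m + 1)]
  · have : A ^ m * g ≤ g ^ (m + 1) := by rw [pow_succ]; gcongr
    linarith [pow_nonneg hA (m + 1)]

/-- Here `A + 2 * q + g` stands for a squared norm of a sum, and `q ^ 2 ≤ A * g` is Cauchy-Schwarz.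
The linear term in `q` is kept with its exact coefficient, since it must later cancel against the
drift. By induction: multiply by `A + 2 * q + g`; the cross terms are of second order and all mixed
powers are absorbed by the two extreme ones. -/
theorem exists_add_pow_le (m : ℕ) : ∃ C : ℝ, 0 ≤ C ∧ ∀ A g q : ℝ, 0 ≤ A → 0 ≤ g → q ^ 2 ≤ A * g →
    (A + 2 * q + g) ^ (m + 1) ≤
      A ^ (m + 1) + 2 * (m + 1) * A ^ m * q + C * (A ^ m * g + g ^ (m + 1)) := by
  induction m with
  | zero => exact ⟨1, zero_le_one, fun A g q hA hg hq => by simp; linarith⟩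
  | succ m ih =>
    obtain ⟨C, hC, h⟩ := ih
    refine ⟨6 * C + 6 * (m + 2), by positivity, fun A g q hA hg hq => ?_⟩
    have hqa : 2 * |q| ≤ A + g := by
      have h1 : |q| ^ 2 ≤ A * g := by rwa [sq_abs]
      refine (sq_le_sq₀ (by positivity) (by positivity)).1 ?_
      nlinarith [sq_nonneg (A - g)]
    have hq1 := (abs_le.1 (le_refl |q|)).1
    have hq2 := (abs_le.1 (le_refl |q|)).2
    have hN0 : 0 ≤ A + 2 * q + g := by linarith
    have hN1 : A + 2 * q + g ≤ 2 * A + 2 * g := by linarith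
    have y1 := pow_mul_le_pow_succ_add hA hg m
    have y2 := pow_mul_le_pow_succ_add hg hA m
    have hAm : 0 ≤ A ^ m := by positivity
    have hgm : 0 ≤ g ^ m := by positivity
    have e1 : A ^ m * q ^ 2 ≤ A ^ (m + 1) * g := by
      rw [pow_succ A, mul_assoc]; gcongr
    have e2 : A ^ m * g ^ 2 ≤ A ^ (m + 1) * g + g ^ (m + 2) := by
      have := mul_le_mul_of_nonneg_right y1 hg
      calc _ = A ^ m * g * g := by ring
        _ ≤ _ := this
        _ = _ := by ring
    have e3 : A * g ^ (m + 1) ≤ A ^ (m + 1) * g + g ^ (m + 2) := by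
      have := mul_le_mul_of_nonneg_right y2 hg
      calc _ = g ^ m * A * g := by ring
        _ ≤ _ := this
        _ = _ := by ring
    have e4 : A ^ m * (2 * q * g) ≤ A ^ (m + 1) * g + A ^ m * g ^ 2 := by
      calc _ ≤ A ^ m * ((A + g) * g) := by gcongr; linarith
        _ = _ := by ring
    have e5 : (A + 2 * q + g) * (C * (A ^ m * g + g ^ (m + 1))) ≤
        6 * C * (A ^ (m + 1) * g + g ^ (m + 2)) := by
      calc _ ≤ (2 * A + 2 * g) * (C * (A ^ m * g + g ^ (m + 1))) := by gcongr
        _ = 2 * C * (A ^ (m + 1) * g + A * g ^ (m + 1) + A ^ m * g ^ 2 + g ^ (m + 2)) := by ring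
        _ ≤ 2 * C * (3 * (A ^ (m + 1) * g + g ^ (m + 2))) := by gcongr; linarith
        _ = _ := by ring
    calc (A + 2 * q + g) ^ (m + 1 + 1) = (A + 2 * q + g) * (A + 2 * q + g) ^ (m + 1) := by ring
      _ ≤ (A + 2 * q + g) * (A ^ (m + 1) + 2 * (m + 1) * A ^ m * q +
          C * (A ^ m * g + g ^ (m + 1))) := by gcongr; exact h A g q hA hg hq
      _ = A ^ (m + 2) + 2 * (m + 2) * A ^ (m + 1) * q + (A ^ (m + 1) * g +
          4 * (m + 1) * (A ^ m * q ^ 2) + (m + 1) * (A ^ m * (2 * q * g))) +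
          (A + 2 * q + g) * (C * (A ^ m * g + g ^ (m + 1))) := by ring
      _ ≤ A ^ (m + 2) + 2 * (m + 2) * A ^ (m + 1) * q + (A ^ (m + 1) * g +
          4 * (m + 1) * (A ^ (m + 1) * g) + (m + 1) * (A ^ (m + 1) * g +
            (A ^ (m + 1) * g + g ^ (m + 2)))) +
          6 * C * (A ^ (m + 1) * g + g ^ (m + 2)) := by
        gcongr
        exact e4.trans (by gcongr)
      _ ≤ _ := by
        push_cast
        have h1 : 0 ≤ A ^ (m + 1) * g := by positivity
        have h2 : 0 ≤ g ^ (m + 2) := by positivity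
        have h3 : (0 : ℝ) ≤ m := m.cast_nonneg
        ring_nf
        ring_nf at h1 h2
        nlinarith [mul_nonneg h3 h1, mul_nonneg h3 h2]

/-- Second-order expansion of an even power of the norm for a step of size `ε`. -/
theorem exists_norm_add_smul_pow_le (m : ℕ) : ∃ C : ℝ, 0 ≤ C ∧
    ∀ {F : Type} [NormedAddCommGroup F] [InnerProductSpace ℝ F] (a c : F) (ε : ℝ),
      0 < ε → ε ≤ 1 →
      (‖a + ε • c‖ ^ 2) ^ (m + 1) ≤ (‖a‖ ^ 2) ^ (m + 1) +
        ε * (2 * (m + 1) * (‖a‖ ^ 2) ^ m * inner ℝ a c) +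
        C * (ε * (‖a‖ ^ 2) ^ (m + 1) + ε ^ (m + 2) * (‖c‖ ^ 2) ^ (m + 1)) := by
  obtain ⟨C, hC, h⟩ := exists_add_pow_le m
  refine ⟨2 * C, by positivity, fun a c ε hε hε1 => ?_⟩
  set A := ‖a‖ ^ 2 with hA
  set G := ‖c‖ ^ 2 with hG
  have hA0 : 0 ≤ A := by positivity
  have hG0 : 0 ≤ G := by positivity
  have hexp : ‖a + ε • c‖ ^ 2 = A + 2 * (ε * inner ℝ a c) + ε ^ 2 * G := by
    rw [norm_add_sq_real, real_inner_smul_right, norm_smul, mul_pow, Real.norm_of_nonneg hε.le]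
  have hq : (ε * inner ℝ a c) ^ 2 ≤ A * (ε ^ 2 * G) := by
    have h1 : (inner ℝ a c) ^ 2 ≤ A * G := by
      rw [hA, hG, ← mul_pow, ← sq_abs]
      exact pow_le_pow_left₀ (abs_nonneg _) (abs_real_inner_le_norm a c) 2
    calc _ = ε ^ 2 * inner ℝ a c ^ 2 := by ring
      _ ≤ ε ^ 2 * (A * G) := by gcongr
      _ = _ := by ring
  rw [hexp]
  refine (h A (ε ^ 2 * G) _ hA0 (by positivity) hq).trans ?_
  -- One factor `ε` is set aside before splitting `A ^ m * (ε * G)`. It leaves `ε * A ^ (m + 1)`,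
  -- which a discount can absorb, and an error of order `ε ^ (m + 2)`.
  have y1 := pow_mul_le_pow_succ_add hA0 (by positivity : 0 ≤ ε * G) m
  have e1 : A ^ m * (ε ^ 2 * G) ≤ ε * A ^ (m + 1) + ε ^ (m + 2) * G ^ (m + 1) := by
    calc _ = ε * (A ^ m * (ε * G)) := by ring
      _ ≤ ε * (A ^ (m + 1) + (ε * G) ^ (m + 1)) := by gcongr
      _ = _ := by ring
  have e2 : (ε ^ 2 * G) ^ (m + 1) ≤ ε ^ (m + 2) * G ^ (m + 1) := by
    rw [mul_pow, ← pow_mul]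
    exact mul_le_mul_of_nonneg_right (pow_le_pow_of_le_one hε.le hε1 (by omega)) (by positivity)
  have e3 : 0 ≤ ε * A ^ (m + 1) := by positivity
  have e4 := mul_le_mul_of_nonneg_left (add_le_add e1 e2) hC
  nlinarith

end Power

/-! ### Integrals against the exponential distribution -/

section Exponential

theorem lintegral_expMeasure_one (f : ℝ → ℝ≥0∞) :
    ∫⁻ r, f r ∂(expMeasure 1) = ∫⁻ r in Ioi (0 : ℝ), ENNReal.ofReal (Real.exp (-r)) * f r := by
  have hm : Measurable (exponentialPDF 1) := (measurable_exponentialPDFReal 1).ennreal_ofReal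
  have h1 : expMeasure 1 = volume.withDensity (exponentialPDF 1) := rfl
  rw [h1, lintegral_withDensity_eq_lintegral_mul_non_measurable _ hm
    (ae_of_all _ fun r => ENNReal.ofReal_lt_top), ← lintegral_add_compl _ measurableSet_Ici
    (A := Ici (0 : ℝ)), compl_Ici]
  have h2 : ∫⁻ r in Iio (0 : ℝ), (exponentialPDF 1 * f) r = 0 := by
    rw [setLIntegral_congr_fun measurableSet_Iio (g := fun _ => 0), lintegral_zero]
    intro r hr
    simp [exponentialPDF_of_neg hr]
  rw [h2, add_zero, setLIntegral_congr Ioi_ae_eq_Ici.symm]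
  refine setLIntegral_congr_fun measurableSet_Ioi fun r hr => ?_
  simp [exponentialPDF_of_nonneg hr.le]

theorem ae_expMeasure_pos : ∀ᵐ r ∂(expMeasure 1), 0 < r := by
  have hm : MeasurableSet {r : ℝ | 0 < r} := measurableSet_Ioi
  have h := lintegral_expMeasure_one ({r : ℝ | 0 < r}ᶜ.indicator 1)
  rw [lintegral_indicator_one hm.compl] at h
  rw [ae_iff]
  change expMeasure 1 {r : ℝ | 0 < r}ᶜ = 0
  rw [h, setLIntegral_congr_fun measurableSet_Ioi (g := fun _ => 0), lintegral_zero]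
  intro r hr
  simp [show 0 < r from hr]

/-- Monotone exhaustion by bounded intervals: the fundamental theorem of calculus is needed only on
compact intervals, and integrability on the half-line is not required beforehand. -/
theorem lintegral_expMeasure_one_le {f : ℝ → ℝ} {M : ℝ} (hf : Measurable f)
    (hf0 : ∀ r, 0 < r → 0 ≤ f r)
    (hint : ∀ n : ℕ, IntervalIntegrable (fun r => Real.exp (-r) * f r) volume 0 n)
    (hM : ∀ n : ℕ, ∫ r in (0 : ℝ)..n, Real.exp (-r) * f r ≤ M) :
    ∫⁻ r, ENNReal.ofReal (f r) ∂(expMeasure 1) ≤ ENNReal.ofReal M := by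
  rw [lintegral_expMeasure_one]
  have hcov : AECover (volume.restrict (Ioi (0 : ℝ))) atTop (fun n : ℕ => Iic (n : ℝ)) :=
    aecover_Iic tendsto_natCast_atTop_atTop
  refine le_of_tendsto' (hcov.lintegral_tendsto_of_nat (by fun_prop)) fun n => ?_
  rw [Measure.restrict_restrict measurableSet_Iic, inter_comm, Ioi_inter_Iic]
  have h1 : ∀ r : ℝ, ENNReal.ofReal (Real.exp (-r)) * ENNReal.ofReal (f r) =
      ENNReal.ofReal (Real.exp (-r) * f r) := fun r =>
    (ENNReal.ofReal_mul (Real.exp_pos _).le).symm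
  simp_rw [h1]
  rw [← ofReal_integral_eq_lintegral_ofReal
    ((intervalIntegrable_iff_integrableOn_Ioc_of_le n.cast_nonneg).1 (hint n))
    ((ae_restrict_iff' measurableSet_Ioc).2 (ae_of_all _ fun r hr =>
      mul_nonneg (Real.exp_pos _).le (hf0 r hr.1))),
    ← intervalIntegral.integral_of_le n.cast_nonneg]
  exact ENNReal.ofReal_le_ofReal (hM n)

theorem integral_exp_neg_mul_le {a : ℝ} (ha : 0 < a) (R : ℝ) :
    ∫ r in (0 : ℝ)..R, Real.exp (-a * r) ≤ 1 / a := by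
  have h : ∀ r ∈ uIcc 0 R, HasDerivAt (fun r => -(1 / a) * Real.exp (-a * r))
      (Real.exp (-a * r)) r := by
    intro r _
    have := (((hasDerivAt_id r).const_mul (-a)).exp).const_mul (-(1 / a))
    have h2 : -(1 / a) * (Real.exp (-a * r) * (-a * 1)) = Real.exp (-a * r) := by field_simp
    rw [← h2]
    exact this
  rw [intervalIntegral.integral_eq_sub_of_hasDerivAt h
    (Continuous.intervalIntegrable (by fun_prop) _ _)]
  have : 0 < 1 / a * Real.exp (-a * R) := by positivity
  simp only [mul_zero, Real.exp_zero]
  linarith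

end Exponential

/-! ### One step of the random Euler scheme -/

section OneStep

theorem ae_comp_add_mul {q : ℝ → Prop} (hq : ∀ᵐ s : ℝ, q s) (t : ℝ) {ε : ℝ} (hε : 0 < ε) :
    ∀ᵐ r : ℝ, q (t + ε * r) := by
  have h : {r : ℝ | ¬ q (t + ε * r)} = (ε * ·) ⁻¹' ((t + ·) ⁻¹' {s | ¬ q s}) := rfl
  rw [ae_iff, h, Real.volume_preimage_mul_left hε.ne', measure_preimage_add, ae_iff.1 hq, mul_zero]

/-- Discounted over one exponential waiting time, the `2(m+1)`-th power of the distance to a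
Filippov solution grows at most by a term of order `ε ^ (m + 2)`. -/
theorem exists_lintegral_norm_pow_le (m : ℕ) : ∃ C : ℝ, 0 ≤ C ∧
    ∀ {d : ℕ} {κ : ℝ} {b : ℝ → EuclideanSpace ℝ (Fin d) → EuclideanSpace ℝ (Fin d)},
      OneSidedLipschitzGrowth κ b → 0 < κ → Measurable (Function.uncurry b) →
      ∀ (x₀ : EuclideanSpace ℝ (Fin d)) (X : ℝ → EuclideanSpace ℝ (Fin d)),
      IsFilippovSolution b x₀ X → Measurable X →
      ∀ (t ε l : ℝ) (z : EuclideanSpace ℝ (Fin d)), 0 ≤ t → 0 < ε → ε < 1 →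
      C + 2 * (m + 1) * κ ≤ l →
      ∫⁻ r, ENNReal.ofReal (Real.exp (-l * (ε * r)) *
          (‖X (t + ε * r) - (z + ε • b (t + ε * r) z)‖ ^ 2) ^ (m + 1)) ∂(expMeasure 1) ≤
        ENNReal.ofReal ((‖X t - z‖ ^ 2) ^ (m + 1) +
          C * ε ^ (m + 2) * ((κ * (1 + ‖z‖)) ^ 2) ^ (m + 1) / (1 + l * ε)) := by
  obtain ⟨C, hC, hpow⟩ := exists_norm_add_smul_pow_le m
  refine ⟨C, hC, fun {d κ b} hb hκ hbm x₀ X hX hXm t ε l z ht hε hε1 hl => ?_⟩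
  have hl0 : 0 < l := lt_of_lt_of_le (by positivity) hl
  -- The `1` comes from the exponential density, `l * ε` from the discount in the rescaled time.
  set a := 1 + l * ε with ha_def
  have ha : 0 < a := by positivity
  set B := ((κ * (1 + ‖z‖)) ^ 2) ^ (m + 1) with hB_def
  have hB : 0 ≤ B := by positivity
  set J : ℝ → EuclideanSpace ℝ (Fin d) := fun r => X (t + ε * r) - (z + ε • b (t + ε * r) z)
    with hJ_def
  have htr : Measurable fun r : ℝ => t + ε * r := by fun_prop
  have hbzm : Measurable fun r => b (t + ε * r) z := hbm.comp (htr.prodMk measurable_const)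
  have hJm : Measurable J := (hXm.comp htr).sub ((hbzm.const_smul ε).const_add z)
  have htr0 : ∀ {r : ℝ}, 0 ≤ r → 0 ≤ t + ε * r := fun hr => by positivity
  -- boundedness on compact intervals
  have hJb : ∀ R : ℝ, 0 ≤ R → ∃ M, ∀ r ∈ Icc 0 R, ‖J r‖ ≤ M := by
    intro R hR
    refine ⟨2 * Real.exp (2 * κ * (t + ε * R)) * (1 + ‖x₀‖) +
      (‖z‖ + ε * (κ * (1 + ‖z‖))), fun r hr => ?_⟩
    have h1 := hX.norm_le hb hκ (htr0 hr.1)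
    have h2 := hb.growth _ (htr0 hr.1) z
    have h3 : 2 * Real.exp (2 * κ * (t + ε * r)) * (1 + ‖x₀‖) ≤
        2 * Real.exp (2 * κ * (t + ε * R)) * (1 + ‖x₀‖) := by
      have := hr.2
      gcongr
    have h4 : ‖z + ε • b (t + ε * r) z‖ ≤ ‖z‖ + ε * (κ * (1 + ‖z‖)) := by
      refine (norm_add_le _ _).trans ?_
      rw [norm_smul, Real.norm_of_nonneg hε.le]
      gcongr
    refine (norm_sub_le _ _).trans ?_
    linarith [norm_nonneg (X (t + ε * r))]
  have hint : ∀ R : ℝ, 0 ≤ R → IntervalIntegrable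
      (fun r => Real.exp (-a * r) * (‖J r‖ ^ 2) ^ (m + 1)) volume 0 R := by
    intro R hR
    obtain ⟨M, hM⟩ := hJb R hR
    refine intervalIntegrable_of_norm_le (K := 1 * (M ^ 2) ^ (m + 1)) hR
      (Measurable.stronglyMeasurable (by fun_prop)) fun r hr => ?_
    rw [Real.norm_of_nonneg (by positivity)]
    have h1 : Real.exp (-a * r) ≤ 1 := Real.exp_le_one_iff.2 (by nlinarith [hr.1])
    have h2 := hM r hr
    gcongr
  -- the energy estimate
  have hmain : ∀ R : ℝ, 0 ≤ R → ∫ r in (0 : ℝ)..R, Real.exp (-a * r) * (‖J r‖ ^ 2) ^ (m + 1) ≤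
      (‖X t - z‖ ^ 2) ^ (m + 1) + C * ε ^ (m + 2) * B / a := by
    intro R hR
    have hacX : AbsolutelyContinuousOnInterval (fun r => X (t + ε * r)) 0 R := by
      refine absolutelyContinuousOnInterval_of_norm_sub_le
        (K := κ * (2 * Real.exp (2 * κ * (t + ε * R)) * (1 + ‖x₀‖)) * ε) hR
        fun s r hs hsr hr => ?_
      refine (hX.norm_sub_le_mul hb hκ (htr0 hs) (T := t + ε * R) (by gcongr)
        (by gcongr)).trans (le_of_eq ?_)
      ring
    have hac := (absolutelyContinuousOnInterval_exp_mul (-a) 0 R).fun_mul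
      (((hacX.fun_sub (absolutelyContinuousOnInterval_const z 0 R)).norm.pow 2).pow (m + 1))
    have hint2 : IntervalIntegrable (fun r => C * ε ^ (m + 2) * B * Real.exp (-a * r)) volume 0 R :=
      Continuous.intervalIntegrable (by fun_prop) _ _
    -- The differentiated quantity is the discounted power of the distance before the jump. The
    -- upper bound for its derivative contains minus the post-jump integrand, so that integration
    -- moves the desired expectation to the left-hand side.
    have key := hac.sub_le_integral hR (h := fun r => C * ε ^ (m + 2) * B * Real.exp (-a * r) -
      Real.exp (-a * r) * (‖J r‖ ^ 2) ^ (m + 1)) (hint2.sub (hint R hR)) (by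
      filter_upwards [ae_comp_add_mul hX.ae_hasDerivAt t hε] with r hr hmem
      have hr0 : 0 < t + ε * r := by have := hmem.1; positivity
      obtain ⟨v, hv, hXv⟩ := hr hr0
      have hXr : HasDerivAt (fun r => X (t + ε * r)) (ε • v) r := by
        have h1 : HasDerivAt (fun r => t + ε * r) ε r := by
          simpa using ((hasDerivAt_id r).const_mul ε).const_add t
        exact HasDerivAt.scomp r hXv h1
      refine ⟨_, ((((hasDerivAt_id r).const_mul (-a)).exp).mul
        ((hasDerivAt_norm_sub_sq hXr (hasDerivAt_const r z)).pow (m + 1))), ?_⟩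
      have h1 := hb.inner_sub_le_of_mem hr0.le hv z
      have h2 := hpow (X (t + ε * r) - z) (-b (t + ε * r) z) ε hε hε1.le
      have h3 : X (t + ε * r) - z + ε • -b (t + ε * r) z = J r := by
        simp only [hJ_def, smul_neg]; abel
      have h4 : (‖-b (t + ε * r) z‖ ^ 2) ^ (m + 1) ≤ B := by
        rw [norm_neg, hB_def]
        have := hb.growth _ hr0.le z
        gcongr
      rw [h3] at h2
      set A := ‖X (t + ε * r) - z‖ ^ 2 with hA_def
      have hA : 0 ≤ A := by positivity
      simp only [id, sub_zero, mul_one, real_inner_smul_right, Nat.add_sub_cancel, inner_neg_right,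
        inner_sub_right] at h1 h2 ⊢
      set p := inner ℝ (X (t + ε * r) - z) v
      set q := inner ℝ (X (t + ε * r) - z) (b (t + ε * r) z)
      have hAm : 0 ≤ A ^ m := by positivity
      have h5 : A ^ m * p ≤ A ^ m * q + κ * A ^ (m + 1) := by
        have := mul_le_mul_of_nonneg_left (by linarith : p ≤ q + κ * A) hAm
        rw [pow_succ]; linarith
      have h6 : C * (ε * A ^ (m + 1) + ε ^ (m + 2) * (‖-b (t + ε * r) z‖ ^ 2) ^ (m + 1)) ≤
          C * (ε * A ^ (m + 1) + ε ^ (m + 2) * B) := by gcongr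
      have h7 : ε * ((C + 2 * (m + 1) * κ) * A ^ (m + 1)) ≤ ε * (l * A ^ (m + 1)) := by gcongr
      have h8 : 2 * (m + 1) * ε * (A ^ m * p) ≤ 2 * (m + 1) * ε * (A ^ m * q + κ * A ^ (m + 1)) :=
        by gcongr
      -- The `1` in `a` cancels the leading term of the jump expansion. The drift term in `p` and
      -- the first-order jump term in `q` cancel up to `κ * A ^ (m + 1)` by `h5`, and `l * ε`
      -- absorbs what remains at order `ε * A ^ (m + 1)`.
      have h9 : -a * A ^ (m + 1) + (m + 1) * A ^ m * (2 * (ε * p)) + (‖J r‖ ^ 2) ^ (m + 1) ≤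
          C * ε ^ (m + 2) * B := by
        rw [ha_def]
        nlinarith
      have h10 := mul_le_mul_of_nonneg_left h9 (Real.exp_pos (-a * r)).le
      push_cast
      nlinarith)
    rw [intervalIntegral.integral_sub hint2 (hint R hR), intervalIntegral.integral_const_mul] at key
    have h1 := mul_le_mul_of_nonneg_left (integral_exp_neg_mul_le ha R)
      (by positivity : 0 ≤ C * ε ^ (m + 2) * B)
    have h2 : 0 ≤ Real.exp (-a * R) * (‖X (t + ε * R) - z‖ ^ 2) ^ (m + 1) := by positivity
    simp only [mul_zero, Real.exp_zero, one_mul, add_zero] at key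
    rw [mul_one_div] at h1
    linarith
  have hexp : ∀ r : ℝ, Real.exp (-r) * (Real.exp (-l * (ε * r)) * (‖J r‖ ^ 2) ^ (m + 1)) =
      Real.exp (-a * r) * (‖J r‖ ^ 2) ^ (m + 1) := by
    intro r
    rw [← mul_assoc, ← Real.exp_add]
    congr 2
    rw [ha_def]; ring
  refine lintegral_expMeasure_one_le
    (f := fun r => Real.exp (-l * (ε * r)) * (‖J r‖ ^ 2) ^ (m + 1)) (by fun_prop) (fun r _ => by positivity) (fun n => ?_)
    fun n => ?_
  · simp_rw [hexp]
    exact hint n n.cast_nonneg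
  · simp_rw [hexp]
    exact hmain n n.cast_nonneg

end OneStep

/-! ### The Lyapunov function of the random Euler scheme -/

section Lyapunov

variable {d : ℕ}

/-- The discounted Lyapunov function: `Φ` is the flow, `x` the starting point, `t` the current time
and `z` the current position of the scheme. -/
noncomputable def lyapunov (Φ : ℝ → EuclideanSpace ℝ (Fin d) → EuclideanSpace ℝ (Fin d))
    (l ε : ℝ) (m : ℕ) (x : EuclideanSpace ℝ (Fin d)) (t : ℝ) (z : EuclideanSpace ℝ (Fin d)) : ℝ :=
  Real.exp (-l * t) * ((‖Φ t x - z‖ ^ 2) ^ (m + 1) +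
    ε ^ (m + 1) * ((1 + ‖x‖ + ‖z‖) ^ 2) ^ (m + 1))

/-- The discounted contribution of a waiting time of length `ε r`. -/
noncomputable def waitingCost (c l ε : ℝ) (m : ℕ) (x : EuclideanSpace ℝ (Fin d)) (t : ℝ)
    (z : EuclideanSpace ℝ (Fin d)) (r : ℝ) : ℝ :=
  Real.exp (-l * t) * (((ε * r * (1 + ‖x‖ + ‖z‖)) ^ 2) ^ (m + 1) / c)

/-- Convexity in `ε`: on `[0, 1]` the power lies below its chord. -/
theorem one_add_mul_pow_le {κ ε : ℝ} (hκ : 0 ≤ κ) (hε : 0 ≤ ε) (hε1 : ε ≤ 1) (n : ℕ) :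
    (1 + κ * ε) ^ n ≤ 1 + ε * ((1 + κ) ^ n - 1) := by
  induction n with
  | zero => simp
  | succ n ih =>
    have h1 : 1 ≤ (1 + κ) ^ n := one_le_pow₀ (by linarith)
    calc (1 + κ * ε) ^ (n + 1) = (1 + κ * ε) ^ n * (1 + κ * ε) := pow_succ _ _
      _ ≤ (1 + ε * ((1 + κ) ^ n - 1)) * (1 + κ * ε) := by gcongr
      _ ≤ _ := by
        rw [pow_succ]
        nlinarith [mul_nonneg (mul_nonneg hκ hε) (mul_nonneg (sub_nonneg.2 h1) (sub_nonneg.2 hε1))]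

/-- The budget behind the choice of `l`: `α * ε` is the one-step error, `u` the growth of the
weight, `v / 2` the waiting cost, all measured against the discount factor `1 + l * ε`. -/
theorem lyapunov_coeff_le {ε l α β u v : ℝ} (hε : 0 ≤ ε) (hε1 : ε ≤ 1) (hl : 0 ≤ l)
    (hu : u ≤ 1 + ε * (β - 1)) (hv : v ≤ ε) (hαβ : 2 * (α + β + 1) ≤ l) :
    α * ε + u + v / 2 * (1 + l * ε) ≤ 1 + l * ε := by
  have h1 : v / 2 * (1 + l * ε) ≤ ε / 2 * (1 + l * ε) := by gcongr
  have h2 : l * ε * ε ≤ l * ε := mul_le_of_le_one_right (mul_nonneg hl hε) hε1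
  have h3 : ε * (2 * (α + β + 1)) ≤ ε * l := by gcongr
  linarith

/-- Negative `a > -1` is allowed: `a = -1/2` yields the polynomial moments, `a = l * ε` the discount
and `a = 1` the divergence of the arrival times. -/
theorem lintegral_exp_neg_mul_expMeasure_le {a : ℝ} (ha : 0 < 1 + a) :
    ∫⁻ r, ENNReal.ofReal (Real.exp (-a * r)) ∂(expMeasure 1) ≤ ENNReal.ofReal (1 / (1 + a)) := by
  have h : ∀ r : ℝ, Real.exp (-r) * Real.exp (-a * r) = Real.exp (-(1 + a) * r) := fun r => by
    rw [← Real.exp_add]; congr 1; ring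
  refine lintegral_expMeasure_one_le (f := fun r => Real.exp (-a * r)) (by fun_prop)
    (fun r _ => (Real.exp_pos _).le) (fun n => Continuous.intervalIntegrable (by fun_prop) _ _)
    fun n => ?_
  simp_rw [h]
  exact integral_exp_neg_mul_le ha n

theorem lintegral_pow_expMeasure_le (k : ℕ) :
    ∫⁻ r, ENNReal.ofReal (r ^ k) ∂(expMeasure 1) ≤ ENNReal.ofReal (k.factorial * 2 ^ k * 2) := by
  have hc : (0 : ℝ) ≤ k.factorial * 2 ^ k := by positivity
  calc ∫⁻ r, ENNReal.ofReal (r ^ k) ∂(expMeasure 1)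
      ≤ ∫⁻ r, ENNReal.ofReal (k.factorial * 2 ^ k) * ENNReal.ofReal (Real.exp (-(-(1 / 2)) * r))
        ∂(expMeasure 1) := by
        refine lintegral_mono_ae ?_
        filter_upwards [ae_expMeasure_pos] with r hr
        rw [← ENNReal.ofReal_mul hc]
        refine ENNReal.ofReal_le_ofReal ?_
        have h1 := Real.pow_div_factorial_le_exp (r / 2) (by positivity) k
        rw [div_le_iff₀ (by positivity), div_pow, div_le_iff₀ (by positivity)] at h1
        calc r ^ k ≤ Real.exp (r / 2) * k.factorial * 2 ^ k := h1
          _ = _ := by rw [show -(-(1 / 2 : ℝ)) * r = r / 2 by ring]; ring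
    _ = ENNReal.ofReal (k.factorial * 2 ^ k) *
        ∫⁻ r, ENNReal.ofReal (Real.exp (-(-(1 / 2)) * r)) ∂(expMeasure 1) :=
      lintegral_const_mul _ (by fun_prop)
    _ ≤ ENNReal.ofReal (k.factorial * 2 ^ k) * ENNReal.ofReal (1 / (1 + -(1 / 2))) := by
      gcongr
      exact lintegral_exp_neg_mul_expMeasure_le (by norm_num)
    _ = _ := by rw [← ENNReal.ofReal_mul hc]; norm_num

/-- The Lyapunov function is a supersolution for the scheme, with the waiting cost to spare. -/
theorem exists_lintegral_lyapunov_le {κ : ℝ} (hκ : 0 < κ) (m : ℕ) :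
    ∃ l c : ℝ, 0 < l ∧ 0 < c ∧
    ∀ {d : ℕ} {b : ℝ → EuclideanSpace ℝ (Fin d) → EuclideanSpace ℝ (Fin d)},
      OneSidedLipschitzGrowth κ b → Measurable (Function.uncurry b) →
      ∀ Φ : ℝ → EuclideanSpace ℝ (Fin d) → EuclideanSpace ℝ (Fin d),
      Measurable (Function.uncurry Φ) → (∀ x, IsFilippovSolution b x (fun t => Φ t x)) →
      ∀ ε t : ℝ, 0 < ε → ε < 1 → 0 ≤ t → ∀ x z : EuclideanSpace ℝ (Fin d),
      ∫⁻ r, (ENNReal.ofReal (lyapunov Φ l ε m x (t + ε * r) (z + ε • b (t + ε * r) z)) +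
          ENNReal.ofReal (waitingCost c l ε m x t z r)) ∂(expMeasure 1) ≤
        ENNReal.ofReal (lyapunov Φ l ε m x t z) := by
  obtain ⟨C, hC, hstep⟩ := exists_lintegral_norm_pow_le m
  set P := (κ ^ 2) ^ (m + 1) with hP
  set P1 := (1 + κ) ^ (2 * (m + 1)) with hP1
  have hP0 : 0 < P := by positivity
  have hP10 : 0 < P1 := by positivity
  set l := C + 2 * (m + 1) * κ + 2 * (C * P + P1 + 1) with hl
  -- `c0` bounds the moment of order `2(m+1)` of the waiting time. Dividing the waiting cost by `2 *
  -- c0` leaves at most half of `ε ^ (m + 1)` times the weight.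
  set c0 : ℝ := (2 * (m + 1)).factorial * 2 ^ (2 * (m + 1)) * 2 with hc0
  have hc0pos : 0 < c0 := by positivity
  have hlpos : 0 < l := by positivity
  refine ⟨l, 2 * c0, hlpos, by positivity, ?_⟩
  intro d b hb hbm Φ hΦm hΦ ε t hε hε1 ht x z
  set L := 1 + ‖x‖ + ‖z‖ with hL
  have hL0 : 0 < L := by positivity
  set h := (L ^ 2) ^ (m + 1) with hh
  have hh0 : 0 < h := by positivity
  set u := (‖Φ t x - z‖ ^ 2) ^ (m + 1) with hu
  have hu0 : 0 ≤ u := by positivity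
  set a := 1 + l * ε with ha
  have ha0 : 0 < a := by positivity
  set e := Real.exp (-l * t) with he
  have he0 : 0 < e := Real.exp_pos _
  -- Bound for the weight after a jump: linear growth multiplies `1 + ‖x‖ + ‖z‖` by at most `1 + κ *
  -- ε`, uniformly in the jump time.
  set D := ε ^ (m + 1) * ((1 + κ * ε) ^ (2 * (m + 1)) * h) with hD
  have hD0 : 0 < D := by positivity
  have hXm : Measurable fun t => Φ t x := hΦm.comp (measurable_id.prodMk measurable_const)
  have hone := hstep hb hκ hbm x _ (hΦ x) hXm t ε l z ht hε hε1 (by rw [hl]; linarith [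
    (by positivity : 0 < 2 * (C * P + P1 + 1))])
  have hB : ((κ * (1 + ‖z‖)) ^ 2) ^ (m + 1) ≤ P * h := by
    rw [hP, hh, ← mul_pow, ← mul_pow]
    have : 1 + ‖z‖ ≤ L := by rw [hL]; linarith [norm_nonneg x]
    gcongr
  calc ∫⁻ r, (ENNReal.ofReal (lyapunov Φ l ε m x (t + ε * r) (z + ε • b (t + ε * r) z)) +
          ENNReal.ofReal (waitingCost (2 * c0) l ε m x t z r)) ∂(expMeasure 1)
      ≤ ∫⁻ r, (ENNReal.ofReal e * ENNReal.ofReal (Real.exp (-l * (ε * r)) *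
          (‖Φ (t + ε * r) x - (z + ε • b (t + ε * r) z)‖ ^ 2) ^ (m + 1)) +
          (ENNReal.ofReal e * ENNReal.ofReal D * ENNReal.ofReal (Real.exp (-(l * ε) * r)) +
          ENNReal.ofReal (e * ((ε ^ 2) ^ (m + 1) * h / (2 * c0))) *
            ENNReal.ofReal (r ^ (2 * (m + 1))))) ∂(expMeasure 1) := by
        refine lintegral_mono_ae ?_
        filter_upwards [ae_expMeasure_pos] with r hr
        rw [← add_assoc]
        refine add_le_add ?_ (le_of_eq ?_)
        · rw [mul_assoc, ← mul_add, ← ENNReal.ofReal_mul hD0.le,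
            ← ENNReal.ofReal_add (by positivity) (by positivity), ← ENNReal.ofReal_mul he0.le]
          refine ENNReal.ofReal_le_ofReal ?_
          rw [lyapunov]
          have h1 : Real.exp (-l * (t + ε * r)) = e * Real.exp (-l * (ε * r)) := by
            rw [he, ← Real.exp_add]; congr 1; ring
          have h2 : Real.exp (-(l * ε) * r) = Real.exp (-l * (ε * r)) := by congr 1; ring
          have h3 : 1 + ‖x‖ + ‖z + ε • b (t + ε * r) z‖ ≤ (1 + κ * ε) * L := by
            have h4 := norm_add_le z (ε • b (t + ε * r) z)
            rw [norm_smul, Real.norm_of_nonneg hε.le] at h4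
            have h5 := mul_le_mul_of_nonneg_left (hb.growth (t + ε * r) (by positivity) z) hε.le
            have h6 : 0 ≤ κ * ε * ‖x‖ := by positivity
            rw [hL]; linarith
          have h7 : ε ^ (m + 1) * ((1 + ‖x‖ + ‖z + ε • b (t + ε * r) z‖) ^ 2) ^ (m + 1) ≤ D := by
            rw [hD]
            refine mul_le_mul_of_nonneg_left ?_ (by positivity)
            rw [hh, pow_mul, ← mul_pow, ← mul_pow]
            gcongr
          rw [h1, h2, mul_assoc]
          refine mul_le_mul_of_nonneg_left ?_ he0.le
          rw [mul_comm D, ← mul_add]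
          gcongr
        · rw [← ENNReal.ofReal_mul (by positivity), waitingCost, hh, pow_mul]
          congr 1
          rw [mul_pow, mul_pow, mul_pow, mul_pow]
          ring
    _ = ENNReal.ofReal e * ∫⁻ r, ENNReal.ofReal (Real.exp (-l * (ε * r)) *
          (‖Φ (t + ε * r) x - (z + ε • b (t + ε * r) z)‖ ^ 2) ^ (m + 1)) ∂(expMeasure 1) +
          (ENNReal.ofReal e * ENNReal.ofReal D *
            ∫⁻ r, ENNReal.ofReal (Real.exp (-(l * ε) * r)) ∂(expMeasure 1) +
          ENNReal.ofReal (e * ((ε ^ 2) ^ (m + 1) * h / (2 * c0))) *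
            ∫⁻ r, ENNReal.ofReal (r ^ (2 * (m + 1))) ∂(expMeasure 1)) := by
        rw [lintegral_add_right _ (by fun_prop), lintegral_add_right _ (by fun_prop),
          lintegral_const_mul' _ _ ENNReal.ofReal_ne_top,
          lintegral_const_mul' _ _ (ENNReal.mul_ne_top ENNReal.ofReal_ne_top ENNReal.ofReal_ne_top),
          lintegral_const_mul' _ _ ENNReal.ofReal_ne_top]
    _ ≤ ENNReal.ofReal e * ENNReal.ofReal (u + C * ε ^ (m + 2) * (P * h) / a) +
          (ENNReal.ofReal e * ENNReal.ofReal D * ENNReal.ofReal (1 / a) +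
          ENNReal.ofReal (e * ((ε ^ 2) ^ (m + 1) * h / (2 * c0))) * ENNReal.ofReal c0) := by
        gcongr
        · exact hone.trans (ENNReal.ofReal_le_ofReal (by gcongr))
        · exact lintegral_exp_neg_mul_expMeasure_le ha0
        · exact lintegral_pow_expMeasure_le _
    _ = ENNReal.ofReal (e * (u + C * ε ^ (m + 2) * (P * h) / a) +
          (e * D * (1 / a) + e * ((ε ^ 2) ^ (m + 1) * h / (2 * c0)) * c0)) := by
        rw [← ENNReal.ofReal_mul he0.le, ← ENNReal.ofReal_mul he0.le,
          ← ENNReal.ofReal_mul (by positivity), ← ENNReal.ofReal_mul (by positivity),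
          ← ENNReal.ofReal_add (by positivity) (by positivity),
          ← ENNReal.ofReal_add (by positivity) (by positivity)]
    _ ≤ ENNReal.ofReal (lyapunov Φ l ε m x t z) := by
        refine ENNReal.ofReal_le_ofReal ?_
        rw [lyapunov]
        have e1 : e * ((ε ^ 2) ^ (m + 1) * h / (2 * c0)) * c0 =
            e * (ε ^ (m + 1) * h * (ε ^ (m + 1) / 2)) := by
          rw [← pow_mul, mul_comm 2, pow_mul]
          field_simp
        have e2 : e * D * (1 / a) = e * (ε ^ (m + 1) * h * ((1 + κ * ε) ^ (2 * (m + 1)) / a)) := by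
          rw [hD]; ring
        have e3 : C * ε ^ (m + 2) * (P * h) / a = ε ^ (m + 1) * h * (C * P * ε / a) := by ring
        rw [e1, e2, e3, ← mul_add, ← mul_add]
        refine mul_le_mul_of_nonneg_left ?_ he0.le
        have f1 := one_add_mul_pow_le hκ.le hε.le hε1.le (2 * (m + 1))
        rw [← hP1] at f1
        have f2 : ε ^ (m + 1) ≤ ε := pow_le_of_le_one hε.le hε1.le (by omega)
        have f3 : C * P * ε / a + (1 + κ * ε) ^ (2 * (m + 1)) / a + ε ^ (m + 1) / 2 ≤ 1 := by
          rw [← add_div, div_add' _ _ _ ha0.ne', div_le_one ha0]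
          exact lyapunov_coeff_le hε.le hε1.le hlpos.le f1 f2
            (by rw [hl]; linarith [(by positivity : 0 ≤ C + 2 * (m + 1) * κ)])
        have f8 := mul_le_mul_of_nonneg_left f3 (by positivity : 0 ≤ ε ^ (m + 1) * h)
        rw [← hL, ← hh, ← hu]
        linarith

end Lyapunov

/-! ### A maximal inequality for nonnegative supermartingales -/

section Maximal

variable {Ω : Type*} {mΩ : MeasurableSpace Ω} {μ : Measure Ω}

/-- Keeping the integral over the event that the level has not yet been reached makes the induction
close: this event is known at time `N`, so the supermartingale inequality applies on it, and its
part where `V (N + 1)` reaches the level is paid for by Markov's inequality. Set integrals replace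
conditional expectations, so no integrability is needed. -/
theorem mul_measure_add_setLIntegral_le {ℱ : Filtration ℕ mΩ} {V : ℕ → Ω → ℝ≥0∞}
    (hV : ∀ n, Measurable[ℱ n] (V n))
    (hsup : ∀ n A, MeasurableSet[ℱ n] A → ∫⁻ ω in A, V (n + 1) ω ∂μ ≤ ∫⁻ ω in A, V n ω ∂μ)
    (a : ℝ≥0∞) (N : ℕ) :
    a * μ {ω | ∃ n ≤ N, a ≤ V n ω} + ∫⁻ ω in {ω | ∃ n ≤ N, a ≤ V n ω}ᶜ, V N ω ∂μ ≤
      ∫⁻ ω, V 0 ω ∂μ := by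
  have hVm : ∀ n, Measurable (V n) := fun n => (hV n).mono (ℱ.le n) le_rfl
  have hA : ∀ n, MeasurableSet[ℱ n] {ω | a ≤ V n ω} := fun n =>
    measurableSet_le measurable_const (hV n)
  have hle : ∀ n (A : Set Ω), MeasurableSet A → a * μ (A ∩ {ω | a ≤ V n ω}) ≤
      ∫⁻ ω in A ∩ {ω | a ≤ V n ω}, V n ω ∂μ := by
    intro n A hAm
    rw [← setLIntegral_const]
    exact setLIntegral_mono (hVm n) fun ω hω => hω.2
  induction N with
  | zero =>
    have h0 : {ω | ∃ n ≤ 0, a ≤ V n ω} = {ω | a ≤ V 0 ω} := by ext; simp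
    rw [h0, ← lintegral_add_compl (μ := μ) (V 0) (ℱ.le 0 _ (hA 0))]
    refine add_le_add (c := ∫⁻ ω in {ω | a ≤ V 0 ω}ᶜ, V 0 ω ∂μ) ?_ le_rfl
    simpa using hle 0 univ MeasurableSet.univ
  | succ N ih =>
    refine le_trans ?_ ih
    set E := {ω | ∃ n ≤ N, a ≤ V n ω} with hE
    have hEm : MeasurableSet[ℱ N] E := by
      have : E = ⋃ n ∈ Iic N, {ω | a ≤ V n ω} := by ext; simp [hE]
      rw [this]
      exact MeasurableSet.biUnion (to_countable _) fun n hn => ℱ.mono hn _ (hA n)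
    have hEm' : MeasurableSet E := ℱ.le N _ hEm
    have h1 : {ω | ∃ n ≤ N + 1, a ≤ V n ω} = E ∪ (Eᶜ ∩ {ω | a ≤ V (N + 1) ω}) := by
      ext ω
      simp only [hE, mem_union, mem_inter_iff, mem_compl_iff, mem_ofPred_eq, Nat.le_succ_iff]
      constructor
      · rintro ⟨n, hn | rfl, h⟩
        · exact Or.inl ⟨n, hn, h⟩
        · by_cases hex : ∃ n ≤ N, a ≤ V n ω
          · exact Or.inl hex
          · exact Or.inr ⟨hex, h⟩
      · rintro (⟨n, hn, h⟩ | ⟨-, h⟩)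
        · exact ⟨n, Or.inl hn, h⟩
        · exact ⟨N + 1, Or.inr rfl, h⟩
    have h2 : {ω | ∃ n ≤ N + 1, a ≤ V n ω}ᶜ = Eᶜ ∩ {ω | a ≤ V (N + 1) ω}ᶜ := by
      rw [h1, compl_union, compl_inter, compl_compl, inter_union_distrib_left, inter_comm Eᶜ E,
        inter_compl_self, empty_union]
    rw [h1, ← h1, h2]
    calc a * μ {ω | ∃ n ≤ N + 1, a ≤ V n ω} +
          ∫⁻ ω in Eᶜ ∩ {ω | a ≤ V (N + 1) ω}ᶜ, V (N + 1) ω ∂μ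
        ≤ a * μ E + (a * μ (Eᶜ ∩ {ω | a ≤ V (N + 1) ω}) +
          ∫⁻ ω in Eᶜ ∩ {ω | a ≤ V (N + 1) ω}ᶜ, V (N + 1) ω ∂μ) := by
          rw [h1, ← add_assoc, ← mul_add]
          gcongr
          exact measure_union_le _ _
      _ ≤ a * μ E + ∫⁻ ω in Eᶜ, V (N + 1) ω ∂μ := by
          rw [← lintegral_inter_add_sdiff (V (N + 1)) Eᶜ (ℱ.le _ _ (hA (N + 1))), Set.sdiff_eq]
          exact add_le_add le_rfl (add_le_add (hle _ _ hEm'.compl) le_rfl)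
      _ ≤ a * μ E + ∫⁻ ω in Eᶜ, V N ω ∂μ := by
          exact add_le_add le_rfl (hsup N _ hEm.compl)

theorem mul_measure_exists_le {ℱ : Filtration ℕ mΩ} {V : ℕ → Ω → ℝ≥0∞}
    (hV : ∀ n, Measurable[ℱ n] (V n))
    (hsup : ∀ n A, MeasurableSet[ℱ n] A → ∫⁻ ω in A, V (n + 1) ω ∂μ ≤ ∫⁻ ω in A, V n ω ∂μ)
    (a : ℝ≥0∞) : a * μ {ω | a < ⨆ n, V n ω} ≤ ∫⁻ ω, V 0 ω ∂μ := by
  have h1 : {ω | a < ⨆ n, V n ω} ⊆ ⋃ N, {ω | ∃ n ≤ N, a ≤ V n ω} := by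
    intro ω hω
    obtain ⟨n, hn⟩ := lt_iSup_iff.1 (show a < ⨆ n, V n ω from hω)
    exact mem_iUnion.2 ⟨n, n, le_rfl, hn.le⟩
  have hmono : Monotone fun N => {ω | ∃ n ≤ N, a ≤ V n ω} :=
    fun N M hNM ω ⟨n, hn, h⟩ => ⟨n, hn.trans hNM, h⟩
  refine (mul_le_mul_right (measure_mono h1) a).trans ?_
  rw [hmono.measure_iUnion, ENNReal.mul_iSup]
  exact iSup_le fun N => le_self_add.trans (mul_measure_add_setLIntegral_le hV hsup a N)

/-- A weak-type bound controls the moments of order `θ < 1`. -/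
theorem exists_lintegral_rpow_le {θ : ℝ} (hθ0 : 0 < θ) (hθ1 : θ < 1) :
    ∃ K : ℝ≥0∞, K ≠ ∞ ∧ ∀ {Ω : Type*} {mΩ : MeasurableSpace Ω} (μ : Measure Ω) (f : Ω → ℝ≥0∞)
      (M : ℝ≥0∞), Measurable f → (∀ a : ℝ≥0∞, a * μ {ω | a < f ω} ≤ M) → μ univ ≤ M →
      ∫⁻ ω, f ω ^ θ ∂μ ≤ K * M := by
  -- Dyadic layers: the layer above `2 ^ k` contributes `2 ^ ((k + 1) * θ)` times a measure of at
  -- most `M / 2 ^ k`. The resulting geometric series converges exactly because `θ < 1`.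
  have hr : (2 : ℝ≥0∞) ^ (θ - 1) < 1 :=
    ENNReal.rpow_lt_one_of_one_lt_of_neg (by norm_num) (by linarith)
  refine ⟨1 + 2 ^ θ * (1 - 2 ^ (θ - 1))⁻¹, ?_, fun {Ω mΩ} μ f M hf hM hμ => ?_⟩
  · refine ENNReal.add_ne_top.2 ⟨ENNReal.one_ne_top, ENNReal.mul_ne_top
      (ENNReal.rpow_ne_top_of_nonneg hθ0.le (by norm_num)) ?_⟩
    exact ENNReal.inv_ne_top.2 (tsub_pos_of_lt hr).ne'
  have hmeas : ∀ k : ℕ, MeasurableSet {ω | (2 : ℝ≥0∞) ^ k < f ω} := fun k =>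
    measurableSet_lt measurable_const hf
  have hpt : ∀ ω, f ω ^ θ ≤ 1 + ∑' k : ℕ, {ω | (2 : ℝ≥0∞) ^ k < f ω}.indicator
      (fun _ => ((2 : ℝ≥0∞) ^ (k + 1)) ^ θ) ω := by
    intro ω
    rcases le_or_gt (f ω) 1 with h1 | h1
    · exact (ENNReal.rpow_le_one h1 hθ0.le).trans le_self_add
    rcases eq_or_ne (f ω) ∞ with htop | htop
    · have : ∑' k : ℕ, {ω | (2 : ℝ≥0∞) ^ k < f ω}.indicator
          (fun _ => ((2 : ℝ≥0∞) ^ (k + 1)) ^ θ) ω = ∞ := by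
        refine top_unique ?_
        calc (∞ : ℝ≥0∞) = ∑' _ : ℕ, 1 := (ENNReal.tsum_const_eq_top_of_ne_zero one_ne_zero).symm
          _ ≤ _ := by
            refine ENNReal.tsum_le_tsum fun k => ?_
            rw [indicator_of_mem]
            · exact ENNReal.one_le_rpow (one_le_pow₀ (by norm_num)) hθ0
            · simp only [mem_ofPred_eq, htop]
              exact ENNReal.pow_lt_top (by norm_num)
      rw [this]; simp
    have hex : ∃ k : ℕ, f ω ≤ 2 ^ (k + 1) := by
      obtain ⟨n, hn⟩ := ENNReal.exists_nat_gt htop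
      refine ⟨n, hn.le.trans ?_⟩
      exact_mod_cast (Nat.lt_two_pow_self.le.trans (Nat.pow_le_pow_right (by norm_num) n.le_succ))
    classical
    have hk := Nat.find_spec hex
    have hk' : (2 : ℝ≥0∞) ^ (Nat.find hex) < f ω := by
      rcases Nat.eq_zero_or_eq_succ_pred (Nat.find hex) with h0 | h0
      · rw [h0, pow_zero]; exact h1
      · have := Nat.find_min hex (m := (Nat.find hex).pred) (by omega)
        rw [not_le] at this
        rwa [h0]
    refine le_trans ?_ le_add_self
    refine le_trans ?_ (ENNReal.le_tsum (Nat.find hex))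
    rw [indicator_of_mem (by exact hk')]
    gcongr
  calc ∫⁻ ω, f ω ^ θ ∂μ
      ≤ ∫⁻ ω, (1 + ∑' k : ℕ, {ω | (2 : ℝ≥0∞) ^ k < f ω}.indicator
        (fun _ => ((2 : ℝ≥0∞) ^ (k + 1)) ^ θ) ω) ∂μ := lintegral_mono hpt
    _ = μ univ + ∑' k : ℕ, ((2 : ℝ≥0∞) ^ (k + 1)) ^ θ * μ {ω | (2 : ℝ≥0∞) ^ k < f ω} := by
      rw [lintegral_add_left measurable_const, lintegral_one, lintegral_tsum fun k =>
        (measurable_const.indicator (hmeas k)).aemeasurable]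
      congr 1
      refine tsum_congr fun k => ?_
      rw [lintegral_indicator_const (hmeas k)]
    _ ≤ M + ∑' k : ℕ, 2 ^ θ * (2 ^ (θ - 1)) ^ k * M := by
      refine add_le_add hμ (ENNReal.tsum_le_tsum fun k => ?_)
      have h2 : ((2 : ℝ≥0∞) ^ (k + 1)) ^ θ = 2 ^ θ * (2 ^ (θ - 1)) ^ k * 2 ^ k := by
        rw [mul_assoc, ← mul_pow, ← ENNReal.rpow_natCast, ← ENNReal.rpow_mul, mul_comm,
          ENNReal.rpow_mul, ENNReal.rpow_natCast, pow_succ']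
        congr 2
        nth_rewrite 3 [← ENNReal.rpow_one 2]
        rw [← ENNReal.rpow_add _ _ (by norm_num) (by norm_num)]
        congr 1; ring
      rw [h2, mul_assoc (2 ^ θ * _)]
      exact mul_le_mul' le_rfl (hM _)
    _ = _ := by
      rw [ENNReal.tsum_mul_right, ENNReal.tsum_mul_left, ENNReal.tsum_geometric, add_mul, one_mul]

end Maximal

/-! ### Paths of the Poisson process and of the scheme -/

section Paths

/-- The random Euler scheme along the jump times `θ`. -/
noncomputable def randomEuler {d : ℕ}
    (b : ℝ → EuclideanSpace ℝ (Fin d) → EuclideanSpace ℝ (Fin d)) (θ : ℕ → ℝ) (ε : ℝ)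
    (x : EuclideanSpace ℝ (Fin d)) : ℕ → EuclideanSpace ℝ (Fin d)
  | 0 => x
  | n + 1 => randomEuler b θ ε x n + ε • b (θ (n + 1)) (randomEuler b θ ε x n)

theorem randomEuler_eq_sum {d : ℕ}
    (b : ℝ → EuclideanSpace ℝ (Fin d) → EuclideanSpace ℝ (Fin d)) (θ : ℕ → ℝ) (ε : ℝ)
    (x : EuclideanSpace ℝ (Fin d)) (n : ℕ) :
    randomEuler b θ ε x n =
      x + ε • ∑ k ∈ Finset.range n, b (θ (k + 1)) (randomEuler b θ ε x k) := by
  induction n with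
  | zero => simp [randomEuler]
  | succ n ih => rw [randomEuler, Finset.sum_range_succ, smul_add, ← add_assoc, ← ih]

theorem leftLim_eq_of_forall_Ioo {F : Type*} [TopologicalSpace F] [T2Space F] {f : ℝ → F}
    {r s : ℝ} {c : F} (hrs : r < s) (h : ∀ u ∈ Ioo r s, f u = c) : Function.leftLim f s = c := by
  refine leftLim_eq_of_tendsto ?_
  refine tendsto_const_nhds.congr' ?_
  filter_upwards [Ioo_mem_nhdsLT hrs] with u hu using (h u hu).symm

variable {Ω : Type*} {τ : ℕ → Ω → ℝ} {ω : Ω}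

theorem arrivalTime_succ (τ : ℕ → Ω → ℝ) (n : ℕ) (ω : Ω) :
    arrivalTime τ (n + 1) ω = arrivalTime τ n ω + τ n ω :=
  Finset.sum_range_succ _ _

theorem strictMono_arrivalTime (hτ : ∀ k, 0 < τ k ω) : StrictMono fun n => arrivalTime τ n ω :=
  strictMono_nat_of_lt_succ fun n => by rw [arrivalTime_succ]; linarith [hτ n]

theorem arrivalTime_nonneg (hτ : ∀ k, 0 < τ k ω) (n : ℕ) : 0 ≤ arrivalTime τ n ω :=
  Finset.sum_nonneg fun k _ => (hτ k).le

theorem poissonProcess_eq (hτ : ∀ k, 0 < τ k ω) {u : ℝ} {n : ℕ} (h1 : arrivalTime τ n ω ≤ u)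
    (h2 : u < arrivalTime τ (n + 1) ω) : poissonProcess τ u ω = n := by
  have hm := strictMono_arrivalTime hτ
  have : {k : ℕ | arrivalTime τ k ω ≤ u} = Iic n := by
    ext k
    simp only [mem_ofPred_eq, mem_Iic]
    refine ⟨fun hk => ?_, fun hk => (hm.monotone hk).trans h1⟩
    exact Nat.lt_succ_iff.1 (hm.lt_iff_lt.1 (hk.trans_lt h2))
  rw [poissonProcess, this, csSup_Iic]

theorem exists_arrivalTime_le_lt (hS : Tendsto (fun n => arrivalTime τ n ω) atTop atTop) {u : ℝ}
    (hu : 0 ≤ u) : ∃ n, arrivalTime τ n ω ≤ u ∧ u < arrivalTime τ (n + 1) ω := by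
  have hex : ∃ n, u < arrivalTime τ n ω := (hS.eventually_gt_atTop u).exists
  classical
  have h0 : Nat.find hex ≠ 0 := fun h => by
    have := Nat.find_spec hex
    rw [h] at this
    simp only [arrivalTime, Finset.range_zero, Finset.sum_empty] at this
    linarith
  obtain ⟨n, hn⟩ := Nat.exists_eq_succ_of_ne_zero h0
  refine ⟨n, not_lt.1 (Nat.find_min hex (by omega)), ?_⟩
  have := Nat.find_spec hex
  rwa [hn] at this

variable {ε : ℝ}

theorem scaledPoisson_eq (hτ : ∀ k, 0 < τ k ω) (hε : 0 < ε) {t : ℝ} {n : ℕ}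
    (h1 : ε * arrivalTime τ n ω ≤ t) (h2 : t < ε * arrivalTime τ (n + 1) ω) :
    scaledPoisson τ ε t ω = n := by
  rw [scaledPoisson, poissonProcess_eq hτ ((le_div_iff₀' hε).2 h1) ((div_lt_iff₀' hε).2 h2)]

theorem exists_mul_arrivalTime_le_lt (hS : Tendsto (fun n => arrivalTime τ n ω) atTop atTop)
    (hε : 0 < ε) {t : ℝ} (ht : 0 ≤ t) :
    ∃ n, ε * arrivalTime τ n ω ≤ t ∧ t < ε * arrivalTime τ (n + 1) ω := by
  obtain ⟨n, h1, h2⟩ := exists_arrivalTime_le_lt hS (div_nonneg ht hε.le)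
  exact ⟨n, (le_div_iff₀' hε).1 h1, (div_lt_iff₀' hε).1 h2⟩

theorem leftLim_scaledPoisson_eq (hτ : ∀ k, 0 < τ k ω) (hε : 0 < ε) {t : ℝ} {n : ℕ}
    (h1 : ε * arrivalTime τ n ω < t) (h2 : t ≤ ε * arrivalTime τ (n + 1) ω) :
    Function.leftLim (fun s => scaledPoisson τ ε s ω) t = n :=
  leftLim_eq_of_forall_Ioo h1 fun _ hu => scaledPoisson_eq hτ hε hu.1.le (hu.2.trans_le h2)

/-- The integral against the Poisson path is the sum over the jump times. -/
theorem stepIntegral_scaledPoisson {d : ℕ} (hτ : ∀ k, 0 < τ k ω)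
    (hS : Tendsto (fun n => arrivalTime τ n ω) atTop atTop) (hε : 0 < ε)
    (f : ℝ → EuclideanSpace ℝ (Fin d)) {t : ℝ} {n : ℕ}
    (h1 : ε * arrivalTime τ n ω ≤ t) (h2 : t < ε * arrivalTime τ (n + 1) ω) :
    stepIntegral (fun s => scaledPoisson τ ε s ω) f t =
      ∑ k ∈ Finset.range n, f (ε * arrivalTime τ (k + 1) ω) := by
  have hm := strictMono_arrivalTime hτ
  have hmε : StrictMono fun n => ε * arrivalTime τ n ω := hm.const_mul hε
  have hjump : ∀ k, scaledPoisson τ ε (ε * arrivalTime τ (k + 1) ω) ω -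
      Function.leftLim (fun s => scaledPoisson τ ε s ω) (ε * arrivalTime τ (k + 1) ω) = 1 := by
    intro k
    rw [scaledPoisson_eq hτ hε le_rfl (hmε (Nat.lt_succ_self (k + 1))),
      leftLim_scaledPoisson_eq hτ hε (hmε (Nat.lt_succ_self k)) le_rfl]
    push_cast; ring
  have hnojump : ∀ s, 0 < s → (∀ k, s ≠ ε * arrivalTime τ (k + 1) ω) →
      scaledPoisson τ ε s ω - Function.leftLim (fun s => scaledPoisson τ ε s ω) s = 0 := by
    intro s hs hne
    obtain ⟨k, hk1, hk2⟩ := exists_mul_arrivalTime_le_lt hS hε hs.le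
    have hk3 : ε * arrivalTime τ k ω ≠ s := by
      cases k with
      | zero =>
        intro h
        simp only [arrivalTime, Finset.range_zero, Finset.sum_empty, mul_zero] at h
        exact hs.ne h
      | succ k => exact fun h => hne k h.symm
    rw [scaledPoisson_eq hτ hε hk1 hk2,
      leftLim_scaledPoisson_eq hτ hε (lt_of_le_of_ne hk1 hk3) hk2.le, sub_self]
  rw [stepIntegral, finsum_mem_eq_sum_of_inter_support_eq
    (t := (Finset.range n).image fun k => ε * arrivalTime τ (k + 1) ω)]
  · rw [Finset.sum_image fun i _ j _ hij => by
      have := hmε.injective hij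
      omega]
    exact Finset.sum_congr rfl fun k _ => by rw [hjump, one_smul]
  · ext s
    simp only [mem_inter_iff, mem_Ioc, Function.mem_support, Finset.coe_image, Finset.coe_range,
      mem_image, mem_Iio]
    refine and_congr_left fun hs => ⟨fun ⟨hs0, hst⟩ => ?_, ?_⟩
    · by_contra! hcon
      refine hs ?_
      rw [hnojump s hs0 fun k hk => ?_, zero_smul]
      rcases lt_or_ge k n with hkn | hkn
      · exact hcon k hkn hk.symm
      · have : ε * arrivalTime τ (n + 1) ω ≤ ε * arrivalTime τ (k + 1) ω :=
          hmε.monotone (by omega)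
        linarith
    · rintro ⟨k, hk, rfl⟩
      exact ⟨mul_pos hε ((arrivalTime_nonneg hτ 0).trans_lt (hm (Nat.succ_pos k))),
        (hmε.monotone (by omega : k + 1 ≤ n)).trans h1⟩

variable {d : ℕ} {b : ℝ → EuclideanSpace ℝ (Fin d) → EuclideanSpace ℝ (Fin d)}
  {x : EuclideanSpace ℝ (Fin d)}

/-- A solution path of the equation driven by the Poisson path is the random Euler scheme. -/
theorem eq_randomEuler_of_solves (hτ : ∀ k, 0 < τ k ω)
    (hS : Tendsto (fun n => arrivalTime τ n ω) atTop atTop) (hε : 0 < ε)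
    {Y : ℝ → EuclideanSpace ℝ (Fin d)}
    (hY : ∀ t, 0 ≤ t → Y t = x + ε • stepIntegral (fun s => scaledPoisson τ ε s ω)
      (fun s => b s (Function.leftLim Y s)) t) (n : ℕ) :
    ∀ t, ε * arrivalTime τ n ω ≤ t → t < ε * arrivalTime τ (n + 1) ω →
      Y t = randomEuler b (fun k => ε * arrivalTime τ k ω) ε x n := by
  -- The sum at a time in the `n`-th interval involves only left limits at jumps `k + 1 ≤ n`, hence
  -- values of `Y` on earlier intervals.
  induction n using Nat.strong_induction_on with
  | _ n ih =>
    intro t h1 h2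
    rw [hY t ((mul_nonneg hε.le (arrivalTime_nonneg hτ n)).trans h1),
      stepIntegral_scaledPoisson hτ hS hε _ h1 h2, randomEuler_eq_sum]
    congr 2
    refine Finset.sum_congr rfl fun k hk => ?_
    rw [leftLim_eq_of_forall_Ioo (mul_lt_mul_of_pos_left
      (strictMono_arrivalTime hτ (Nat.lt_succ_self k)) hε) fun u hu =>
      ih k (Finset.mem_range.1 hk) u hu.1.le hu.2]

/-- The piecewise constant interpolation of the random Euler scheme solves the equation. -/
theorem solves_of_eq_randomEuler (hτ : ∀ k, 0 < τ k ω)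
    (hS : Tendsto (fun n => arrivalTime τ n ω) atTop atTop) (hε : 0 < ε)
    {Y : ℝ → EuclideanSpace ℝ (Fin d)}
    (hY : ∀ n t, ε * arrivalTime τ n ω ≤ t → t < ε * arrivalTime τ (n + 1) ω →
      Y t = randomEuler b (fun k => ε * arrivalTime τ k ω) ε x n) (t : ℝ) (ht : 0 ≤ t) :
    Y t = x + ε • stepIntegral (fun s => scaledPoisson τ ε s ω)
      (fun s => b s (Function.leftLim Y s)) t := by
  obtain ⟨n, h1, h2⟩ := exists_mul_arrivalTime_le_lt hS hε ht
  rw [stepIntegral_scaledPoisson hτ hS hε _ h1 h2, hY n t h1 h2, randomEuler_eq_sum]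
  congr 2
  refine Finset.sum_congr rfl fun k _ => ?_
  rw [leftLim_eq_of_forall_Ioo (mul_lt_mul_of_pos_left
    (strictMono_arrivalTime hτ (Nat.lt_succ_self k)) hε) fun u hu => hY k u hu.1.le hu.2]

end Paths

/-! ### Independence of the waiting times from the past -/

section Independence

/-- The intersections `A ∩ B` form a π-system generating `m₁ ⊔ m₂`, and on them the product formula
follows from the two hypotheses. It is used to join `ξ` with the earlier waiting times. -/
theorem ProbabilityTheory.Indep.sup_left {Ω : Type*} {m₁ m₂ m₃ mΩ : MeasurableSpace Ω}
    {μ : Measure Ω} [IsProbabilityMeasure μ] (h₁ : m₁ ≤ mΩ) (h₂ : m₂ ≤ mΩ) (h₃ : m₃ ≤ mΩ)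
    (h₁₂₃ : Indep m₁ (m₂ ⊔ m₃) μ) (h₂₃ : Indep m₂ m₃ μ) : Indep (m₁ ⊔ m₂) m₃ μ := by
  set π : Set (Set Ω) := {s | ∃ A B, MeasurableSet[m₁] A ∧ MeasurableSet[m₂] B ∧ A ∩ B = s}
    with hπ
  have hgen : m₁ ⊔ m₂ = MeasurableSpace.generateFrom π := by
    refine le_antisymm (sup_le ?_ ?_) (MeasurableSpace.generateFrom_le ?_)
    · exact fun A hA => MeasurableSpace.measurableSet_generateFrom
        ⟨A, univ, hA, MeasurableSet.univ, inter_univ A⟩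
    · exact fun B hB => MeasurableSpace.measurableSet_generateFrom
        ⟨univ, B, MeasurableSet.univ, hB, univ_inter B⟩
    · rintro _ ⟨A, B, hA, hB, rfl⟩
      exact MeasurableSet.inter ((le_sup_left : m₁ ≤ m₁ ⊔ m₂) _ hA)
        ((le_sup_right : m₂ ≤ m₁ ⊔ m₂) _ hB)
  refine IndepSets.indep (p2 := {s | MeasurableSet[m₃] s}) (sup_le h₁ h₂) h₃ ?_
    (@MeasurableSpace.isPiSystem_measurableSet Ω m₃) hgen
    (@MeasurableSpace.generateFrom_measurableSet Ω m₃).symm ?_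
  · rintro _ ⟨A, B, hA, hB, rfl⟩ _ ⟨A', B', hA', hB', rfl⟩ -
    exact ⟨A ∩ A', B ∩ B', hA.inter hA', hB.inter hB', inter_inter_inter_comm _ _ _ _⟩
  · rw [IndepSets_iff]
    rintro _ C ⟨A, B, hA, hB, rfl⟩ hC
    rw [Indep_iff] at h₁₂₃ h₂₃
    have hB' := (le_sup_left : m₂ ≤ m₂ ⊔ m₃) _ hB
    have hC' := (le_sup_right : m₃ ≤ m₂ ⊔ m₃) _ hC
    rw [inter_assoc, h₁₂₃ A (B ∩ C) hA (MeasurableSet.inter hB' hC'), h₂₃ B C hB hC,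
      h₁₂₃ A B hA hB', mul_assoc]

variable {Ω β E : Type*} {mΩ : MeasurableSpace Ω} [MeasurableSpace β] [mE : MeasurableSpace E]
  {P : Measure Ω} {τ : ℕ → Ω → ℝ} {ξ : Ω → E}

/-- The information carried by `ξ` and the first `n` waiting times. -/
def waitingFiltration (hξ : Measurable ξ) (hτ : ∀ k, Measurable (τ k)) : Filtration ℕ mΩ where
  seq n := MeasurableSpace.comap ξ mE ⊔ ⨆ k ∈ Iio n, MeasurableSpace.comap (τ k) inferInstance
  mono' _ _ h := sup_le_sup le_rfl (biSup_mono fun _ hk => lt_of_lt_of_le hk h)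
  le' _ := sup_le hξ.comap_le (iSup₂_le fun k _ => (hτ k).comap_le)

theorem measurable_waitingFiltration_init (hξ : Measurable ξ) (hτ : ∀ k, Measurable (τ k)) (n : ℕ) :
    Measurable[waitingFiltration hξ hτ n] ξ :=
  (comap_measurable ξ).mono le_sup_left le_rfl

theorem measurable_waitingFiltration (hξ : Measurable ξ) (hτ : ∀ k, Measurable (τ k)) {k n : ℕ}
    (hk : k < n) : Measurable[waitingFiltration hξ hτ n] (τ k) :=
  (comap_measurable (τ k)).mono ((le_iSup₂ (f := fun k (_ : k ∈ Iio n) =>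
    MeasurableSpace.comap (τ k) inferInstance) k hk).trans le_sup_right) le_rfl

theorem indep_waitingFiltration [IsProbabilityMeasure P] (hξ : Measurable ξ)
    (hτ : ∀ k, Measurable (τ k)) (hi : iIndepFun τ P)
    (hξτ : Indep (MeasurableSpace.comap ξ mE)
      (⨆ k, MeasurableSpace.comap (τ k) inferInstance) P) (n : ℕ) :
    Indep (waitingFiltration hξ hτ n) (MeasurableSpace.comap (τ n) inferInstance) P := by
  have hle : ∀ k, MeasurableSpace.comap (τ k) inferInstance ≤ mΩ := fun k => (hτ k).comap_le
  refine Indep.sup_left hξ.comap_le (iSup₂_le fun k _ => hle k) (hle n) ?_ ?_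
  · exact indep_of_indep_of_le_right hξτ (sup_le (iSup₂_le fun k _ =>
      le_iSup (fun k => MeasurableSpace.comap (τ k) inferInstance) k)
      (le_iSup (fun k => MeasurableSpace.comap (τ k) inferInstance) n))
  · have h := indep_iSup_of_disjoint hle hi (S := Iio n) (T := {n}) (by simp)
    simpa using h

/-- Integrating out a waiting time that is independent of the past. -/
theorem lintegral_mul_of_indep {Ω β : Type*} {m mΩ : MeasurableSpace Ω} [MeasurableSpace β]
    {P : Measure Ω} [IsProbabilityMeasure P] (hm : m ≤ mΩ)
    {T : Ω → ℝ} (hT : Measurable T) {ν : Measure ℝ} (hlaw : P.map T = ν)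
    (hind : Indep m (MeasurableSpace.comap T inferInstance) P) {R : Ω → ℝ≥0∞}
    (hR : Measurable[m] R) {U : Ω → β} (hU : Measurable[m] U) {f : β × ℝ → ℝ≥0∞}
    (hf : Measurable f) :
    ∫⁻ ω, R ω * f (U ω, T ω) ∂P = ∫⁻ ω, R ω * ∫⁻ r, f (U ω, r) ∂ν ∂P := by
  have hRm : Measurable R := hR.mono hm le_rfl
  have hUm : Measurable U := hU.mono hm le_rfl
  have hRU : Measurable[m] fun ω => (R ω, U ω) := hR.prodMk hU
  have hindF : IndepFun (fun ω => (R ω, U ω)) T P :=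
    indep_of_indep_of_le_left hind hRU.comap_le
  have hRUm : Measurable fun ω => (R ω, U ω) := hRm.prodMk hUm
  have hmap := (indepFun_iff_map_prod_eq_prod_map_map hRUm.aemeasurable hT.aemeasurable).1 hindF
  have hg : Measurable fun q : (ℝ≥0∞ × β) × ℝ => q.1.1 * f (q.1.2, q.2) := by fun_prop
  have : IsProbabilityMeasure ν := hlaw ▸ Measure.isProbabilityMeasure_map hT.aemeasurable
  calc ∫⁻ ω, R ω * f (U ω, T ω) ∂P
      = ∫⁻ q, q.1.1 * f (q.1.2, q.2) ∂(P.map fun ω => ((R ω, U ω), T ω)) :=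
        (lintegral_map hg (hRUm.prodMk hT)).symm
    _ = ∫⁻ q, ∫⁻ r, q.1 * f (q.2, r) ∂ν ∂(P.map fun ω => (R ω, U ω)) := by
        rw [hmap, hlaw, lintegral_prod _ hg.aemeasurable]
    _ = ∫⁻ ω, ∫⁻ r, R ω * f (U ω, r) ∂ν ∂P :=
        lintegral_map hg.lintegral_prod_right' hRUm
    _ = _ := lintegral_congr fun ω => lintegral_const_mul _ (by fun_prop)

end Independence

/-! ### Almost sure behaviour of the arrival times -/

section Arrival

variable {Ω : Type*} {mΩ : MeasurableSpace Ω} {P : Measure Ω} {τ : ℕ → Ω → ℝ}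

theorem ae_forall_pos (hlaw : ∀ k, HasLaw (τ k) (expMeasure 1) P) :
    ∀ᵐ ω ∂P, ∀ k, 0 < τ k ω := by
  refine ae_all_iff.2 fun k => ?_
  have h := ae_expMeasure_pos
  rw [← (hlaw k).map_eq] at h
  exact ae_of_ae_map (hlaw k).aemeasurable h

/-- By independence `E exp (-S_n) ≤ 2 ^ (-n)`, so `∑ exp (-S_n)` has finite expectation and its
terms tend to zero almost surely. -/
theorem ae_tendsto_arrivalTime [IsProbabilityMeasure P] (hτ : ∀ k, Measurable (τ k))
    (hlaw : ∀ k, HasLaw (τ k) (expMeasure 1) P) (hi : iIndepFun τ P) :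
    ∀ᵐ ω ∂P, Tendsto (fun n => arrivalTime τ n ω) atTop atTop := by
  let X : ℕ → Ω → ℝ≥0∞ := fun k ω => ENNReal.ofReal (Real.exp (-(τ k ω)))
  have hg : Measurable fun r : ℝ => ENNReal.ofReal (Real.exp (-r)) := by fun_prop
  have hX : ∀ k, Measurable (X k) := fun k => hg.comp (hτ k)
  have hXi : iIndepFun X P := hi.comp (fun _ r => ENNReal.ofReal (Real.exp (-r))) fun _ => hg
  have hXint : ∀ k, ∫⁻ ω, X k ω ∂P ≤ 2⁻¹ := by
    intro k
    have h1 : ∫⁻ ω, X k ω ∂P = ∫⁻ r, ENNReal.ofReal (Real.exp (-r)) ∂(expMeasure 1) := by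
      rw [← (hlaw k).map_eq, lintegral_map hg (hτ k)]
    have h2 := lintegral_exp_neg_mul_expMeasure_le (a := 1) (by norm_num)
    simp only [neg_mul, one_mul] at h2
    rw [h1]
    refine h2.trans (le_of_eq ?_)
    rw [show (1 : ℝ) / (1 + 1) = 2⁻¹ by norm_num, ENNReal.ofReal_inv_of_pos (by norm_num)]
    simp
  have hprod : ∀ n ω, ENNReal.ofReal (Real.exp (-(arrivalTime τ n ω))) =
      ∏ k ∈ Finset.range n, X k ω := by
    intro n ω
    rw [arrivalTime, ← Finset.sum_neg_distrib, Real.exp_sum,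
      ENNReal.ofReal_prod_of_nonneg fun _ _ => (Real.exp_pos _).le]
  have hm : ∀ n, Measurable fun ω => ENNReal.ofReal (Real.exp (-(arrivalTime τ n ω))) := by
    intro n
    simp_rw [hprod]
    exact Finset.measurable_fun_prod _ fun k _ => hX k
  have hsum : ∫⁻ ω, ∑' n, ENNReal.ofReal (Real.exp (-(arrivalTime τ n ω))) ∂P ≠ ∞ := by
    rw [lintegral_tsum fun n => (hm n).aemeasurable]
    refine ne_top_of_le_ne_top (b := ∑' n : ℕ, (2⁻¹ : ℝ≥0∞) ^ n) ?_ (ENNReal.tsum_le_tsum fun n => ?_)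
    · rw [ENNReal.tsum_geometric]
      simp
    · simp_rw [hprod]
      rw [lintegral_prod_eq_prod_lintegral_of_indepFun _ X hXi hX]
      exact (Finset.prod_le_prod' fun k _ => hXint k).trans (by simp)
  filter_upwards [ae_lt_top (Measurable.tsum hm) hsum] with ω hω
  have h1 := ENNReal.tendsto_atTop_zero_of_tsum_ne_top hω.ne
  have h2 : Tendsto (fun n => Real.exp (-(arrivalTime τ n ω))) atTop (𝓝 0) := by
    have := (ENNReal.tendsto_toReal ENNReal.zero_ne_top).comp h1
    simpa [Function.comp_def, ENNReal.toReal_ofReal (Real.exp_pos _).le] using this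
  have h3 : Tendsto (fun n => -(arrivalTime τ n ω)) atTop atBot :=
    Real.tendsto_exp_comp_nhds_zero.1 h2
  simpa [Function.comp_def] using tendsto_neg_atBot_atTop.comp h3

end Arrival

/-! ### Moments of the Lyapunov process -/

section LyapunovProcess

variable {d : ℕ} {Ω : Type*}

/-- The Lyapunov function along the random Euler scheme, plus the cost of the last waiting time. -/
noncomputable def lyapunovProcess
    (b Φ : ℝ → EuclideanSpace ℝ (Fin d) → EuclideanSpace ℝ (Fin d)) (l c ε : ℝ) (m : ℕ)
    (τ : ℕ → Ω → ℝ) (ξ : Ω → EuclideanSpace ℝ (Fin d)) : ℕ → Ω → ℝ≥0∞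
  | 0, ω => ENNReal.ofReal (lyapunov Φ l ε m (ξ ω) 0 (ξ ω))
  | n + 1, ω =>
    ENNReal.ofReal (lyapunov Φ l ε m (ξ ω) (ε * arrivalTime τ (n + 1) ω)
      (randomEuler b (fun k => ε * arrivalTime τ k ω) ε (ξ ω) (n + 1))) +
    ENNReal.ofReal (waitingCost c l ε m (ξ ω) (ε * arrivalTime τ n ω)
      (randomEuler b (fun k => ε * arrivalTime τ k ω) ε (ξ ω) n) (τ n ω))

theorem lyapunov_le_lyapunovProcess
    (b Φ : ℝ → EuclideanSpace ℝ (Fin d) → EuclideanSpace ℝ (Fin d)) (l c ε : ℝ) (m : ℕ)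
    (τ : ℕ → Ω → ℝ) (ξ : Ω → EuclideanSpace ℝ (Fin d)) (n : ℕ) (ω : Ω) :
    ENNReal.ofReal (lyapunov Φ l ε m (ξ ω) (ε * arrivalTime τ n ω)
      (randomEuler b (fun k => ε * arrivalTime τ k ω) ε (ξ ω) n)) ≤
      lyapunovProcess b Φ l c ε m τ ξ n ω := by
  cases n with
  | zero => simp [lyapunovProcess, arrivalTime, randomEuler]
  | succ n => exact le_self_add

variable {mΩ : MeasurableSpace Ω} {P : Measure Ω} {τ : ℕ → Ω → ℝ}
  {ξ : Ω → EuclideanSpace ℝ (Fin d)}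
  {b Φ : ℝ → EuclideanSpace ℝ (Fin d) → EuclideanSpace ℝ (Fin d)} {l c ε : ℝ} {m : ℕ}

theorem measurable_lyapunov (hΦ : Measurable (Function.uncurry Φ)) :
    Measurable fun q : EuclideanSpace ℝ (Fin d) × ℝ × EuclideanSpace ℝ (Fin d) =>
      lyapunov Φ l ε m q.1 q.2.1 q.2.2 := by
  have h : Measurable fun q : EuclideanSpace ℝ (Fin d) × ℝ × EuclideanSpace ℝ (Fin d) =>
      Φ q.2.1 q.1 := hΦ.comp (measurable_snd.fst.prodMk measurable_fst)
  unfold lyapunov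
  fun_prop

theorem measurable_waitingCost :
    Measurable fun q : (EuclideanSpace ℝ (Fin d) × ℝ × EuclideanSpace ℝ (Fin d)) × ℝ =>
      waitingCost c l ε m q.1.1 q.1.2.1 q.1.2.2 q.2 := by
  unfold waitingCost
  fun_prop

theorem measurable_arrivalTime_filtration (hξ : Measurable ξ) (hτ : ∀ k, Measurable (τ k))
    (n : ℕ) : Measurable[waitingFiltration hξ hτ n] fun ω => ε * arrivalTime τ n ω := by
  refine Measurable.const_mul ?_ ε
  unfold arrivalTime
  refine Finset.measurable_fun_sum _ fun k hk => ?_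
  exact measurable_waitingFiltration hξ hτ (Finset.mem_range.1 hk)

theorem measurable_randomEuler_filtration (hbm : Measurable (Function.uncurry b))
    (hξ : Measurable ξ) (hτ : ∀ k, Measurable (τ k)) (n : ℕ) :
    Measurable[waitingFiltration hξ hτ n] fun ω =>
      randomEuler b (fun k => ε * arrivalTime τ k ω) ε (ξ ω) n := by
  induction n with
  | zero => exact measurable_waitingFiltration_init hξ hτ 0
  | succ n ih =>
    have h1 : Measurable[waitingFiltration hξ hτ (n + 1)] fun ω =>
        randomEuler b (fun k => ε * arrivalTime τ k ω) ε (ξ ω) n :=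
      ih.mono ((waitingFiltration hξ hτ).mono n.le_succ) le_rfl
    have h2 := measurable_arrivalTime_filtration (ε := ε) hξ hτ (n + 1)
    have h3 := hbm.comp (h2.prodMk h1)
    exact h1.add (h3.const_smul ε)

theorem measurable_lyapunovProcess (hbm : Measurable (Function.uncurry b))
    (hΦ : Measurable (Function.uncurry Φ)) (hξ : Measurable ξ) (hτ : ∀ k, Measurable (τ k)) (n : ℕ) :
    Measurable[waitingFiltration hξ hτ n] (lyapunovProcess b Φ l c ε m τ ξ n) := by
  cases n with
  | zero =>
    have h := measurable_waitingFiltration_init hξ hτ 0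
    exact ((measurable_lyapunov hΦ).comp (h.prodMk (measurable_const.prodMk h))).ennreal_ofReal
  | succ n =>
    have hmono := (waitingFiltration hξ hτ).mono n.le_succ
    have h := measurable_waitingFiltration_init hξ hτ (n + 1)
    have h1 := (measurable_lyapunov (l := l) (ε := ε) (m := m) hΦ).comp
      (h.prodMk ((measurable_arrivalTime_filtration (ε := ε) hξ hτ (n + 1)).prodMk
        (measurable_randomEuler_filtration (ε := ε) hbm hξ hτ (n + 1))))
    have h2 := (measurable_waitingCost (c := c) (l := l) (ε := ε) (m := m)).comp
      ((h.prodMk (((measurable_arrivalTime_filtration (ε := ε) hξ hτ n).mono hmono le_rfl).prodMk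
        ((measurable_randomEuler_filtration (ε := ε) hbm hξ hτ n).mono hmono le_rfl))).prodMk
        (measurable_waitingFiltration hξ hτ n.lt_succ_self))
    exact h1.ennreal_ofReal.add h2.ennreal_ofReal

/-- The Lyapunov process is a supermartingale. -/
theorem lintegral_mul_lyapunovProcess_succ_le [IsProbabilityMeasure P]
    (hbm : Measurable (Function.uncurry b)) (hΦ : Measurable (Function.uncurry Φ))
    (hε : 0 < ε)
    (hstep : ∀ t : ℝ, 0 ≤ t → ∀ x z : EuclideanSpace ℝ (Fin d),
      ∫⁻ r, (ENNReal.ofReal (lyapunov Φ l ε m x (t + ε * r) (z + ε • b (t + ε * r) z)) +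
          ENNReal.ofReal (waitingCost c l ε m x t z r)) ∂(expMeasure 1) ≤
        ENNReal.ofReal (lyapunov Φ l ε m x t z))
    (hξ : Measurable ξ) (hτ : ∀ k, Measurable (τ k))
    (hlaw : ∀ k, HasLaw (τ k) (expMeasure 1) P) (hi : iIndepFun τ P)
    (hξτ : Indep (MeasurableSpace.comap ξ inferInstance)
      (⨆ k, MeasurableSpace.comap (τ k) inferInstance) P) (n : ℕ) {R : Ω → ℝ≥0∞}
    (hR : Measurable[waitingFiltration hξ hτ n] R) :
    ∫⁻ ω, R ω * lyapunovProcess b Φ l c ε m τ ξ (n + 1) ω ∂P ≤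
      ∫⁻ ω, R ω * lyapunovProcess b Φ l c ε m τ ξ n ω ∂P := by
  let f : (EuclideanSpace ℝ (Fin d) × ℝ × EuclideanSpace ℝ (Fin d)) × ℝ → ℝ≥0∞ := fun q =>
    ENNReal.ofReal (lyapunov Φ l ε m q.1.1 (q.1.2.1 + ε * q.2)
      (q.1.2.2 + ε • b (q.1.2.1 + ε * q.2) q.1.2.2)) +
    ENNReal.ofReal (waitingCost c l ε m q.1.1 q.1.2.1 q.1.2.2 q.2)
  have hf : Measurable f := by
    have h1 : Measurable fun q : (EuclideanSpace ℝ (Fin d) × ℝ × EuclideanSpace ℝ (Fin d)) × ℝ =>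
        q.1.2.1 + ε * q.2 := by fun_prop
    have h2 : Measurable fun q : (EuclideanSpace ℝ (Fin d) × ℝ × EuclideanSpace ℝ (Fin d)) × ℝ =>
        b (q.1.2.1 + ε * q.2) q.1.2.2 := hbm.comp (h1.prodMk (by fun_prop))
    have h3 := (measurable_lyapunov (l := l) (ε := ε) (m := m) hΦ).comp
      ((measurable_fst.fst : Measurable fun q :
        (EuclideanSpace ℝ (Fin d) × ℝ × EuclideanSpace ℝ (Fin d)) × ℝ => q.1.1).prodMk
        (h1.prodMk (measurable_fst.snd.snd.add (h2.const_smul ε))))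
    exact h3.ennreal_ofReal.add measurable_waitingCost.ennreal_ofReal
  let U : Ω → EuclideanSpace ℝ (Fin d) × ℝ × EuclideanSpace ℝ (Fin d) := fun ω =>
    (ξ ω, ε * arrivalTime τ n ω, randomEuler b (fun k => ε * arrivalTime τ k ω) ε (ξ ω) n)
  have hU : Measurable[waitingFiltration hξ hτ n] U :=
    (measurable_waitingFiltration_init hξ hτ n).prodMk
      ((measurable_arrivalTime_filtration hξ hτ n).prodMk
        (measurable_randomEuler_filtration hbm hξ hτ n))
  have hW : ∀ ω, lyapunovProcess b Φ l c ε m τ ξ (n + 1) ω = f (U ω, τ n ω) := by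
    intro ω
    simp only [lyapunovProcess, f, U, randomEuler, arrivalTime_succ, mul_add]
  simp_rw [hW]
  rw [lintegral_mul_of_indep ((waitingFiltration hξ hτ).le n) (hτ n) (hlaw n).map_eq
    (indep_waitingFiltration hξ hτ hi hξτ n) hR hU hf]
  refine lintegral_mono_ae ?_
  filter_upwards [ae_forall_pos hlaw] with ω hω
  refine mul_le_mul' le_rfl ?_
  -- The one-step estimate starts from the Lyapunov function alone; the cost of the preceding
  -- waiting time, present in the process at time `n`, is simply dropped.
  exact (hstep _ (mul_nonneg hε.le (arrivalTime_nonneg hω n)) _ _).trans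
    (lyapunov_le_lyapunovProcess b Φ l c ε m τ ξ n ω)

theorem lyapunovProcess_zero (hΦ0 : ∀ x, Φ 0 x = x) (ω : Ω) :
    lyapunovProcess b Φ l c ε m τ ξ 0 ω =
      ENNReal.ofReal (ε ^ (m + 1) * ((1 + 2 * ‖ξ ω‖) ^ 2) ^ (m + 1)) := by
  simp only [lyapunovProcess, lyapunov, hΦ0, sub_self, norm_zero, mul_zero, Real.exp_zero, one_mul]
  congr 1
  rw [zero_pow two_ne_zero, zero_pow m.succ_ne_zero, zero_add]
  ring

/-- Moments of the running supremum of the Lyapunov process. -/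
theorem lintegral_iSup_lyapunovProcess_rpow_le [IsProbabilityMeasure P] {θ : ℝ} {K : ℝ≥0∞}
    (hθ0 : 0 < θ)
    (hK : ∀ (μ : Measure Ω) (f : Ω → ℝ≥0∞) (M : ℝ≥0∞), Measurable f →
      (∀ a : ℝ≥0∞, a * μ {ω | a < f ω} ≤ M) → μ univ ≤ M → ∫⁻ ω, f ω ^ θ ∂μ ≤ K * M)
    (hbm : Measurable (Function.uncurry b)) (hΦ : Measurable (Function.uncurry Φ))
    (hΦ0 : ∀ x, Φ 0 x = x) (hε : 0 < ε)
    (hstep : ∀ t : ℝ, 0 ≤ t → ∀ x z : EuclideanSpace ℝ (Fin d),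
      ∫⁻ r, (ENNReal.ofReal (lyapunov Φ l ε m x (t + ε * r) (z + ε • b (t + ε * r) z)) +
          ENNReal.ofReal (waitingCost c l ε m x t z r)) ∂(expMeasure 1) ≤
        ENNReal.ofReal (lyapunov Φ l ε m x t z))
    (hξ : Measurable ξ) (hτ : ∀ k, Measurable (τ k))
    (hlaw : ∀ k, HasLaw (τ k) (expMeasure 1) P) (hi : iIndepFun τ P)
    (hξτ : Indep (MeasurableSpace.comap ξ inferInstance)
      (⨆ k, MeasurableSpace.comap (τ k) inferInstance) P) :
    ∫⁻ ω, (⨆ n, lyapunovProcess b Φ l c ε m τ ξ n ω) ^ θ ∂P ≤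
      K * ∫⁻ ω, ENNReal.ofReal (ε ^ (m + 1) * ((1 + 2 * ‖ξ ω‖) ^ 2) ^ (m + 1)) ^ θ ∂P := by
  set N : Ω → ℝ≥0∞ := fun ω =>
    ENNReal.ofReal (ε ^ (m + 1) * ((1 + 2 * ‖ξ ω‖) ^ 2) ^ (m + 1)) with hN
  have hN0 : ∀ ω, N ω ≠ 0 := fun ω => (ENNReal.ofReal_pos.2 (by positivity)).ne'
  have hNtop : ∀ ω, N ω ≠ ∞ := fun ω => ENNReal.ofReal_ne_top
  have hNF : ∀ n, Measurable[waitingFiltration hξ hτ n] N := by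
    intro n
    have h1 : Measurable fun x : EuclideanSpace ℝ (Fin d) =>
      ENNReal.ofReal (ε ^ (m + 1) * ((1 + 2 * ‖x‖) ^ 2) ^ (m + 1)) := by fun_prop
    exact h1.comp (measurable_waitingFiltration_init hξ hτ n)
  have hNm : Measurable N := (hNF 0).mono ((waitingFiltration hξ hτ).le 0) le_rfl
  have hρm : Measurable fun ω => N ω ^ θ := hNm.pow_const θ
  -- Normalising by the initial value gives `V 0 = 1`, and weighting `P` by `N ^ θ` restores the
  -- scale afterwards. Both factors are known at time zero, so the supermartingale property
  -- persists; the result is a bound by `E N ^ θ` without any assumption on the moments of `N`.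
  set V : ℕ → Ω → ℝ≥0∞ := fun n ω => (N ω)⁻¹ * lyapunovProcess b Φ l c ε m τ ξ n ω with hV
  have hVF : ∀ n, Measurable[waitingFiltration hξ hτ n] (V n) := fun n =>
    (hNF n).inv.mul (measurable_lyapunovProcess hbm hΦ hξ hτ n)
  have hVm : ∀ n, Measurable (V n) := fun n =>
    (hVF n).mono ((waitingFiltration hξ hτ).le n) le_rfl
  set μ : Measure Ω := P.withDensity fun ω => N ω ^ θ with hμ
  have hset : ∀ n A, MeasurableSet A → ∫⁻ ω in A, V n ω ∂μ =
      ∫⁻ ω, A.indicator (fun ω => N ω ^ θ * (N ω)⁻¹) ω * lyapunovProcess b Φ l c ε m τ ξ n ω ∂P := by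
    intro n A hA
    rw [hμ, setLIntegral_withDensity_eq_setLIntegral_mul P hρm (hVm n) hA,
      ← lintegral_indicator hA]
    refine lintegral_congr fun ω => ?_
    by_cases hω : ω ∈ A
    · simp [hω, hV, mul_assoc]
    · simp [hω]
  have hsup : ∀ n A, MeasurableSet[waitingFiltration hξ hτ n] A →
      ∫⁻ ω in A, V (n + 1) ω ∂μ ≤ ∫⁻ ω in A, V n ω ∂μ := by
    intro n A hA
    have hA' := (waitingFiltration hξ hτ).le n A hA
    rw [hset _ A hA', hset _ A hA']
    exact lintegral_mul_lyapunovProcess_succ_le hbm hΦ hε hstep hξ hτ hlaw hi hξτ n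
      ((((hNF n).pow_const θ).mul (hNF n).inv).indicator hA)
  have hV0 : ∀ ω, V 0 ω = 1 := fun ω => by
    simp only [hV, lyapunovProcess_zero hΦ0]
    exact ENNReal.inv_mul_cancel (hN0 ω) (hNtop ω)
  have hμuniv : μ univ = ∫⁻ ω, N ω ^ θ ∂P := by
    rw [hμ, withDensity_apply _ MeasurableSet.univ, Measure.restrict_univ]
  have hweak := fun a => mul_measure_exists_le (μ := μ) hVF hsup a
  simp only [hV0, lintegral_one, hμuniv] at hweak
  have h := hK μ (fun ω => ⨆ n, V n ω) _ (Measurable.iSup hVm) hweak hμuniv.le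
  refine le_trans (le_of_eq ?_) h
  rw [hμ, lintegral_withDensity_eq_lintegral_mul P hρm ((Measurable.iSup hVm).pow_const θ)]
  refine lintegral_congr fun ω => ?_
  simp only [Pi.mul_apply, hV]
  rw [← ENNReal.mul_iSup, ← ENNReal.mul_rpow_of_nonneg _ _ hθ0.le, ← mul_assoc,
    ENNReal.mul_inv_cancel (hN0 ω) (hNtop ω), one_mul]

end LyapunovProcess

/-! ### The convergence rate -/

section Rate

variable {d : ℕ} {κ : ℝ} {b Φ : ℝ → EuclideanSpace ℝ (Fin d) → EuclideanSpace ℝ (Fin d)}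
  {Ω : Type*} {τ : ℕ → Ω → ℝ} {ξ : Ω → EuclideanSpace ℝ (Fin d)} {ω : Ω}

theorem two_mul_add_two_mul_pow_le {α β : ℝ} (hα : 0 ≤ α) (hβ : 0 ≤ β) (j : ℕ) :
    (2 * α + 2 * β) ^ j ≤ 4 ^ j * (α ^ j + β ^ j) := by
  have hα' : 0 ≤ α ^ j := by positivity
  have hβ' : 0 ≤ β ^ j := by positivity
  have h4 : (0 : ℝ) ≤ 4 ^ j := by positivity
  rcases le_total α β with h | h
  · calc (2 * α + 2 * β) ^ j ≤ (4 * β) ^ j := by gcongr; linarith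
      _ = 4 ^ j * β ^ j := mul_pow _ _ _
      _ ≤ _ := by gcongr; linarith
  · calc (2 * α + 2 * β) ^ j ≤ (4 * α) ^ j := by gcongr; linarith
      _ = 4 ^ j * α ^ j := mul_pow _ _ _
      _ ≤ _ := by gcongr; linarith

/-- The error up to time `T` is controlled by the running supremum of the Lyapunov process. -/
theorem ofReal_norm_sub_pow_le (hb : OneSidedLipschitzGrowth κ b) (hκ : 0 < κ)
    (hΦ : ∀ x, IsFilippovSolution b x (fun t => Φ t x)) {l c ε T t : ℝ} (hl : 0 < l) (hc : 0 < c)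
    (hε : 0 < ε) (hτ : ∀ k, 0 < τ k ω) (m : ℕ) (htT : t ≤ T) {n : ℕ}
    (h1 : ε * arrivalTime τ n ω ≤ t) (h2 : t < ε * arrivalTime τ (n + 1) ω) :
    ENNReal.ofReal ((‖randomEuler b (fun k => ε * arrivalTime τ k ω) ε (ξ ω) n -
        Φ t (ξ ω)‖ ^ 2) ^ (m + 1)) ≤
      ENNReal.ofReal (4 ^ (m + 1) * Real.exp (l * T) +
        4 ^ (m + 1) * ((κ * (2 * Real.exp (2 * κ * T))) ^ 2) ^ (m + 1) * c * Real.exp (l * T)) *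
      ⨆ n, lyapunovProcess b Φ l c ε m τ ξ n ω := by
  set K₁ := κ * (2 * Real.exp (2 * κ * T)) with hK₁
  have hK₁0 : 0 < K₁ := by positivity
  set s := ε * arrivalTime τ n ω with hs
  have hs0 : 0 ≤ s := mul_nonneg hε.le (arrivalTime_nonneg hτ n)
  set z := randomEuler b (fun k => ε * arrivalTime τ k ω) ε (ξ ω) n with hz
  set x := ξ ω
  have hsT : s ≤ T := h1.trans htT
  have hts : t - s ≤ ε * τ n ω := by
    rw [arrivalTime_succ, mul_add, ← hs] at h2
    linarith
  set γ := ε * τ n ω * (1 + ‖x‖ + ‖z‖) with hγ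
  have hτn := hτ n
  have hγ0 : 0 ≤ γ := by positivity
  -- Between jumps the scheme rests while the solution moves with bounded speed for at most the
  -- whole waiting time. `γ` is the quantity whose power the waiting cost measures.
  have hdist : ‖z - Φ t x‖ ≤ ‖Φ s x - z‖ + K₁ * γ := by
    have e1 := (hΦ x).norm_sub_le_mul hb hκ hs0 h1 htT
    have e2 : K₁ * ((1 + ‖x‖) * (t - s)) ≤ K₁ * γ := by
      rw [hγ]
      refine mul_le_mul_of_nonneg_left ?_ hK₁0.le
      rw [mul_comm]
      exact mul_le_mul hts (by linarith [norm_nonneg z]) (by positivity) (by positivity)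
    have e3 : κ * (2 * Real.exp (2 * κ * T) * (1 + ‖x‖)) * (t - s) =
        K₁ * ((1 + ‖x‖) * (t - s)) := by rw [hK₁]; ring
    rw [e3] at e1
    have e4 : z - Φ t x = -(Φ s x - z) - (Φ t x - Φ s x) := by abel
    rw [e4]
    refine (norm_sub_le _ _).trans ?_
    rw [norm_neg]
    linarith
  have hpow : (‖z - Φ t x‖ ^ 2) ^ (m + 1) ≤
      4 ^ (m + 1) * ((‖Φ s x - z‖ ^ 2) ^ (m + 1) + (K₁ ^ 2) ^ (m + 1) * (γ ^ 2) ^ (m + 1)) := by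
    rw [← mul_pow (K₁ ^ 2), ← mul_pow K₁]
    refine le_trans ?_ (two_mul_add_two_mul_pow_le (sq_nonneg _) (sq_nonneg _) _)
    gcongr
    have := pow_le_pow_left₀ (norm_nonneg _) hdist 2
    nlinarith [sq_nonneg (‖Φ s x - z‖ - K₁ * γ)]
  have hexp : 1 ≤ Real.exp (l * T) * Real.exp (-l * s) := by
    rw [← Real.exp_add]
    exact Real.one_le_exp (by nlinarith)
  have hly : (‖Φ s x - z‖ ^ 2) ^ (m + 1) ≤ Real.exp (l * T) * lyapunov Φ l ε m x s z := by
    rw [lyapunov, ← mul_assoc]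
    refine le_trans ?_ (le_mul_of_one_le_left (by positivity) hexp)
    exact le_add_of_nonneg_right (by positivity)
  have hwc : (γ ^ 2) ^ (m + 1) ≤ c * Real.exp (l * T) * waitingCost c l ε m x s z (τ n ω) := by
    rw [waitingCost, ← hγ]
    have : c * Real.exp (l * T) * (Real.exp (-l * s) * ((γ ^ 2) ^ (m + 1) / c)) =
        (Real.exp (l * T) * Real.exp (-l * s)) * (γ ^ 2) ^ (m + 1) := by field_simp
    rw [this]
    exact le_mul_of_one_le_left (by positivity) hexp
  have hW1 : ENNReal.ofReal (lyapunov Φ l ε m x s z) ≤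
      ⨆ n, lyapunovProcess b Φ l c ε m τ ξ n ω :=
    (lyapunov_le_lyapunovProcess b Φ l c ε m τ ξ n ω).trans
      (le_iSup (fun n => lyapunovProcess b Φ l c ε m τ ξ n ω) n)
  -- The cost of the interval containing `t` is charged at its right end, hence the index `n + 1`,
  -- even if that end lies beyond `T`. Its discount is taken at the left end `s ≤ T`, so `exp (l *
  -- T)` undoes it.
  have hW2 : ENNReal.ofReal (waitingCost c l ε m x s z (τ n ω)) ≤
      ⨆ n, lyapunovProcess b Φ l c ε m τ ξ n ω :=
    le_trans (le_add_self : _ ≤ lyapunovProcess b Φ l c ε m τ ξ (n + 1) ω)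
      (le_iSup (fun n => lyapunovProcess b Φ l c ε m τ ξ n ω) (n + 1))
  set A₁ := 4 ^ (m + 1) * Real.exp (l * T) with hA₁
  set A₂ := 4 ^ (m + 1) * (K₁ ^ 2) ^ (m + 1) * c * Real.exp (l * T) with hA₂
  have hA₁0 : 0 ≤ A₁ := by positivity
  have hA₂0 : 0 ≤ A₂ := by positivity
  have hly0 : 0 ≤ lyapunov Φ l ε m x s z := by rw [lyapunov]; positivity
  have hwc0 : 0 ≤ waitingCost c l ε m x s z (τ n ω) := by rw [waitingCost]; positivity
  calc ENNReal.ofReal ((‖z - Φ t x‖ ^ 2) ^ (m + 1))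
      ≤ ENNReal.ofReal (A₁ * lyapunov Φ l ε m x s z +
          A₂ * waitingCost c l ε m x s z (τ n ω)) := by
        refine ENNReal.ofReal_le_ofReal (hpow.trans ?_)
        calc _ ≤ 4 ^ (m + 1) * (Real.exp (l * T) * lyapunov Φ l ε m x s z +
              (K₁ ^ 2) ^ (m + 1) * (c * Real.exp (l * T) *
                waitingCost c l ε m x s z (τ n ω))) := by gcongr
          _ = _ := by rw [hA₁, hA₂]; ring
    _ = ENNReal.ofReal A₁ * ENNReal.ofReal (lyapunov Φ l ε m x s z) +
        ENNReal.ofReal A₂ * ENNReal.ofReal (waitingCost c l ε m x s z (τ n ω)) := by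
        rw [ENNReal.ofReal_add (by positivity) (by positivity), ENNReal.ofReal_mul hA₁0,
          ENNReal.ofReal_mul hA₂0]
    _ ≤ ENNReal.ofReal A₁ * (⨆ n, lyapunovProcess b Φ l c ε m τ ξ n ω) +
        ENNReal.ofReal A₂ * (⨆ n, lyapunovProcess b Φ l c ε m τ ξ n ω) := by gcongr
    _ = _ := by rw [← add_mul, ← ENNReal.ofReal_add hA₁0 hA₂0]

theorem ofReal_sq_pow_rpow {r p : ℝ} (hr : 0 ≤ r) {m : ℕ} :
    ENNReal.ofReal ((r ^ 2) ^ (m + 1)) ^ (p / ((m + 1 : ℕ) : ℝ)) = ENNReal.ofReal r ^ (2 * p) := by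
  rw [ENNReal.ofReal_pow (by positivity), ENNReal.ofReal_pow hr, ← ENNReal.rpow_natCast,
    ← ENNReal.rpow_natCast, ← ENNReal.rpow_mul, ← ENNReal.rpow_mul]
  congr 1
  have : ((m + 1 : ℕ) : ℝ) ≠ 0 := by positivity
  field_simp
  push_cast
  ring

theorem initial_rpow_le {r ε p : ℝ} (hr : 0 ≤ r) (hε : 0 < ε) {m : ℕ} (hp : 0 ≤ p) :
    ENNReal.ofReal (ε ^ (m + 1) * ((1 + 2 * r) ^ 2) ^ (m + 1)) ^ (p / ((m + 1 : ℕ) : ℝ)) ≤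
      ENNReal.ofReal (ε ^ p) * (3 ^ (2 * p) * (1 + ENNReal.ofReal r ^ (2 * p))) := by
  have hm : ((m + 1 : ℕ) : ℝ) ≠ 0 := by positivity
  have h2p : 0 ≤ 2 * p := by positivity
  rw [ENNReal.ofReal_mul (by positivity), ENNReal.mul_rpow_of_nonneg _ _ (by positivity),
    ofReal_sq_pow_rpow (by positivity), ENNReal.ofReal_pow hε.le, ← ENNReal.rpow_natCast,
    ← ENNReal.rpow_mul, mul_div_cancel₀ _ hm, ENNReal.ofReal_rpow_of_pos hε]
  refine mul_le_mul' le_rfl ?_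
  have h3 : ENNReal.ofReal (1 + 2 * r) ≤ 3 * max 1 (ENNReal.ofReal r) := by
    rw [← ENNReal.ofReal_one, ← ENNReal.ofReal_max, show (3 : ℝ≥0∞) = ENNReal.ofReal 3 by simp,
      ← ENNReal.ofReal_mul (by norm_num)]
    refine ENNReal.ofReal_le_ofReal ?_
    linarith [le_max_left 1 r, le_max_right 1 r]
  refine (ENNReal.rpow_le_rpow h3 h2p).trans ?_
  rw [ENNReal.mul_rpow_of_nonneg _ _ h2p]
  refine mul_le_mul' le_rfl ?_
  rcases le_total 1 (ENNReal.ofReal r) with h | h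
  · rw [max_eq_right h]; exact le_add_self
  · rw [max_eq_left h, ENNReal.one_rpow]; exact le_self_add

variable {mΩ : MeasurableSpace Ω} {P : Measure Ω}

theorem exists_solvesPoissonSDE [IsProbabilityMeasure P] {ε : ℝ} (hε : 0 < ε)
    (hτ : ∀ k, Measurable (τ k)) (hlaw : ∀ k, HasLaw (τ k) (expMeasure 1) P)
    (hi : iIndepFun τ P)
    (b : ℝ → EuclideanSpace ℝ (Fin d) → EuclideanSpace ℝ (Fin d))
    (ξ : Ω → EuclideanSpace ℝ (Fin d)) :
    ∃ Y : ℝ → Ω → EuclideanSpace ℝ (Fin d), SolvesPoissonSDE P b τ ε ξ Y := by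
  refine ⟨fun t ω => randomEuler b (fun k => ε * arrivalTime τ k ω) ε (ξ ω)
    (poissonProcess τ (t / ε) ω), ?_⟩
  filter_upwards [ae_forall_pos hlaw, ae_tendsto_arrivalTime hτ hlaw hi] with ω h1 h2
  refine solves_of_eq_randomEuler h1 h2 hε fun n t ht1 ht2 => ?_
  rw [poissonProcess_eq h1 ((le_div_iff₀' hε).2 ht1) ((div_lt_iff₀' hε).2 ht2)]

end Rate

theorem theorem2p8 (d : ℕ) (κ T p : ℝ) (hκ : 0 < κ) (hT : 0 < T) (hp : 1 ≤ p) :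
    ∃ C : ℝ, 0 < C ∧
      ∀ b : ℝ → EuclideanSpace ℝ (Fin d) → EuclideanSpace ℝ (Fin d),
        Measurable (Function.uncurry b) → OneSidedLipschitzGrowth κ b →
        -- the Filippov solution from each starting point exists and is unique
        (∀ x₀ : EuclideanSpace ℝ (Fin d), ∃ X : ℝ → EuclideanSpace ℝ (Fin d),
          IsFilippovSolution b x₀ X ∧
            ∀ Y : ℝ → EuclideanSpace ℝ (Fin d), IsFilippovSolution b x₀ Y → EqOn Y X (Ici 0)) ∧
        -- the convergence rate
        ∀ (Ω : Type*) (F₀ : MeasurableSpace Ω) [mΩ : MeasurableSpace Ω] (P : Measure Ω)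
          [IsProbabilityMeasure P] (τ : ℕ → Ω → ℝ) (ξ : Ω → EuclideanSpace ℝ (Fin d))
          (X : ℝ → Ω → EuclideanSpace ℝ (Fin d)),
          (∀ k, Measurable[mΩ] (τ k)) → (∀ k, HasLaw (τ k) (expMeasure 1) P) → iIndepFun τ P →
          F₀ ≤ mΩ →
          Indep F₀ (⨆ k, MeasurableSpace.comap (τ k) inferInstance) P →
          Measurable[F₀] ξ → (∀ q : ℝ≥0∞, 1 < q → q ≠ ∞ → MemLp ξ q P) →
          (∀ᵐ ω ∂P, IsFilippovSolution b (ξ ω) (fun t => X t ω)) →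
          ∀ ε : ℝ, 0 < ε → ε < 1 →
            (∃ Y : ℝ → Ω → EuclideanSpace ℝ (Fin d), SolvesPoissonSDE P b τ ε ξ Y) ∧
            ∀ Y : ℝ → Ω → EuclideanSpace ℝ (Fin d), SolvesPoissonSDE P b τ ε ξ Y →
              ∫⁻ ω, (⨆ t ∈ Icc (0 : ℝ) T, ‖Y t ω - X t ω‖ₑ ^ (2 * p)) ∂P ≤
                ENNReal.ofReal C * (1 + ∫⁻ ω, ‖ξ ω‖ₑ ^ (2 * p) ∂P) *
                  ENNReal.ofReal (ε ^ p) := by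
  have hp0 : 0 < p := by linarith
  -- An integer exponent above `p` makes `θ = p / (m + 1)` less than one, as the weak-type bound
  -- requires, while `(ε ^ (m + 1)) ^ θ = ε ^ p`. All constants are fixed here, before `b` and `Ω`
  -- appear.
  obtain ⟨m, hm⟩ := exists_nat_gt p
  obtain ⟨l, c, hl, hc, hstep⟩ := exists_lintegral_lyapunov_le hκ m
  set θ : ℝ := p / ((m + 1 : ℕ) : ℝ) with hθ
  have hm1 : (0 : ℝ) < ((m + 1 : ℕ) : ℝ) := by positivity
  have hθ0 : 0 < θ := by positivity
  have hθ1 : θ < 1 := by rw [hθ, div_lt_one hm1]; push_cast; linarith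
  obtain ⟨K, hK, hKθ⟩ := exists_lintegral_rpow_le hθ0 hθ1
  set C₁ : ℝ := 4 ^ (m + 1) * Real.exp (l * T) +
    4 ^ (m + 1) * ((κ * (2 * Real.exp (2 * κ * T))) ^ 2) ^ (m + 1) * c * Real.exp (l * T) with hC₁
  set C₂ : ℝ≥0∞ := ENNReal.ofReal C₁ ^ θ * K * 3 ^ (2 * p) with hC₂
  have hC₂top : C₂ ≠ ∞ := ENNReal.mul_ne_top (ENNReal.mul_ne_top
    (ENNReal.rpow_ne_top_of_nonneg hθ0.le ENNReal.ofReal_ne_top) hK)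
    (ENNReal.rpow_ne_top_of_nonneg (by positivity) (by norm_num))
  refine ⟨C₂.toReal + 1, by positivity, fun b hbm hb => ⟨fun x₀ => ?_, ?_⟩⟩
  · obtain ⟨X, hX, -⟩ := hb.exists_isFilippovSolution hκ hbm x₀
    exact ⟨X, hX, fun Y hY => hY.eqOn hb hκ hX⟩
  intro Ω F₀ mΩ P _ τ ξ X hτ hlaw hi hF hind hξF _ hX ε hε hε1
  refine ⟨exists_solvesPoissonSDE hε hτ hlaw hi b ξ, fun Y hY => ?_⟩
  -- Nothing is assumed about the measurability of `X` in `ω`. By uniqueness it agrees almost surely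
  -- with the jointly measurable flow evaluated at `ξ`.
  obtain ⟨Φ, hΦm, hΦ⟩ := hb.exists_measurable_flow hκ hbm
  have hξ : Measurable[mΩ] ξ := hξF.mono hF le_rfl
  have hξτ := indep_of_indep_of_le_left hind hξF.comap_le
  have hbound := lintegral_iSup_lyapunovProcess_rpow_le hθ0 hKθ hbm hΦm
    (fun x => (hΦ x).initial) hε (fun t ht => hstep hb hbm Φ hΦm hΦ ε t hε hε1 ht)
    hξ hτ hlaw hi hξτ
  have hpath : ∀ᵐ ω ∂P, (⨆ t ∈ Icc (0 : ℝ) T, ‖Y t ω - X t ω‖ₑ ^ (2 * p)) ≤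
      ENNReal.ofReal C₁ ^ θ * (⨆ n, lyapunovProcess b Φ l c ε m τ ξ n ω) ^ θ := by
    filter_upwards [hY, hX, ae_forall_pos hlaw, ae_tendsto_arrivalTime hτ hlaw hi]
      with ω hYω hXω h1 h2
    refine iSup₂_le fun t ht => ?_
    obtain ⟨n, hn1, hn2⟩ := exists_mul_arrivalTime_le_lt h2 hε ht.1
    have hYt := eq_randomEuler_of_solves (Y := fun t => Y t ω) h1 h2 hε hYω n t hn1 hn2
    have hXt : X t ω = Φ t (ξ ω) := hXω.eqOn hb hκ (hΦ (ξ ω)) ht.1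
    have := ofReal_norm_sub_pow_le (ξ := ξ) hb hκ hΦ hl hc hε h1 m ht.2 hn1 hn2
    rw [← ENNReal.mul_rpow_of_nonneg _ _ hθ0.le, ← ofReal_norm,
      ← ofReal_sq_pow_rpow (norm_nonneg _) (m := m)]
    refine ENNReal.rpow_le_rpow ?_ hθ0.le
    rw [hXt]
    change Y t ω = _ at hYt
    rw [hYt]
    exact this
  have hC₁top : ENNReal.ofReal C₁ ^ θ ≠ ∞ :=
    ENNReal.rpow_ne_top_of_nonneg hθ0.le ENNReal.ofReal_ne_top
  have h3top : (3 : ℝ≥0∞) ^ (2 * p) ≠ ∞ :=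
    ENNReal.rpow_ne_top_of_nonneg (by positivity) (by norm_num)
  calc ∫⁻ ω, (⨆ t ∈ Icc (0 : ℝ) T, ‖Y t ω - X t ω‖ₑ ^ (2 * p)) ∂P
      ≤ ∫⁻ ω, ENNReal.ofReal C₁ ^ θ *
        (⨆ n, lyapunovProcess b Φ l c ε m τ ξ n ω) ^ θ ∂P := lintegral_mono_ae hpath
    _ = ENNReal.ofReal C₁ ^ θ *
        ∫⁻ ω, (⨆ n, lyapunovProcess b Φ l c ε m τ ξ n ω) ^ θ ∂P :=
      lintegral_const_mul' _ _ hC₁top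
    _ ≤ ENNReal.ofReal C₁ ^ θ * (K * ∫⁻ ω, ENNReal.ofReal (ε ^ p) *
        (3 ^ (2 * p) * (1 + ‖ξ ω‖ₑ ^ (2 * p))) ∂P) := by
      refine mul_le_mul' le_rfl (hbound.trans (mul_le_mul' le_rfl (lintegral_mono fun ω => ?_)))
      rw [← ofReal_norm]
      exact initial_rpow_le (norm_nonneg _) hε hp0.le
    _ = C₂ * (1 + ∫⁻ ω, ‖ξ ω‖ₑ ^ (2 * p) ∂P) * ENNReal.ofReal (ε ^ p) := by
      rw [lintegral_const_mul' _ _ ENNReal.ofReal_ne_top, lintegral_const_mul' _ _ h3top,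
        lintegral_add_left measurable_const, lintegral_one, measure_univ, hC₂]
      ring
    _ ≤ _ := by
      gcongr
      rw [ENNReal.le_ofReal_iff_toReal_le hC₂top (by positivity)]
      linarith
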